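/- Throughout, computability is that of type-two computability theory. Names are elements of Baire space $\mathbb N^{\mathbb N}$; a representation of a set $S$ is a partial surjection $\delta:\subseteq\mathbb N^{\mathbb N}\to S$; a multivalued operation $f:\subseteq S\rightrightarrows T$ is $(\delta,\delta')$-computable if some computable partial function on Baire space maps every $\delta$-name of every $x\in\operatorname{dom} f$ to a $\delta'$-name of some element of $f(x)$; and $\delta\le\delta'$ means that $\delta$-names can be computably translated to $\delta'$-names of the same objects. $\langle p,q\rangle$ denotes pairing on Baire space, $\eta$ is the standard representation of the continuous partial functions $\subseteq\mathbb N^{\mathbb N}\to\mathbb N^{\mathbb N}$ with $G_\delta$ domain, $[\delta,\delta']$ is the product of representations and $\delta\sqcap\delta'$ their meet (a name consists of a $\delta$-name and a $\delta'$-name of the same object). Let $(X,d,\nu)$ be a computable metric space: $(X,d)$ is a metric space, $\nu:\mathbb N\to X$ has dense range and $(i,j)\mapsto d(\nu(i),\nu(j))$ is computable. Points are given by the Cauchy representation $\delta_X$: $p$ is a name of $x$ if $d(\nu(p_i),\nu(p_j))<2^{-\min\{i,j\}}$ for all $i,j$ and $\nu(p_i)\to x$. Ideal balls are the balls $B(\nu(a),q)$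 with $a\in\mathbb N$ and $q>0$ rational. Let * $\Sigma^0_1(X)$ be the open sets, where a name of $U$ enumerates ideal balls with union $U$, and $\Pi^0_1(X)$ the closed sets, where a name of $A$ is a $\Sigma^0_1(X)$-name of $X\setminus A$, with representation $\delta_{\Pi^0_1(X)}$; * $\delta_{\mathrm{range}}$ be the representation of the closed sets $A$ in which a name of $A\ne\emptyset$ encodes a sequence of $\delta_X$-names of points that are dense in $A$, with a separate name for $\emptyset$; * $\delta^{>}_{\mathrm{dist}}$ be the representation of the closed sets $A$ in which a name $p$ of $A$ is such that $\eta_p$ maps each $\delta_X$-name of each $x\in X$ to an enumeration of all rationals below $d(x,A)\in[0,\infty]$, where $d(x,\emptyset)=\infty$; * $\delta_{\mathrm{mc}}$ be the minimal cover representation of the set $\mathcal K(X)$ of compact sets: a name of $K$ lists the codes of all finite covers of $K$ by ideal balls each of which meets $K$; * $C$ be the set of continuous partial maps $f:\subseteq X\to X$ with closed domain, where $\langle p,q\rangle$ is a name of $f$ if $\eta_p$ maps each $\delta_X$-name of each $x\in\operatorname{dom} f$ to a $\delta_X$-name of $f(x)$ and $q$ is a $\Pi^0_1(X)$-name of $\operatorname{dom}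 f$. Let $\mathcal Y$ be a class of closed sets $A\subseteq X$ with $\dim A\le 0$, with a representation $\delta_{\mathcal Y}$ such that $\delta_{\mathcal Y}\le\delta_{\Pi^0_1(X)}$. Consider the following operations. * $E':\subseteq\mathcal Y\times\{\text{closed subsets of }X\}\rightrightarrows C$, with domain $\{(A,B): A\in\mathcal Y,\ \emptyset\ne B\subseteq A,\ B\ne X,\ B \text{ closed}\}$ and $E'(A,B)=\{f: \operatorname{dom} f=A,\ f(A)=B,\ f|_B=\mathrm{id}_B\}$; here $(A,B)$ is named by $[\delta_{\mathcal Y},\delta_{\mathrm{range}}\sqcap\delta^{>}_{\mathrm{dist}}]$. * $N:\subseteq\Pi^0_1(X)^2\times\mathcal Y\rightrightarrows\Sigma^0_1(X)^2$, with domain $\{(A,B,Y): A\cap B=\emptyset\}$ and $N(A,B,Y)=\{(U,V): A\subseteq U,\ B\subseteq V,\ Y\subseteq U\cup V,\ U\cap V=\emptyset\}$. * $M:\subseteq X\times\Sigma^0_1(X)\times\mathcal Y\rightrightarrows\Sigma^0_1(X)^2$, with domain $\{(x,U,Y): x\in U\}$ and $M(x,U,Y)=\{(V,W): x\in V\subseteq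 U,\ Y\subseteq V\cup W,\ V\cap W=\emptyset\}$. * $B$, with domain $\mathcal Y$, whose values at $Y$ are the triples $((U_i)_{i\in\mathbb N},(V_i)_{i\in\mathbb N},R)$, where $U_i,V_i$ are open, $U_i\cap V_i=\emptyset$ and $Y\subseteq U_i\cup V_i$ for every $i$, and $R\subseteq\mathbb N^2$ satisfies, with $\alpha$ the standard numbering of the ideal balls: $(i,a)\in R$ implies $U_i\cap Y\subseteq\alpha(a)$, and for all $a$ and $x\in\alpha(a)\cap Y$ there is $i$ with $(i,a)\in R$ and $x\in U_i$. Here the sequences are named by sequences of $\Sigma^0_1(X)$-names and $R$ by an enumeration. * $S:\subseteq\Sigma^0_1(X)^{\mathbb N}\times\mathcal Y\rightrightarrows\Sigma^0_1(X)^{\mathbb N}$, with domain $\{((U_i)_i,Y): Y\subseteq\bigcup_i U_i\}$ and $S((U_i)_i,Y)=\{(W_i)_i: W_i\subseteq U_i \text{ for all } i,\ Y\subseteq\bigcup_i W_i,\ W_i\cap W_j=\emptyset \text{ for } i\ne j\}$. Call $(\mathcal Y,\delta_{\mathcal Y})$ uniformly effectively zero-dimensional if $S$ is computable. **Corollary.**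 Suppose that $Y\cup\{x\}\in\mathcal Y$ for all $x\in X$, $Y\in\mathcal Y$ and that $\gamma:X\times\mathcal Y\to\mathcal Y$, $(x,Y)\mapsto Y\cup\{x\}$, is computable. Suppose further that $Y\cap\{y: d(x,y)\le 2^{-n}\}$ is compact for all $x\in X$, $n\in\mathbb N$, $Y\in\mathcal Y$ and that $\beta:X\times\mathbb N\times\mathcal Y\to\mathcal K(X)$, $(x,n,Y)\mapsto Y\cap\{y: d(x,y)\le 2^{-n}\}$, is computable with respect to $\delta_{\mathrm{mc}}$. Then $E'$ is computable if and only if $(\mathcal Y,\delta_{\mathcal Y})$ is uniformly effectively zero-dimensional. Moreover, computability of $N$, of $M$, of $B$ and of $S$ are equivalent conditions. -/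

import Mathlib

open Set Filter Topology

namespace TTE

/-! ### Computability on Baire space -/

/-- Baire space `ℕ → ℕ`; its elements serve as names. -/
abbrev Baire : Type := ℕ → ℕ

/-- The finite prefix `q 0, …, q (m - 1)`. -/
def prefixOf (q : Baire) (m : ℕ) : List ℕ := (List.range m).map q

/-- The canonical representation `η` of the continuous partial functions `⊆ Baire → Baire` with
`G_δ` domain, as a relation: `Eta a q r` says that `q` lies in the domain of `η_a` and that
`η_a (q) = r`. The sequence `a` tabulates, for every `n` and every finite prefix `w` of the input,
either `0` (the prefix is too short to determine the output symbol number `n`) or `v + 1`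
(the output symbol number `n` is `v`); the first nonzero entry along the input counts. -/
def Eta (a q r : Baire) : Prop :=
  ∀ n, ∃ m, a (Nat.pair n (Encodable.encode (prefixOf q m))) = r n + 1 ∧
    ∀ k < m, a (Nat.pair n (Encodable.encode (prefixOf q k))) = 0

/-- First component of the pairing `⟨p, q⟩` on Baire space (interleaving). -/
def left (p : Baire) : Baire := fun n => p (2 * n)

/-- Second component of the pairing `⟨p, q⟩` on Baire space (interleaving). -/
def right (p : Baire) : Baire := fun n => p (2 * n + 1)

/-- The `i`-th component of the countable tupling `⟨p⁽⁰⁾, p⁽¹⁾, …⟩`. -/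
def component (p : Baire) (i : ℕ) : Baire := fun k => p (Nat.pair i k)

/-! ### Naming relations, representations, multivalued operations -/

/-- A naming relation; `δ p x` says that `p` is a `δ`-name of `x`. -/
abbrev Naming (α : Type*) : Type _ := Baire → α → Prop

/-- `δ` is a representation of the set `S`: a partial surjection from Baire space onto `S`. -/
structure IsRepresentation {α : Type*} (δ : Naming α) (S : Set α) : Prop where
  functional : ∀ p x y, δ p x → δ p y → x = y
  mem : ∀ p x, δ p x → x ∈ S
  surjective : ∀ x ∈ S, ∃ p, δ p x

/-- The reduction `δ ≤ δ'`: names are translated by a computable partial function. -/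
def Reducible {α : Type*} (δ δ' : Naming α) : Prop :=
  ∃ a : Baire, Computable a ∧ ∀ p x, δ p x → ∃ r, Eta a p r ∧ δ' r x

/-- A multivalued partial operation `⊆ α ⇉ β`. -/
structure Operation (α β : Type*) where
  dom : Set α
  val : α → Set β

/-- An everywhere defined single-valued operation on a set. -/
def Operation.ofFun {α β : Type*} (s : Set α) (f : α → β) : Operation α β where
  dom := s
  val := fun x => {f x}

/-- `(δ, δ')`-computability: some computable partial function on Baire space maps every name of
every point of the domain to a name of one of the values of the operation at that point. -/
def Operation.IsComputable {α β : Type*} (f : Operation α β) (δ : Naming α) (δ' : Naming β) :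
    Prop :=
  ∃ a : Baire, Computable a ∧
    ∀ x ∈ f.dom, ∀ p, δ p x → ∃ r, Eta a p r ∧ ∃ y ∈ f.val x, δ' r y

/-- The product representation `[δ, δ']`. -/
def prodName {α β : Type*} (δ : Naming α) (δ' : Naming β) : Naming (α × β) :=
  fun p x => δ (left p) x.1 ∧ δ' (right p) x.2

/-- The representation `δ^ω` of sequences. -/
def seqName {α : Type*} (δ : Naming α) : Naming (ℕ → α) :=
  fun p x => ∀ i, δ (component p i) (x i)

/-- The meet `δ ⊓ δ'`: a name supplies a `δ`-name and a `δ'`-name of the same object. -/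
def meetName {α : Type*} (δ δ' : Naming α) : Naming α :=
  fun p x => δ (left p) x ∧ δ' (right p) x

/-- The representation `p ↦ p 0` of the natural numbers. -/
def natName : Naming ℕ := fun p n => p 0 = n

/-- Enumerations (with padding by `0`) of sets of pairs of natural numbers. -/
def enumName : Naming (Set (ℕ × ℕ)) :=
  fun p R => R = {c | ∃ i, p i = Nat.pair c.1 c.2 + 1}

/-- Standard total numbering of the positive rationals. -/
def posRat (k : ℕ) : ℚ := ((k.unpair.1 : ℚ) + 1) / ((k.unpair.2 : ℚ) + 1)

/-- Standard total numbering of the rationals. -/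
def rat (k : ℕ) : ℚ :=
  ((k.unpair.1.unpair.1 : ℚ) - (k.unpair.1.unpair.2 : ℚ)) / ((k.unpair.2 : ℚ) + 1)

/-- Extended reals named from below: the name enumerates all rationals strictly below `t`. -/
def lowerName : Naming EReal :=
  fun p t => {n : ℕ | (((rat n : ℚ) : ℝ) : EReal) < t} = {n | ∃ i, p i = n + 1}

/-! ### Computable metric spaces and their hyperspaces -/

/-- `(X, d, ν)` is a computable metric space: `ν` is a dense sequence and the real numbers
`d (ν i, ν j)` are computable uniformly in `i, j`. -/
structure IsComputableMetricSpace {X : Type*} [MetricSpace X] (ν : ℕ → X) : Prop where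
  dense : DenseRange ν
  computable_dist : ∃ f : ℕ × ℕ × ℕ → ℕ, Computable f ∧
    ∀ i j k, |dist (ν i) (ν j) - ((rat (f (i, j, k)) : ℚ) : ℝ)| ≤ (2 : ℝ)⁻¹ ^ k

section Spaces

variable {X : Type*} [MetricSpace X] (ν : ℕ → X)

/-- The Cauchy representation of `X`. -/
def cauchyName : Naming X :=
  fun p x => (∀ i j, dist (ν (p i)) (ν (p j)) < (2 : ℝ)⁻¹ ^ (min i j)) ∧
    Tendsto (fun i => ν (p i)) atTop (𝓝 x)

/-- The standard numbering of the ideal open balls. -/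
def idealBall (c : ℕ) : Set X :=
  Metric.ball (ν c.unpair.1) ((posRat c.unpair.2 : ℚ) : ℝ)

/-- The representation of the open sets by enumerating ideal balls that exhaust them. -/
def openName : Naming (Set X) :=
  fun p U => U = ⋃ c ∈ {c : ℕ | ∃ i, p i = c + 1}, idealBall ν c

/-- The representation of the closed sets by negative information. -/
def closedName : Naming (Set X) := fun p A => openName ν p Aᶜ

/-- The representation of the closed sets by a dense sequence of points (positive information);
the empty set has the single name `0^ω`. -/
def rangeName : Naming (Set X) :=
  fun p A => IsClosed A ∧
    ((A = ∅ ∧ ∀ i, p i = 0) ∨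
      (A ≠ ∅ ∧ (∀ i, 1 ≤ p i) ∧ ∃ y : ℕ → X,
        (∀ i, cauchyName ν (fun k => component p i k - 1) (y i)) ∧
          (∀ i, y i ∈ A) ∧ A ⊆ closure (range y)))

/-- The representation of the closed sets by the distance function as a lower semicontinuous
function into the extended reals (with `d(x, ∅) = ∞`). -/
noncomputable def distName : Naming (Set X) :=
  fun a A => IsClosed A ∧
    ∀ q x, cauchyName ν q x → ∃ r, Eta a q r ∧ lowerName r (Metric.infEDist x A : EReal)

/-- The minimal cover representation of the compact sets: a name lists (the codes of) all finite
covers of `K` by ideal balls each of which meets `K`. -/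
def minCoverName : Naming (Set X) :=
  fun p K => IsCompact K ∧
    range p = {c | ∃ w : List ℕ, c = Encodable.encode w ∧
      (K ⊆ ⋃ b ∈ {b | b ∈ w}, idealBall ν b) ∧ ∀ b ∈ w, (idealBall ν b ∩ K).Nonempty}

/-- `η_a` realizes the partial function `f : ⊆ X → X`. -/
def RealizesMap (a : Baire) (f : X →. X) : Prop :=
  ∀ p x, cauchyName ν p x → ∀ y ∈ f x, ∃ r, Eta a p r ∧ cauchyName ν r y

/-- The continuous partial functions `⊆ X → X` with closed domain. -/
def partialMaps : Set (X →. X) := {f | IsClosed f.Dom ∧ ∃ a, RealizesMap ν a f}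

/-- The representation of `partialMaps`: a realizer, and negative information on the domain. -/
def partialMapName : Naming (X →. X) :=
  fun p f => RealizesMap ν (left p) f ∧ closedName ν (right p) f.Dom

/-! ### The operations -/

/-- `γ : X × 𝒴 → 𝒴` adds a point. -/
def opAddPoint (𝒴 : Set (Set X)) : Operation (X × Set X) (Set X) :=
  Operation.ofFun {z | z.2 ∈ 𝒴} fun z => insert z.1 z.2

/-- `β : X × ℕ × 𝒴 → 𝒦(X)` intersects with the closed ball of radius `2⁻ⁿ`. -/
noncomputable def opBall (𝒴 : Set (Set X)) : Operation (X × ℕ × Set X) (Set X) :=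
  Operation.ofFun {z | z.2.2 ∈ 𝒴} fun z => z.2.2 ∩ Metric.closedBall z.1 ((2 : ℝ)⁻¹ ^ z.2.1)

/-- The retraction operator `E'`: on `(A, B)` with `A ∈ 𝒴`, `B` closed, `∅ ≠ B ⊆ A`, `B ≠ X`, its
values are the continuous partial functions with domain `A` and image `B` that fix `B`
pointwise. -/
def opRetract (𝒴 : Set (Set X)) : Operation (Set X × Set X) (X →. X) where
  dom := {z | z.1 ∈ 𝒴 ∧ IsClosed z.2 ∧ z.2.Nonempty ∧ z.2 ⊆ z.1 ∧ z.2 ≠ univ}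
  val := fun z => {f | f ∈ partialMaps ν ∧ f.Dom = z.1 ∧ f.ran = z.2 ∧ ∀ b ∈ z.2, b ∈ f b}

/-- Computability of `E'`: the set `A` is given by a name in `𝒴`, and `B` by positive information
together with its distance function from below. -/
def RetractComputable (𝒴 : Set (Set X)) (δ : Naming (Set X)) : Prop :=
  (opRetract ν 𝒴).IsComputable (prodName δ (meetName (rangeName ν) (distName ν)))
    (partialMapName ν)

/-- The operation `N` (vanishing large inductive dimension). -/
def opN (𝒴 : Set (Set X)) : Operation (Set X × Set X × Set X) (Set X × Set X) where
  dom := {z | IsClosed z.1 ∧ IsClosed z.2.1 ∧ z.2.2 ∈ 𝒴 ∧ Disjoint z.1 z.2.1}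
  val := fun z => {o | IsOpen o.1 ∧ IsOpen o.2 ∧ z.1 ⊆ o.1 ∧ z.2.1 ⊆ o.2 ∧
    z.2.2 ⊆ o.1 ∪ o.2 ∧ Disjoint o.1 o.2}

def NComputable (𝒴 : Set (Set X)) (δ : Naming (Set X)) : Prop :=
  (opN 𝒴).IsComputable (prodName (closedName ν) (prodName (closedName ν) δ))
    (prodName (openName ν) (openName ν))

/-- The operation `M` (vanishing small inductive dimension). -/
def opM (𝒴 : Set (Set X)) : Operation (X × Set X × Set X) (Set X × Set X) where
  dom := {z | IsOpen z.2.1 ∧ z.2.2 ∈ 𝒴 ∧ z.1 ∈ z.2.1}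
  val := fun z => {o | IsOpen o.1 ∧ IsOpen o.2 ∧ z.1 ∈ o.1 ∧ o.1 ⊆ z.2.1 ∧
    z.2.2 ⊆ o.1 ∪ o.2 ∧ Disjoint o.1 o.2}

def MComputable (𝒴 : Set (Set X)) (δ : Naming (Set X)) : Prop :=
  (opM 𝒴).IsComputable (prodName (cauchyName ν) (prodName (openName ν) δ))
    (prodName (openName ν) (openName ν))

/-- The operation `B` (a countable basis of relatively clopen sets): on `Y ∈ 𝒴` its values consist
of a sequence of pairs of disjoint open sets `(U i, V i)` covering `Y` and a refined inclusion
`R` of the numbering `i ↦ U i ∩ Y` with respect to the numbering `a ↦ idealBall ν a ∩ Y`. So the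
sets `U i ∩ Y` form a basis of the topology of `Y`. -/
def opB (𝒴 : Set (Set X)) :
    Operation (Set X) ((ℕ → Set X) × (ℕ → Set X) × Set (ℕ × ℕ)) where
  dom := 𝒴
  val := fun Y => {o | (∀ i, IsOpen (o.1 i) ∧ IsOpen (o.2.1 i) ∧ Y ⊆ o.1 i ∪ o.2.1 i ∧
      Disjoint (o.1 i) (o.2.1 i)) ∧
    (∀ i a, (i, a) ∈ o.2.2 → o.1 i ∩ Y ⊆ idealBall ν a ∩ Y) ∧
    ∀ a, ∀ x ∈ idealBall ν a ∩ Y, ∃ i, (i, a) ∈ o.2.2 ∧ x ∈ o.1 i ∩ Y}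

def BComputable (𝒴 : Set (Set X)) (δ : Naming (Set X)) : Prop :=
  (opB ν 𝒴).IsComputable δ
    (prodName (seqName (openName ν)) (prodName (seqName (openName ν)) enumName))

/-- The operation `S` (reduction principle for sequences of open sets covering a set of `𝒴`). -/
def opS (𝒴 : Set (Set X)) : Operation ((ℕ → Set X) × Set X) (ℕ → Set X) where
  dom := {z | (∀ i, IsOpen (z.1 i)) ∧ z.2 ∈ 𝒴 ∧ z.2 ⊆ ⋃ i, z.1 i}
  val := fun z => {W | (∀ i, IsOpen (W i) ∧ W i ⊆ z.1 i) ∧ z.2 ⊆ ⋃ i, W i ∧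
    Pairwise fun i j => Disjoint (W i) (W j)}

def SComputable (𝒴 : Set (Set X)) (δ : Naming (Set X)) : Prop :=
  (opS 𝒴).IsComputable (prodName (seqName (openName ν)) δ) (seqName (openName ν))

/-- The represented class `(𝒴, δ)` is uniformly effectively zero-dimensional. -/
def UniformlyEffectivelyZeroDimensional (𝒴 : Set (Set X)) (δ : Naming (Set X)) : Prop :=
  SComputable ν 𝒴 δ

end Spaces

end TTE

namespace TTE

/-! ### Closure properties of computable functions -/

section Computable

variable {α β γ : Type*} [Primcodable α] [Primcodable β] [Primcodable γ]

/-! Every algorithm is expressed relative to a family of situations `t` with names `nm t`. `Semi`,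
`Comp`, `CRe` and `Named` express that predicates are semidecidable, discrete values and real
numbers computable, and objects nameable, uniformly in `nm t`. These notions are closed under
existential quantification, bounded universal quantification, search and application of a realizer,
so writing an algorithm amounts to writing a predicate or an open set. Since the situations of
`Operation.Input` contain the name of the input and not only the input, values of a multivalued
operation become functions of the situation.

The four conditions are linked by S → N → M → S and S ↔ B. For S → N, reduce the cover of `Y` by the
complements of `B` and `A`, then thicken by the complement of `Y`. N → M is N for a point and the
complement of its neighbourhood. For M → S and B → S, the given operation yields a semidecidable
countable family of disjoint open pairs `(V, W)` covering `Y`, each `V` lying in some member of the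
cover; taking the first `V` in an enumeration that contains the point gives disjoint pieces
(`Named.exists_reduction`). The difficulty in M → S is that M acts on names of arbitrary points; by
continuity finite words suffice (`Task.exists_of_semi`). For S → B, reduce the covers by balls of
radius `2⁻ᵏ`.

S → E': at every level `k`, S applied to the cover of `A` by the complement of `B` and by the
`2⁻ᵏ`-balls around a dense sequence of `B` assigns to each point of `A` a single piece. While these
pieces are balls, their centres converge to the point; once the complement of `B` is reported, the
sequence is frozen. The limit is a retraction onto `B` (`exists_freeze_limit`).

E' → M: a retraction of `Y ∪ {x, y}` onto `{x, y}` separates `x` from `y` by open sets covering `Y`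
(`Named.exists_separation`). Near `x`, the set `Y` is compact on a closed ball, so finitely many
such separations take care of the sphere, and the minimal cover name certifies when enough have been
found. Spaces with at most two points, where `{x, y}` may be all of `X`, are treated directly. -/

theorem computable_fst {f : α → β × γ} (h : Computable f) : Computable fun x => (f x).1 :=
  Computable.fst.comp h

theorem computable_snd {f : α → β × γ} (h : Computable f) : Computable fun x => (f x).2 :=
  Computable.snd.comp h

theorem computable_add {f g : α → ℕ} (hf : Computable f) (hg : Computable g) :
    Computable fun x => f x + g x := Primrec.nat_add.to_comp.comp hf hg

theorem computable_sub {f g : α → ℕ} (hf : Computable f) (hg : Computable g) :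
    Computable fun x => f x - g x := Primrec.nat_sub.to_comp.comp hf hg

theorem computable_mul {f g : α → ℕ} (hf : Computable f) (hg : Computable g) :
    Computable fun x => f x * g x := Primrec.nat_mul.to_comp.comp hf hg

theorem computable_div {f g : α → ℕ} (hf : Computable f) (hg : Computable g) :
    Computable fun x => f x / g x := Primrec.nat_div.to_comp.comp hf hg

theorem computable_mod {f g : α → ℕ} (hf : Computable f) (hg : Computable g) :
    Computable fun x => f x % g x := Primrec.nat_mod.to_comp.comp hf hg

theorem computable_pow {f g : α → ℕ} (hf : Computable f) (hg : Computable g) :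
    Computable fun x => f x ^ g x := by
  have : Computable fun x => Nat.rec (motive := fun _ => ℕ) 1 (fun _ r => r * f x) (g x) :=
    Computable.nat_rec hg (Computable.const 1)
      (computable_mul (computable_snd Computable.snd) (hf.comp Computable.fst)).to₂
  refine this.of_eq fun x => ?_
  induction g x with
  | zero => rfl
  | succ k ih => rw [pow_succ, ← ih]

theorem computable_natPair {f g : α → ℕ} (hf : Computable f) (hg : Computable g) :
    Computable fun x => Nat.pair (f x) (g x) := Primrec₂.natPair.to_comp.comp hf hg

theorem computable_unpair {f : α → ℕ} (hf : Computable f) :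
    Computable fun x => (f x).unpair := Computable.unpair.comp hf

theorem computable_encode {f : α → β} (hf : Computable f) :
    Computable fun x => Encodable.encode (f x) := Computable.encode.comp hf

theorem computable_decode {f : α → ℕ} (hf : Computable f) :
    Computable fun x => (Encodable.decode (f x) : Option β) := Computable.decode.comp hf

theorem computable_length {f : α → List β} (hf : Computable f) :
    Computable fun x => (f x).length := Computable.list_length.comp hf

theorem computable_getElem? {f : α → List β} {g : α → ℕ} (hf : Computable f)
    (hg : Computable g) : Computable fun x => (f x)[g x]? := Computable.list_getElem?.comp hf hg

theorem computable_getD {f : α → List ℕ} {g : α → ℕ} (hf : Computable f)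
    (hg : Computable g) : Computable fun x => (f x).getD (g x) 0 :=
  (Primrec.list_getD 0).to_comp.comp hf hg

theorem computable_some {f : α → β} (hf : Computable f) : Computable fun x => some (f x) :=
  Computable.option_some.comp hf

theorem computable_and {f g : α → Bool} (hf : Computable f) (hg : Computable g) :
    Computable fun x => f x && g x := Primrec.and.to_comp.comp hf hg

theorem computable_or {f g : α → Bool} (hf : Computable f) (hg : Computable g) :
    Computable fun x => f x || g x := Primrec.or.to_comp.comp hf hg

theorem computable_not {f : α → Bool} (hf : Computable f) :
    Computable fun x => !(f x) := Primrec.not.to_comp.comp hf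

theorem computable_decide_eq [DecidableEq β] {f g : α → β} (hf : Computable f)
    (hg : Computable g) : Computable fun x => decide (f x = g x) :=
  (Primrec.eq (α := β)).decide.to_comp.comp hf hg

theorem computable_blt {f g : α → ℕ} (hf : Computable f) (hg : Computable g) :
    Computable fun x => Nat.blt (f x) (g x) :=
  (Primrec.nat_lt.decide.to_comp.comp hf hg).of_eq fun x => by
    rw [Bool.eq_iff_iff, Nat.blt_eq, decide_eq_true_iff]

theorem computable_ble {f g : α → ℕ} (hf : Computable f) (hg : Computable g) :
    Computable fun x => Nat.ble (f x) (g x) :=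
  (Primrec.nat_le.decide.to_comp.comp hf hg).of_eq fun x => by
    rw [Bool.eq_iff_iff, Nat.ble_eq, decide_eq_true_iff]

theorem computable_cond {c : α → Bool} {f g : α → β} (hc : Computable c) (hf : Computable f)
    (hg : Computable g) : Computable fun x => bif c x then f x else g x :=
  Computable.cond hc hf hg

theorem computable_optionElim {o : α → Option β} {d : α → γ} {f : α → β → γ}
    (ho : Computable o) (hd : Computable d) (hf : Computable fun z : α × β => f z.1 z.2) :
    Computable fun x => (o x).elim (d x) (f x) := by
  refine (Computable.option_casesOn ho hd hf.to₂).of_eq fun x => ?_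
  cases o x <;> rfl

attribute [fun_prop] Computable

attribute [fun_prop] Computable.id Computable.const Computable.comp Computable.pair computable_fst
  computable_snd computable_add computable_sub computable_mul computable_div computable_mod
  computable_pow computable_natPair computable_unpair computable_encode computable_decode
  computable_length computable_getElem? computable_getD computable_some
  computable_and computable_or computable_not computable_decide_eq computable_blt
  computable_ble computable_cond computable_optionElim

/-- Bounded search for a witness. -/
def anyBelow (f : ℕ → Bool) (n : ℕ) : Bool := Nat.rec false (fun k r => r || f k) n

theorem anyBelow_iff {f : ℕ → Bool} {n : ℕ} : anyBelow f n = true ↔ ∃ k < n, f k = true := by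
  induction n with
  | zero => simp [anyBelow]
  | succ n ih =>
    have : anyBelow f (n + 1) = (anyBelow f n || f n) := rfl
    rw [this, Bool.or_eq_true, ih]
    constructor
    · rintro (⟨k, hk, h⟩ | h)
      exacts [⟨k, by omega, h⟩, ⟨n, by omega, h⟩]
    · rintro ⟨k, hk, h⟩
      rcases Nat.lt_succ_iff_lt_or_eq.1 hk with h' | rfl
      exacts [Or.inl ⟨k, h', h⟩, Or.inr h]

@[fun_prop]
theorem computable_anyBelow {f : α → ℕ → Bool} {n : α → ℕ}
    (hf : Computable fun z : α × ℕ => f z.1 z.2) (hn : Computable n) :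
    Computable fun x => anyBelow (f x) (n x) := by
  refine Computable.nat_rec hn (Computable.const false) (h := fun x (r : ℕ × Bool) =>
    r.2 || f x r.1) (Computable₂.mk ?_)
  have : Computable fun z : α × ℕ × Bool => f z.1 z.2.1 :=
    hf.comp (by fun_prop : Computable fun z : α × ℕ × Bool => (z.1, z.2.1))
  fun_prop

/-- The bounded universal quantifier. -/
def allBelow (f : ℕ → Bool) (n : ℕ) : Bool := !(anyBelow (fun k => !(f k)) n)

theorem allBelow_iff {f : ℕ → Bool} {n : ℕ} : allBelow f n = true ↔ ∀ k < n, f k = true := by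
  rw [allBelow, Bool.not_eq_true', ← Bool.not_eq_true, anyBelow_iff]
  simp

@[fun_prop]
theorem computable_allBelow {f : α → ℕ → Bool} {n : α → ℕ}
    (hf : Computable fun z : α × ℕ => f z.1 z.2) (hn : Computable n) :
    Computable fun x => allBelow (f x) (n x) := by
  unfold allBelow
  fun_prop

/-- The successor of the least witness below `n`, and `0` if there is none. -/
def firstBelow (f : ℕ → Bool) (n : ℕ) : ℕ :=
  Nat.rec 0 (fun k r => bif r = 0 then (bif f k then k + 1 else 0) else r) n

theorem firstBelow_succ (f : ℕ → Bool) (n : ℕ) : firstBelow f (n + 1) =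
    bif firstBelow f n = 0 then (bif f n then n + 1 else 0) else firstBelow f n := rfl

@[fun_prop]
theorem computable_firstBelow {f : α → ℕ → Bool} {n : α → ℕ}
    (hf : Computable fun z : α × ℕ => f z.1 z.2) (hn : Computable n) :
    Computable fun x => firstBelow (f x) (n x) := by
  refine Computable.nat_rec hn (Computable.const 0) (h := fun x (r : ℕ × ℕ) =>
    bif r.2 = 0 then (bif f x r.1 then r.1 + 1 else 0) else r.2) (Computable₂.mk ?_)
  have : Computable fun z : α × ℕ × ℕ => f z.1 z.2.1 :=
    hf.comp (by fun_prop : Computable fun z : α × ℕ × ℕ => (z.1, z.2.1))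
  fun_prop

theorem firstBelow_spec {f : ℕ → Bool} {n v : ℕ} (h : firstBelow f n = v + 1) :
    v < n ∧ f v = true := by
  induction n with
  | zero => simp [firstBelow] at h
  | succ n ih =>
    rw [firstBelow_succ] at h
    by_cases h0 : firstBelow f n = 0
    · by_cases h1 : f n = true
      · simp only [h0, h1, decide_true, cond_true] at h
        obtain rfl : n = v := by omega
        exact ⟨by omega, h1⟩
      · simp [h0, h1] at h
    · simp only [h0, decide_false, cond_false] at h
      exact ⟨(ih h).1.trans (by omega), (ih h).2⟩

theorem firstBelow_ne_zero {f : ℕ → Bool} {n v : ℕ} (hv : v < n) (h : f v = true) :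
    firstBelow f n ≠ 0 := by
  induction n with
  | zero => omega
  | succ n ih =>
    rw [firstBelow_succ]
    by_cases h0 : firstBelow f n = 0
    · rcases Nat.lt_succ_iff_lt_or_eq.1 hv with h' | rfl
      · exact absurd h0 (ih h')
      · simp [h0, h]
    · simp [h0]

/-- Searching longer and longer prefixes for an output symbol that is unique. -/
theorem exists_firstBelow {f : ℕ → ℕ → Bool} {r : ℕ} (huniq : ∀ m v, f m v = true → v = r)
    (hex : ∃ m, ∀ m' ≥ m, f m' r = true) :
    ∃ m, firstBelow (f m) m = r + 1 ∧ ∀ k < m, firstBelow (f k) k = 0 := by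
  have h1 : ∃ m, firstBelow (f m) m ≠ 0 := by
    obtain ⟨m, hm⟩ := hex
    exact ⟨max m (r + 1), firstBelow_ne_zero (by omega) (hm _ (le_max_left _ _))⟩
  classical
  refine ⟨Nat.find h1, ?_, fun k hk => not_not.1 (Nat.find_min h1 hk)⟩
  obtain ⟨v, hv⟩ := Nat.exists_eq_succ_of_ne_zero (Nat.find_spec h1)
  rw [hv, huniq _ _ (firstBelow_spec hv).2]

end Computable

/-! ### Semidecidable predicates and computable families relative to names -/

theorem length_prefixOf (q : Baire) (m : ℕ) : (prefixOf q m).length = m := by simp [prefixOf]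

theorem getElem?_prefixOf {q : Baire} {m i : ℕ} (h : i < m) : (prefixOf q m)[i]? = some (q i) := by
  simp [prefixOf, h]

theorem prefixOf_append (q : Baire) {m m' : ℕ} (h : m ≤ m') :
    ∃ v, prefixOf q m' = prefixOf q m ++ v := by
  obtain ⟨k, rfl⟩ := Nat.exists_eq_add_of_le h
  exact ⟨(List.map (fun x => m + x) (List.range k)).map q, by simp [prefixOf, List.range_add]⟩

theorem prefixOf_congr {q q' : Baire} {m : ℕ} (h : ∀ i < m, q i = q' i) :
    prefixOf q m = prefixOf q' m :=
  List.map_congr_left fun i hi => h i (List.mem_range.1 hi)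

theorem prefixOf_eq_iff {q : Baire} {m : ℕ} {w : List ℕ} :
    prefixOf q m = w ↔ w.length = m ∧ ∀ i < m, w[i]? = some (q i) := by
  constructor
  · rintro rfl
    exact ⟨length_prefixOf q m, fun i hi => getElem?_prefixOf hi⟩
  · rintro ⟨rfl, h⟩
    refine List.ext_getElem? fun i => ?_
    by_cases hi : i < w.length
    · rw [getElem?_prefixOf hi, h i hi]
    · rw [List.getElem?_eq_none (by rw [length_prefixOf]; omega),
        List.getElem?_eq_none (by omega)]

section Semi

variable {T : Type*} {α β γ : Type} [Primcodable α] [Primcodable β] [Primcodable γ]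

/-- `P t x` is semidecidable uniformly in a name `nm t` of `t` and in the parameter `x`. -/
def Semi (nm : T → Baire) (P : T → α → Prop) : Prop :=
  ∃ D : List ℕ × α → Bool, Computable D ∧
    (∀ w v x, D (w, x) = true → D (w ++ v, x) = true) ∧
    ∀ t x, P t x ↔ ∃ m, D (prefixOf (nm t) m, x) = true

/-- The values `F t x` can be computed uniformly from a name `nm t` of `t` and the parameter `x`. -/
def Comp (nm : T → Baire) (F : T → α → β) : Prop :=
  Semi nm fun t (z : α × β) => F t z.1 = z.2

variable {nm : T → Baire}

theorem Semi.congr {P Q : T → α → Prop} (h : Semi nm P) (hPQ : ∀ t x, Q t x ↔ P t x) :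
    Semi nm Q := by
  obtain rfl : Q = P := funext₂ fun t x => propext (hPQ t x)
  exact h

-- Acceptance survives lengthening of the prefix. Hence finitely many accepting prefixes of the same
-- name can be replaced by one common prefix.
omit [Primcodable α] in
theorem prefix_mono {D : List ℕ × α → Bool}
    (hD : ∀ w v x, D (w, x) = true → D (w ++ v, x) = true) {q : Baire} {m m' : ℕ} {x : α}
    (h : m ≤ m') (hm : D (prefixOf q m, x) = true) : D (prefixOf q m', x) = true := by
  obtain ⟨v, hv⟩ := prefixOf_append q h
  rw [hv]
  exact hD _ _ _ hm

theorem Semi.of_bool {b : α → Bool} (hb : Computable b) : Semi nm fun _ x => b x = true :=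
  ⟨fun z => b z.2, by fun_prop, fun _ _ _ h => h, fun _ _ => ⟨fun h => ⟨0, h⟩, fun ⟨_, h⟩ => h⟩⟩

theorem Semi.const_true : Semi nm fun _ (_ : α) => True :=
  (Semi.of_bool (b := fun _ => true) (by fun_prop)).congr fun _ _ => by simp

theorem Semi.and {P Q : T → α → Prop} (hP : Semi nm P) (hQ : Semi nm Q) :
    Semi nm fun t x => P t x ∧ Q t x := by
  obtain ⟨D, hD, hDm, hDP⟩ := hP
  obtain ⟨E, hE, hEm, hEQ⟩ := hQ
  refine ⟨fun z => D z && E z, by fun_prop, fun w v x h => ?_, fun t x => ?_⟩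
  · rw [Bool.and_eq_true] at h ⊢
    exact ⟨hDm _ _ _ h.1, hEm _ _ _ h.2⟩
  · refine (and_congr (hDP t x) (hEQ t x)).trans ?_
    constructor
    · rintro ⟨⟨m, hm⟩, ⟨k, hk⟩⟩
      exact ⟨max m k, by rw [Bool.and_eq_true]; exact ⟨prefix_mono hDm (le_max_left _ _) hm,
        prefix_mono hEm (le_max_right _ _) hk⟩⟩
    · rintro ⟨m, hm⟩
      rw [Bool.and_eq_true] at hm
      exact ⟨⟨m, hm.1⟩, ⟨m, hm.2⟩⟩

theorem Semi.or {P Q : T → α → Prop} (hP : Semi nm P) (hQ : Semi nm Q) :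
    Semi nm fun t x => P t x ∨ Q t x := by
  obtain ⟨D, hD, hDm, hDP⟩ := hP
  obtain ⟨E, hE, hEm, hEQ⟩ := hQ
  refine ⟨fun z => D z || E z, by fun_prop, fun w v x h => ?_, fun t x => ?_⟩
  · rw [Bool.or_eq_true] at h ⊢
    exact h.imp (hDm _ _ _) (hEm _ _ _)
  · simp only [hDP, hEQ, Bool.or_eq_true, exists_or]

/-- Dovetailing: the length of the prefix also bounds the codes of the witnesses that are tried, so
a single parameter controls both searches and acceptance remains monotone. -/
theorem Semi.ex {P : T → α → β → Prop} (hP : Semi nm fun t (z : α × β) => P t z.1 z.2) :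
    Semi nm fun t x => ∃ b, P t x b := by
  obtain ⟨D, hD, hDm, hDP⟩ := hP
  refine ⟨fun z => anyBelow (fun k => (Encodable.decode k : Option β).elim false
    (fun b => D (z.1, (z.2, b)))) z.1.length, by fun_prop, fun w v x h => ?_, fun t x => ?_⟩
  · rw [anyBelow_iff] at h ⊢
    obtain ⟨k, hk, h⟩ := h
    refine ⟨k, by rw [List.length_append]; exact Nat.lt_add_right _ hk, ?_⟩
    revert h
    cases (Encodable.decode k : Option β) with
    | none => exact id
    | some b => exact hDm _ _ _
  · constructor
    · rintro ⟨b, hb⟩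
      obtain ⟨m, hm⟩ := (hDP t (x, b)).1 hb
      refine ⟨max m (Encodable.encode b + 1), anyBelow_iff.2 ⟨Encodable.encode b, ?_, ?_⟩⟩
      · rw [length_prefixOf]; omega
      · rw [Encodable.encodek]
        exact prefix_mono hDm (le_max_left _ _) hm
    · rintro ⟨m, hm⟩
      obtain ⟨k, -, hk⟩ := anyBelow_iff.1 hm
      revert hk
      cases (Encodable.decode k : Option β) with
      | none => simp
      | some b => exact fun h => ⟨b, (hDP t (x, b)).2 ⟨m, h⟩⟩

theorem Semi.reindex {P : T → β → Prop} (hP : Semi nm P) {g : α → β} (hg : Computable g) :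
    Semi nm fun t x => P t (g x) := by
  obtain ⟨D, hD, hDm, hDP⟩ := hP
  exact ⟨fun z => D (z.1, g z.2), by fun_prop, fun _ _ _ => hDm _ _ _, fun t x => hDP t (g x)⟩

/-- Only finitely many indices are involved, so the maximum of their accepting prefix lengths serves
all of them. -/
theorem Semi.allLt {P : T → α → ℕ → Prop} (hP : Semi nm fun t (z : α × ℕ) => P t z.1 z.2)
    {n : α → ℕ} (hn : Computable n) : Semi nm fun t x => ∀ i < n x, P t x i := by
  obtain ⟨D, hD, hDm, hDP⟩ := hP
  refine ⟨fun z => allBelow (fun k => D (z.1, (z.2, k))) (n z.2), by fun_prop,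
    fun w v x h => ?_, fun t x => ?_⟩
  · rw [allBelow_iff] at h ⊢
    exact fun k hk => hDm _ _ _ (h k hk)
  · simp only [allBelow_iff]
    constructor
    · intro h
      have h' : ∀ i, ∃ m, i < n x → D (prefixOf (nm t) m, (x, i)) = true := by
        intro i
        by_cases hi : i < n x
        · obtain ⟨m, hm⟩ := (hDP t (x, i)).1 (h i hi)
          exact ⟨m, fun _ => hm⟩
        · exact ⟨0, fun h => absurd h hi⟩
      choose m hm using h'
      exact ⟨(Finset.range (n x)).sup m, fun k hk =>
        prefix_mono hDm (Finset.le_sup (f := m) (Finset.mem_range.2 hk)) (hm k hk)⟩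
    · rintro ⟨m, hm⟩ i hi
      exact (hDP t (x, i)).2 ⟨m, hm i hi⟩

theorem Comp.of_computable {g : α → β} (hg : Computable g) : Comp nm fun _ x => g x := by
  classical
  have : DecidableEq β := Encodable.decidableEqOfEncodable β
  exact (Semi.of_bool (b := fun z : α × β => decide (g z.1 = z.2)) (by fun_prop)).congr
    fun _ _ => by simp

theorem Comp.name : Comp nm fun t k => nm t k := by
  refine ⟨fun z => decide (z.1[z.2.1]? = some z.2.2), by fun_prop, fun w v x h => ?_,
    fun t x => ?_⟩
  · rw [decide_eq_true_iff] at h ⊢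
    rw [List.getElem?_append_left (List.getElem?_eq_some_iff.1 h).1, h]
  · simp only [decide_eq_true_iff]
    constructor
    · intro h
      exact ⟨x.1 + 1, by rw [getElem?_prefixOf (Nat.lt_succ_self _), h]⟩
    · rintro ⟨m, hm⟩
      have := (List.getElem?_eq_some_iff.1 hm).1
      rw [length_prefixOf] at this
      rw [getElem?_prefixOf this] at hm
      exact Option.some.inj hm

/-- `Comp` is semidecidability of the graph, so substituting a computed value is an existential
quantifier over that value. -/
theorem Semi.subst {P : T → β → Prop} (hP : Semi nm P) {F : T → α → β} (hF : Comp nm F) :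
    Semi nm fun t x => P t (F t x) := by
  refine (Semi.ex (P := fun t x b => F t x = b ∧ P t b) (Semi.and hF
    (hP.reindex (by fun_prop)))).congr fun t x => by simp

theorem Comp.congr {F G : T → α → β} (h : Comp nm F) (hFG : ∀ t x, G t x = F t x) :
    Comp nm G := by
  obtain rfl : G = F := funext₂ hFG
  exact h

theorem Comp.reindex {F : T → β → γ} (hF : Comp nm F) {g : α → β} (hg : Computable g) :
    Comp nm fun t x => F t (g x) :=
  Semi.reindex (P := fun t (z : β × γ) => F t z.1 = z.2) hF
    (g := fun z : α × γ => (g z.1, z.2)) (by fun_prop)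

theorem Comp.subst {F : T → β → γ} (hF : Comp nm F) {G : T → α → β} (hG : Comp nm G) :
    Comp nm fun t x => F t (G t x) :=
  (Semi.ex (P := fun t (x : α × γ) b => G t x.1 = b ∧ F t b = x.2) (Semi.and
    (Semi.reindex (P := fun t (z : α × β) => G t z.1 = z.2) hG
      (g := fun z : (α × γ) × β => (z.1.1, z.2)) (by fun_prop))
    (Semi.reindex (P := fun t (z : β × γ) => F t z.1 = z.2) hF
      (g := fun z : (α × γ) × β => (z.2, z.1.2)) (by fun_prop)))).congr fun t x => by simp

theorem Comp.map {g : β → γ} (hg : Computable g) {F : T → α → β} (hF : Comp nm F) :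
    Comp nm fun t x => g (F t x) :=
  Comp.subst (F := fun _ b => g b) (Comp.of_computable hg) hF

theorem Comp.pair {F : T → α → β} {G : T → α → γ} (hF : Comp nm F) (hG : Comp nm G) :
    Comp nm fun t x => (F t x, G t x) :=
  (Semi.and (Semi.reindex (P := fun t (z : α × β) => F t z.1 = z.2) hF
      (g := fun z : α × (β × γ) => (z.1, z.2.1)) (by fun_prop))
    (Semi.reindex (P := fun t (z : α × γ) => G t z.1 = z.2) hG
      (g := fun z : α × (β × γ) => (z.1, z.2.2)) (by fun_prop))).congr
    fun t x => by rw [Prod.ext_iff]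

theorem Comp.map₂ {δ : Type} [Primcodable δ] {g : β → γ → δ}
    (hg : Computable fun z : β × γ => g z.1 z.2) {F : T → α → β} {G : T → α → γ}
    (hF : Comp nm F) (hG : Comp nm G) : Comp nm fun t x => g (F t x) (G t x) :=
  Comp.map hg (hF.pair hG)

theorem Comp.semi {F : T → α → Bool} (hF : Comp nm F) : Semi nm fun t x => F t x = true :=
  Semi.reindex (P := fun t (z : α × Bool) => F t z.1 = z.2) hF
    (g := fun x => (x, true)) (by fun_prop)

theorem Comp.semi_false {F : T → α → Bool} (hF : Comp nm F) : Semi nm fun t x => F t x = false :=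
  Semi.reindex (P := fun t (z : α × Bool) => F t z.1 = z.2) hF
    (g := fun x => (x, false)) (by fun_prop)

theorem Comp.semi_eq {F G : T → α → β} (hF : Comp nm F) (hG : Comp nm G) :
    Semi nm fun t x => F t x = G t x := by
  have : DecidableEq β := Encodable.decidableEqOfEncodable β
  exact (Comp.map (g := fun z : β × β => decide (z.1 = z.2)) (by fun_prop)
    (hF.pair hG)).semi.congr fun _ _ => by simp

theorem Comp.semi_ne {F G : T → α → β} (hF : Comp nm F) (hG : Comp nm G) :
    Semi nm fun t x => F t x ≠ G t x := by
  have : DecidableEq β := Encodable.decidableEqOfEncodable β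
  exact (Comp.map (g := fun z : β × β => !decide (z.1 = z.2)) (by fun_prop)
    (hF.pair hG)).semi.congr fun _ _ => by simp

theorem Comp.prefixes {F : T → α × ℕ → ℕ} (hF : Comp nm F) :
    Comp nm fun t (z : α × ℕ) => prefixOf (fun k => F t (z.1, k)) z.2 := by
  have h1 : Semi nm fun _ (z : (α × ℕ) × List ℕ) => z.2.length = z.1.2 :=
    (Semi.of_bool (b := fun z : (α × ℕ) × List ℕ => decide (z.2.length = z.1.2))
      (by fun_prop)).congr fun _ _ => by simp
  have h2 : Semi nm fun t (z : (α × ℕ) × List ℕ) =>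
      ∀ i < z.1.2, z.2[i]? = some (F t (z.1.1, i)) := by
    refine Semi.allLt ?_ (by fun_prop)
    exact Comp.semi_eq (F := fun _ (z : ((α × ℕ) × List ℕ) × ℕ) => z.1.2[z.2]?)
      (Comp.of_computable (by fun_prop)) (Comp.map (by fun_prop) (hF.reindex (by fun_prop)))
  exact (h1.and h2).congr fun t z => prefixOf_eq_iff

/-- The graph of the least-witness function is semidecidable because `q` is computed with Boolean
values: failure at smaller indices is as observable as success. -/
theorem Comp.find {q : T → α × ℕ → Bool} (hq : Comp nm q) (h : ∀ t a, ∃ s, q t (a, s) = true) :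
    ∃ F : T → α → ℕ, Comp nm F ∧ ∀ t a, q t (a, F t a) = true := by
  classical
  refine ⟨fun t a => Nat.find (h t a), ?_, fun t a => Nat.find_spec (h t a)⟩
  refine Semi.congr (P := fun t (z : α × ℕ) => q t z = true ∧ ∀ i < z.2, q t (z.1, i) = false)
    (Semi.and hq.semi (Semi.allLt (Comp.semi_false (hq.reindex (by fun_prop)))
      (by fun_prop))) fun t z => ?_
  rw [Nat.find_eq_iff]
  simp

/-- The prefix length plays the role of a computation stage, at which acceptance is decidable
relative to the name. -/
theorem Semi.stages {P : T → β → Prop} (hP : Semi nm P) :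
    ∃ Q : T → β × ℕ → Bool, Comp nm Q ∧ ∀ t b, P t b ↔ ∃ s, Q t (b, s) = true := by
  obtain ⟨D, hD, -, hDP⟩ := hP
  refine ⟨fun t z => D (prefixOf (nm t) z.2, z.1), ?_, hDP⟩
  refine Comp.map (g := D) hD (Comp.pair ?_ (Comp.of_computable (by fun_prop)))
  exact (Comp.prefixes (F := fun t (z : Unit × ℕ) => nm t z.2)
    (Comp.name.reindex (by fun_prop))).reindex (g := fun z : β × ℕ => ((), z.2)) (by fun_prop)

/-- Search for a code of a witness together with a stage confirming it. The witness found may depend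
on the name and not only on the object named, which is harmless as the choice is a function of the
situation. -/
theorem Semi.choose {P : T → α → β → Prop} (hP : Semi nm fun t (z : α × β) => P t z.1 z.2)
    (h : ∀ t a, ∃ b, P t a b) : ∃ F : T → α → β, Comp nm F ∧ ∀ t a, P t a (F t a) := by
  have hP' : Semi nm fun t (z : α × ℕ) => ∃ b, Encodable.decode z.2 = some b ∧ P t z.1 b := by
    refine Semi.ex (Semi.and (Comp.semi_eq (Comp.of_computable (by fun_prop))
      (Comp.of_computable (by fun_prop))) ?_)
    exact hP.reindex (g := fun z : (α × ℕ) × β => (z.1.1, z.2)) (by fun_prop)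
  obtain ⟨Q, hQ, hQP⟩ := hP'.stages
  obtain ⟨K, hK, hKq⟩ := Comp.find (nm := nm) (α := α)
    (q := fun t z => Q t ((z.1, z.2.unpair.1), z.2.unpair.2)) (hQ.reindex (by fun_prop))
    (fun t a => by
      obtain ⟨b, hb⟩ := h t a
      obtain ⟨s, hs⟩ := (hQP t (a, Encodable.encode b)).1 ⟨b, Encodable.encodek b, hb⟩
      exact ⟨Nat.pair (Encodable.encode b) s, by simpa using hs⟩)
  have hK' : ∀ t a, ∃ b : β, Encodable.decode (K t a).unpair.1 = some b ∧ P t a b := fun t a =>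
    (hQP t (a, (K t a).unpair.1)).2 ⟨_, hKq t a⟩
  choose F hF hFP using hK'
  refine ⟨F, ?_, hFP⟩
  refine (Comp.semi_eq (F := fun t (z : α × β) =>
    (Encodable.decode (K t z.1).unpair.1 : Option β)) (G := fun _ z => some z.2)
    (Comp.map (g := fun k => (Encodable.decode k.unpair.1 : Option β)) (by fun_prop)
      (hK.reindex (by fun_prop)))
    (Comp.of_computable (by fun_prop))).congr fun t z => ?_
  rw [hF, Option.some_inj]

/-- Enumerations of semidecidable sets of natural numbers. -/
theorem Semi.enumerate {E : T → α × ℕ → Prop} (hE : Semi nm E) :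
    ∃ F : T → α × ℕ → ℕ, Comp nm F ∧ ∀ t a c, E t (a, c) ↔ ∃ i, F t (a, i) = c + 1 := by
  obtain ⟨Q, hQ, hQE⟩ := hE.stages
  refine ⟨fun t z => bif Q t ((z.1, z.2.unpair.1), z.2.unpair.2) then z.2.unpair.1 + 1 else 0,
    ?_, fun t a c => ?_⟩
  · exact Comp.map (g := fun y : Bool × ℕ => bif y.1 then y.2.unpair.1 + 1 else 0) (by fun_prop)
      (Comp.pair (hQ.reindex (g := fun z : α × ℕ => ((z.1, z.2.unpair.1), z.2.unpair.2))
        (by fun_prop)) (Comp.of_computable (g := fun z : α × ℕ => z.2) (by fun_prop)))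
  · rw [hQE]
    constructor
    · rintro ⟨s, hs⟩
      exact ⟨Nat.pair c s, by simp [hs]⟩
    · rintro ⟨i, hi⟩
      cases hq : Q t ((a, i.unpair.1), i.unpair.2) with
      | false => simp [hq] at hi
      | true =>
        simp only [hq, cond_true, Nat.add_right_cancel_iff] at hi
        exact ⟨_, hi ▸ hq⟩

/-- Applying `η`. -/
theorem Comp.eta {A Q R : T → α × ℕ → ℕ} (hA : Comp nm A) (hQ : Comp nm Q)
    (h : ∀ t a, Eta (fun k => A t (a, k)) (fun k => Q t (a, k)) fun k => R t (a, k)) :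
    Comp nm R := by
  have hv : Comp nm fun t (z : (α × ℕ) × ℕ) => A t (z.1.1, Nat.pair z.1.2
      (Encodable.encode (prefixOf (fun k => Q t (z.1.1, k)) z.2))) := by
    refine hA.subst (Comp.pair (Comp.of_computable (by fun_prop)) (Comp.map₂ (by fun_prop)
      (Comp.of_computable (g := fun z : (α × ℕ) × ℕ => z.1.2) (by fun_prop))
      (Comp.map (by fun_prop) ((Comp.prefixes hQ).reindex
        (g := fun z : (α × ℕ) × ℕ => (z.1.1, z.2)) (by fun_prop)))))
  have h2 : Semi nm fun t (z : (α × ℕ) × ℕ) => ∃ m, A t (z.1.1, Nat.pair z.1.2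
      (Encodable.encode (prefixOf (fun k => Q t (z.1.1, k)) m))) = z.2 + 1 ∧
      ∀ k < m, A t (z.1.1, Nat.pair z.1.2
      (Encodable.encode (prefixOf (fun k => Q t (z.1.1, k)) k))) = 0 := by
    refine Semi.ex (Semi.and ?_ (Semi.allLt ?_ (by fun_prop)))
    · exact Comp.semi_eq (hv.reindex (g := fun z : ((α × ℕ) × ℕ) × ℕ => (z.1.1, z.2))
        (by fun_prop)) (Comp.of_computable (by fun_prop))
    · exact Comp.semi_eq (hv.reindex (g := fun z : (((α × ℕ) × ℕ) × ℕ) × ℕ => (z.1.1.1, z.2))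
        (by fun_prop)) (Comp.of_computable (Computable.const 0))
  -- The decisive prefix length is unique, since it carries a nonzero entry and all shorter prefixes
  -- carry zero. So the semidecidable condition determines the output symbol.
  refine h2.congr fun t z => ?_
  obtain ⟨⟨a, n⟩, v⟩ := z
  obtain ⟨m, hm, hlt⟩ := h t a n
  simp only at hm hlt ⊢
  constructor
  · intro hv
    exact ⟨m, hv ▸ hm, hlt⟩
  · rintro ⟨m', hm', hlt'⟩
    rcases lt_trichotomy m m' with h' | rfl | h'
    · have := hlt' m h'
      omega
    · omega
    · have := hlt m' h'
      omega

end Semi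
/-! ### Named families of objects -/

section Named

variable {T T' : Type*} {α β γ : Type} [Primcodable α] [Primcodable β] [Primcodable γ]
  {B C : Type*} {nm : T → Baire} {nm' : T' → Baire}

/-- Interleaving, the pairing on Baire space. -/
def ilv (p q : Baire) : Baire := fun n => bif n % 2 = 0 then p (n / 2) else q (n / 2)

theorem left_ilv (p q : Baire) : left (ilv p q) = p := by
  funext n
  simp [left, ilv]

theorem right_ilv (p q : Baire) : right (ilv p q) = q := by
  funext n
  have h1 : (2 * n + 1) % 2 ≠ 0 := by omega
  have h2 : (2 * n + 1) / 2 = n := by omega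
  simp [right, ilv, h2]

theorem Comp.cond {c : T → α → Bool} {F G : T → α → β} (hc : Comp nm c) (hF : Comp nm F)
    (hG : Comp nm G) : Comp nm fun t x => bif c t x then F t x else G t x :=
  Comp.map (g := fun z : Bool × β × β => bif z.1 then z.2.1 else z.2.2) (by fun_prop)
    (hc.pair (hF.pair hG))

theorem Comp.ilv {F G : T → α × ℕ → ℕ} (hF : Comp nm F) (hG : Comp nm G) :
    Comp nm fun t (z : α × ℕ) => ilv (fun k => F t (z.1, k)) (fun k => G t (z.1, k)) z.2 :=
  Comp.cond (c := fun _ z => decide (z.2 % 2 = 0)) (Comp.of_computable (by fun_prop))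
    (hF.reindex (g := fun z : α × ℕ => (z.1, z.2 / 2)) (by fun_prop))
    (hG.reindex (g := fun z : α × ℕ => (z.1, z.2 / 2)) (by fun_prop))

/-- Names of the objects `y t x` can be computed uniformly from names of `t` and from `x`. -/
def Named (nm : T → Baire) (δ : Naming B) (y : T → α → B) : Prop :=
  ∃ F : T → α × ℕ → ℕ, Comp nm F ∧ ∀ t a, δ (fun k => F t (a, k)) (y t a)

variable {δ : Naming B} {δ' : Naming C}

theorem Named.congr {y z : T → α → B} (h : Named nm δ y) (hyz : ∀ t a, z t a = y t a) :
    Named nm δ z := by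
  obtain rfl : z = y := funext₂ hyz
  exact h

theorem Named.subst {y : T → α → B} (h : Named nm δ y) {G : T → β → α} (hG : Comp nm G) :
    Named nm δ fun t b => y t (G t b) := by
  obtain ⟨F, hF, hFy⟩ := h
  exact ⟨fun t z => F t (G t z.1, z.2), hF.subst (Comp.pair (hG.reindex (by fun_prop))
    (Comp.of_computable (by fun_prop))), fun t b => hFy t (G t b)⟩

theorem Named.reindex {y : T → α → B} (h : Named nm δ y) {g : β → α} (hg : Computable g) :
    Named nm δ fun t b => y t (g b) :=
  h.subst (G := fun _ => g) (Comp.of_computable hg)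

theorem Named.prod {y : T → α → B} {z : T → α → C} (hy : Named nm δ y) (hz : Named nm δ' z) :
    Named nm (prodName δ δ') fun t a => (y t a, z t a) := by
  obtain ⟨F, hF, hFy⟩ := hy
  obtain ⟨G, hG, hGz⟩ := hz
  refine ⟨_, hF.ilv hG, fun t a => ⟨?_, ?_⟩⟩
  · simpa only [left_ilv] using hFy t a
  · simpa only [right_ilv] using hGz t a

theorem Named.meet {δ₁ δ₂ : Naming B} {y : T → α → B} (h₁ : Named nm δ₁ y)
    (h₂ : Named nm δ₂ y) : Named nm (meetName δ₁ δ₂) y := by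
  obtain ⟨F, hF, hFy⟩ := h₁
  obtain ⟨G, hG, hGz⟩ := h₂
  refine ⟨_, hF.ilv hG, fun t a => ⟨?_, ?_⟩⟩
  · simpa only [left_ilv] using hFy t a
  · simpa only [right_ilv] using hGz t a

theorem Comp.left {F : T → α × ℕ → ℕ} (hF : Comp nm F) :
    Comp nm fun t (z : α × ℕ) => left (fun k => F t (z.1, k)) z.2 :=
  hF.reindex (g := fun z : α × ℕ => (z.1, 2 * z.2)) (by fun_prop)

theorem Comp.right {F : T → α × ℕ → ℕ} (hF : Comp nm F) :
    Comp nm fun t (z : α × ℕ) => right (fun k => F t (z.1, k)) z.2 :=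
  hF.reindex (g := fun z : α × ℕ => (z.1, 2 * z.2 + 1)) (by fun_prop)

theorem Named.fst {y : T → α → B × C} (h : Named nm (prodName δ δ') y) :
    Named nm δ fun t a => (y t a).1 := by
  obtain ⟨F, hF, hFy⟩ := h
  exact ⟨_, hF.left, fun t a => (hFy t a).1⟩

theorem Named.snd {y : T → α → B × C} (h : Named nm (prodName δ δ') y) :
    Named nm δ' fun t a => (y t a).2 := by
  obtain ⟨F, hF, hFy⟩ := h
  exact ⟨_, hF.right, fun t a => (hFy t a).2⟩

theorem Named.meet_left {δ₁ δ₂ : Naming B} {y : T → α → B} (h : Named nm (meetName δ₁ δ₂) y) :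
    Named nm δ₁ y := by
  obtain ⟨F, hF, hFy⟩ := h
  exact ⟨_, hF.left, fun t a => (hFy t a).1⟩

theorem Named.meet_right {δ₁ δ₂ : Naming B} {y : T → α → B} (h : Named nm (meetName δ₁ δ₂) y) :
    Named nm δ₂ y := by
  obtain ⟨F, hF, hFy⟩ := h
  exact ⟨_, hF.right, fun t a => (hFy t a).2⟩

theorem Named.seq {y : T → α → ℕ → B} (h : Named nm δ fun t (z : α × ℕ) => y t z.1 z.2) :
    Named nm (seqName δ) y := by
  obtain ⟨F, hF, hFy⟩ := h
  refine ⟨fun t z => F t ((z.1, z.2.unpair.1), z.2.unpair.2), hF.reindex (by fun_prop),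
    fun t a i => ?_⟩
  unfold component
  simpa only [Nat.unpair_pair] using hFy t (a, i)

theorem Named.seq_apply {y : T → α → ℕ → B} (h : Named nm (seqName δ) y) :
    Named nm δ fun t (z : α × ℕ) => y t z.1 z.2 := by
  obtain ⟨F, hF, hFy⟩ := h
  exact ⟨fun t z => F t (z.1.1, Nat.pair z.1.2 z.2), hF.reindex (by fun_prop),
    fun t a => hFy t a.1 a.2⟩

theorem Named.nat {F : T → α → ℕ} (hF : Comp nm F) : Named nm natName F :=
  ⟨fun t z => F t z.1, hF.reindex (by fun_prop), fun _ _ => rfl⟩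

theorem Named.reduce {δ₁ δ₂ : Naming B} (hδ : Reducible δ₁ δ₂) {y : T → α → B}
    (h : Named nm δ₁ y) : Named nm δ₂ y := by
  obtain ⟨e, he, hδ⟩ := hδ
  obtain ⟨F, hF, hFy⟩ := h
  choose R hR hRy using fun t a => hδ _ _ (hFy t a)
  exact ⟨fun t z => R t z.1 z.2, Comp.eta (A := fun _ z => e z.2) (Comp.of_computable
    (Computable.comp he Computable.snd)) hF hR, hRy⟩

/-- The output names are picked by choice, but `η` determines them from the realizer and the input
name, so `Comp.eta` makes the choice computable. -/
theorem Operation.IsComputable.apply {f : Operation B C} (hf : f.IsComputable δ δ')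
    {y : T → α → B} (h : Named nm δ y) (hdom : ∀ t a, y t a ∈ f.dom) :
    ∃ z : T → α → C, Named nm δ' z ∧ ∀ t a, z t a ∈ f.val (y t a) := by
  obtain ⟨e, he, hf⟩ := hf
  obtain ⟨F, hF, hFy⟩ := h
  choose R hR z hz hRz using fun t a => hf _ (hdom t a) _ (hFy t a)
  exact ⟨z, ⟨fun t z => R t z.1 z.2, Comp.eta (A := fun _ z => e z.2) (Comp.of_computable
    (Computable.comp he Computable.snd)) hF hR, hRz⟩, hz⟩

/-- The situations in which a realizer of an operation has to work. -/
abbrev Operation.Input (f : Operation B C) (δ : Naming B) : Type _ :=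
  {z : Baire × B // z.2 ∈ f.dom ∧ δ z.1 z.2}

/-- A uniform algorithm is turned into a table for `η`: the entry for position `n` and word `w` is
the successor of the first symbol below the length of `w` that is accepted from `w`, and `0` if
there is none. Acceptance determines the symbol, so the first nonzero entry is correct. -/
theorem Operation.isComputable_of_named {f : Operation B C}
    (h : ∃ y : f.Input δ → Unit → C, Named (fun t : f.Input δ => t.1.1) δ' y ∧
      ∀ t, y t () ∈ f.val t.1.2) : f.IsComputable δ δ' := by
  obtain ⟨y, ⟨F, hF, hFy⟩, hy⟩ := h
  obtain ⟨D, hD, hDm, hDF⟩ : Comp (fun t : f.Input δ => t.1.1) fun t k => F t ((), k) :=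
    hF.reindex (by fun_prop)
  refine ⟨fun e => (Encodable.decode e.unpair.2 : Option (List ℕ)).elim 0 fun w =>
    firstBelow (fun v => D (w, (e.unpair.1, v))) w.length, by fun_prop, fun x hx p hp => ?_⟩
  let t : f.Input δ := ⟨(p, x), hx, hp⟩
  refine ⟨fun k => F t ((), k), fun n => ?_, y t (), hy t, hFy t ()⟩
  obtain ⟨m, hm, hlt⟩ := exists_firstBelow (f := fun m v => D (prefixOf p m, (n, v)))
    (r := F t ((), n)) (fun m v h => ((hDF t (n, v)).2 ⟨m, h⟩).symm) (by
      obtain ⟨m, hm⟩ := (hDF t (n, F t ((), n))).1 rfl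
      exact ⟨m, fun m' h' => prefix_mono hDm h' hm⟩)
  refine ⟨m, ?_, fun k hk => ?_⟩
  · simpa [length_prefixOf] using hm
  · simpa [length_prefixOf] using hlt k hk

theorem Operation.Input.named (f : Operation B C) (δ : Naming B) :
    Named (fun t : f.Input δ => t.1.1) δ fun t (_ : Unit) => t.1.2 :=
  ⟨fun t z => t.1.1 z.2, Comp.reindex (F := fun (t : f.Input δ) k => t.1.1 k) Comp.name
    (by fun_prop), fun t _ => t.2.2⟩

theorem Semi.of_prefixes {D : List ℕ × γ → Bool} (hD : Computable D) {F : T → β × ℕ → ℕ}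
    (hF : Comp nm F) :
    Semi nm fun t (z : β × γ) => ∃ m, D (prefixOf (fun k => F t (z.1, k)) m, z.2) = true := by
  refine Semi.ex (Comp.semi (Comp.map hD (Comp.pair ?_ (Comp.of_computable (by fun_prop)))))
  exact (Comp.prefixes hF).reindex (g := fun z : (β × γ) × ℕ => (z.1.1, z.2)) (by fun_prop)

/-- Substitution of a partial family of situations. -/
theorem Semi.pull {P : T' → γ → Prop} (hP : Semi nm' P) {S : T → β → Prop} (hS : Semi nm S)
    (φ : ∀ t b, S t b → T') {F : T → β × ℕ → ℕ} (hF : Comp nm F)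
    (h : ∀ t b hs k, nm' (φ t b hs) k = F t (b, k)) :
    Semi nm fun t (z : β × γ) => ∃ hs : S t z.1, P (φ t z.1 hs) z.2 := by
  obtain ⟨D, hD, hDm, hDP⟩ := hP
  refine (Semi.and (hS.reindex (g := fun z : β × γ => z.1) (by fun_prop))
    (Semi.of_prefixes hD hF)).congr fun t z => ?_
  constructor
  · rintro ⟨hs, hp⟩
    refine ⟨hs, ?_⟩
    simpa only [← h t z.1 hs] using (hDP _ _).1 hp
  · rintro ⟨hs, hp⟩
    refine ⟨hs, (hDP _ _).2 ?_⟩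
    simpa only [← h t z.1 hs] using hp

theorem Semi.pullback {P : T → γ → Prop} (hP : Semi nm P) {φ : T' → T}
    (h : Comp nm' fun t k => nm (φ t) k) : Semi nm' fun t x => P (φ t) x :=
  ((Semi.pull hP (Semi.const_true (α := Unit)) (fun t _ _ => φ t)
    (F := fun t z => nm (φ t) z.2) (h.reindex (by fun_prop)) fun _ _ _ _ => rfl).reindex
    (g := fun x : γ => ((), x)) (by fun_prop)).congr fun t x => by simp

theorem Comp.pullback {F : T → β → γ} (hF : Comp nm F) {φ : T' → T}
    (h : Comp nm' fun t k => nm (φ t) k) : Comp nm' fun t x => F (φ t) x :=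
  Semi.pullback hF h

theorem Named.pullback {y : T → α → B} (hy : Named nm δ y) {φ : T' → T}
    (h : Comp nm' fun t k => nm (φ t) k) : Named nm' δ fun t a => y (φ t) a := by
  obtain ⟨F, hF, hFy⟩ := hy
  exact ⟨_, hF.pullback h, fun t a => hFy (φ t) a⟩

theorem Comp.left_name {base : T' → T} {q : T' → Baire}
    (h : ∀ t, nm' t = TTE.ilv (q t) (nm (base t))) : Comp nm' fun t k => q t k :=
  (Comp.name.reindex (g := fun k => 2 * k) (by fun_prop)).congr fun t k => by
    rw [h, ← left_ilv (q t) (nm (base t))]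
    simp [TTE.left, left_ilv]

theorem Comp.right_name {base : T' → T} {q : T' → Baire}
    (h : ∀ t, nm' t = TTE.ilv (q t) (nm (base t))) : Comp nm' fun t k => nm (base t) k :=
  (Comp.name.reindex (g := fun k => 2 * k + 1) (by fun_prop)).congr fun t k => by
    rw [h, ← right_ilv (q t) (nm (base t))]
    simp [TTE.right, right_ilv]

theorem prefixOf_ilv {q q' p p' : Baire} {m : ℕ} (hq : ∀ i < m, q i = q' i)
    (hp : ∀ i < m, p i = p' i) : prefixOf (ilv q p) (2 * m) = prefixOf (ilv q' p') (2 * m) := by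
  refine prefixOf_congr fun i hi => ?_
  simp only [ilv, hq (i / 2) (by omega), hp (i / 2) (by omega)]

theorem getD_prefixOf {q : Baire} {m i : ℕ} (h : i < m) : (prefixOf q m).getD i 0 = q i := by
  rw [List.getD_eq_getElem?_getD, getElem?_prefixOf h, Option.getD_some]

/-- Currying: names for `η`. -/
theorem Comp.curry {base : T' → T} {q : T' → Baire} (h : ∀ t, nm' t = TTE.ilv (q t) (nm (base t)))
    {G : T' → ℕ → ℕ} (hG : Comp nm' G) :
    ∃ A : T → Unit × ℕ → ℕ, Comp nm A ∧
      ∀ t, Eta (fun k => A (base t) ((), k)) (q t) fun n => G t n := by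
  obtain ⟨D, hD, hDm, hDG⟩ := hG
  let W : ℕ → List ℕ := fun e => (Encodable.decode e.unpair.2 : Option (List ℕ)).elim [] id
  have hW : Computable W := by
    refine computable_optionElim (by fun_prop) (by fun_prop) ?_
    exact Computable.snd
  -- A word of length `m` for the outer input, together with the name of the base situation,
  -- determines exactly `2 * m` entries of the interleaved name. The default `0` lies beyond the
  -- part that is read.
  let L : T → ℕ → List ℕ := fun t e =>
    prefixOf (TTE.ilv (fun i => (W e).getD i 0) (nm t)) (2 * (W e).length)
  have hL : Comp nm L :=
    (Comp.prefixes (Comp.ilv (F := fun _ (z : ℕ × ℕ) => (W z.1).getD z.2 0)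
      (G := fun t z => nm t z.2) (Comp.of_computable (by fun_prop))
      (Comp.name.reindex (by fun_prop)))).reindex (g := fun e => (e, 2 * (W e).length))
      (by fun_prop)
  refine ⟨fun t z => firstBelow (fun v => D (L t z.2, (z.2.unpair.1, v))) (W z.2).length, ?_,
    fun t n => ?_⟩
  · exact Comp.map (g := fun y : List ℕ × ℕ =>
      firstBelow (fun v => D (y.1, (y.2.unpair.1, v))) (W y.2).length) (by fun_prop)
      (Comp.pair (hL.reindex (by fun_prop)) (Comp.of_computable (by fun_prop)))
  · have hw : ∀ m, W (Nat.pair n (Encodable.encode (prefixOf (q t) m))) = prefixOf (q t) m :=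
      fun m => by simp [W]
    have hLm : ∀ m, L (base t) (Nat.pair n (Encodable.encode (prefixOf (q t) m))) =
        prefixOf (nm' t) (2 * m) := fun m => by
      simp only [L, hw, length_prefixOf, h]
      exact prefixOf_ilv (fun i hi => getD_prefixOf hi) fun _ _ => rfl
    simp only [hw, hLm, length_prefixOf, Nat.unpair_pair]
    exact exists_firstBelow (f := fun m v => D (prefixOf (nm' t) (2 * m), (n, v)))
      (fun m v h => ((hDG t (n, v)).2 ⟨_, h⟩).symm) (by
        obtain ⟨m, hm⟩ := (hDG t (n, G t n)).1 rfl
        exact ⟨m, fun m' h' => prefix_mono hDm (by omega) hm⟩)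

end Named
/-! ### Rational and real numbers -/

/-- The code of the rational number `(a - b) / (c + 1)`. -/
def ratCode (a b c : ℕ) : ℕ := Nat.pair (Nat.pair a b) c

theorem rat_ratCode (a b c : ℕ) : rat (ratCode a b c) = ((a : ℚ) - b) / (c + 1) := by
  simp [rat, ratCode]

theorem rat_surjective : Function.Surjective rat := by
  intro q
  obtain ⟨d, hd⟩ := Nat.exists_eq_succ_of_ne_zero q.den_pos.ne'
  have hq : q = (q.num : ℚ) / ((d : ℚ) + 1) := by
    have h := (Rat.num_div_den q).symm
    rw [hd] at h
    push_cast at h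
    exact h
  refine ⟨ratCode q.num.toNat (-q.num).toNat d, ?_⟩
  rw [rat_ratCode]
  conv_rhs => rw [hq]
  congr 1
  have : ((q.num.toNat : ℤ) - ((-q.num).toNat : ℤ)) = q.num := by omega
  exact_mod_cast this

theorem exists_rat_btwn_code {x y : ℝ} (h : x < y) : ∃ n, x < (rat n : ℚ) ∧ ((rat n : ℚ) : ℝ) < y := by
  obtain ⟨q, hq⟩ := exists_rat_btwn h
  obtain ⟨n, rfl⟩ := rat_surjective q
  exact ⟨n, hq⟩

/-- Addition on codes of rational numbers. -/
def ratAdd (n m : ℕ) : ℕ :=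
  ratCode (n.unpair.1.unpair.1 * (m.unpair.2 + 1) + m.unpair.1.unpair.1 * (n.unpair.2 + 1))
    (n.unpair.1.unpair.2 * (m.unpair.2 + 1) + m.unpair.1.unpair.2 * (n.unpair.2 + 1))
    ((n.unpair.2 + 1) * (m.unpair.2 + 1) - 1)

theorem rat_ratAdd (n m : ℕ) : rat (ratAdd n m) = rat n + rat m := by
  rw [ratAdd, rat_ratCode]
  have h : (((n.unpair.2 + 1) * (m.unpair.2 + 1) - 1 : ℕ) : ℚ) =
      ((n.unpair.2 : ℚ) + 1) * ((m.unpair.2 : ℚ) + 1) - 1 := by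
    rw [Nat.cast_sub (Nat.succ_le_of_lt (by positivity))]
    push_cast
    ring
  rw [h]
  simp only [rat]
  have h1 : (n.unpair.2 : ℚ) + 1 ≠ 0 := by positivity
  have h2 : (m.unpair.2 : ℚ) + 1 ≠ 0 := by positivity
  push_cast
  rw [sub_add_cancel, div_add_div _ _ h1 h2]
  congr 1
  ring

/-- Negation on codes of rational numbers. -/
def ratNeg (n : ℕ) : ℕ := ratCode n.unpair.1.unpair.2 n.unpair.1.unpair.1 n.unpair.2

theorem rat_ratNeg (n : ℕ) : rat (ratNeg n) = -rat n := by
  rw [ratNeg, rat_ratCode, rat, ← neg_div, neg_sub]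

/-- The order on codes of rational numbers. -/
def ratLt (n m : ℕ) : Bool :=
  Nat.blt (n.unpair.1.unpair.1 * (m.unpair.2 + 1) + m.unpair.1.unpair.2 * (n.unpair.2 + 1))
    (m.unpair.1.unpair.1 * (n.unpair.2 + 1) + n.unpair.1.unpair.2 * (m.unpair.2 + 1))

theorem ratLt_iff {n m : ℕ} : ratLt n m = true ↔ rat n < rat m := by
  rw [ratLt, Nat.blt_eq, rat, rat, div_lt_div_iff₀ (by positivity) (by positivity),
    ← Nat.cast_lt (α := ℚ)]
  push_cast
  constructor <;> intro h <;> linarith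

/-- The code of `2⁻ᵏ`. -/
def ratPow (k : ℕ) : ℕ := ratCode 1 0 (2 ^ k - 1)

theorem rat_ratPow (k : ℕ) : ((rat (ratPow k) : ℚ) : ℝ) = (2 : ℝ)⁻¹ ^ k := by
  rw [ratPow, rat_ratCode, Nat.cast_sub Nat.one_le_two_pow]
  simp

/-- The code as a rational of a code of a positive rational. -/
def ratPos (k : ℕ) : ℕ := ratCode (k.unpair.1 + 1) 0 k.unpair.2

theorem rat_ratPos (k : ℕ) : rat (ratPos k) = posRat k := by
  rw [ratPos, rat_ratCode, posRat]
  simp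

section Computable

variable {α : Type*} [Primcodable α] {f g h : α → ℕ}

@[fun_prop]
theorem computable_ratCode (hf : Computable f) (hg : Computable g) (hh : Computable h) :
    Computable fun x => ratCode (f x) (g x) (h x) := by unfold ratCode; fun_prop

@[fun_prop]
theorem computable_ratAdd (hf : Computable f) (hg : Computable g) :
    Computable fun x => ratAdd (f x) (g x) := by unfold ratAdd; fun_prop

@[fun_prop]
theorem computable_ratNeg (hf : Computable f) :
    Computable fun x => ratNeg (f x) := by unfold ratNeg; fun_prop

@[fun_prop]
theorem computable_ratLt (hf : Computable f) (hg : Computable g) :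
    Computable fun x => ratLt (f x) (g x) := by unfold ratLt; fun_prop

@[fun_prop]
theorem computable_ratPow (hf : Computable f) :
    Computable fun x => ratPow (f x) := by unfold ratPow; fun_prop

@[fun_prop]
theorem computable_ratPos (hf : Computable f) :
    Computable fun x => ratPos (f x) := by unfold ratPos; fun_prop

end Computable

section Real

variable {T T' : Type*} {α β : Type} [Primcodable α] [Primcodable β]
  {nm : T → Baire} {nm' : T' → Baire}

/-- The real numbers `f t x` can be computed uniformly from names of `t` and from `x`. -/
def CRe (nm : T → Baire) (f : T → α → ℝ) : Prop :=
  (Semi nm fun t (z : α × ℕ) => ((rat z.2 : ℚ) : ℝ) < f t z.1) ∧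
    Semi nm fun t (z : α × ℕ) => f t z.1 < ((rat z.2 : ℚ) : ℝ)

theorem CRe.congr {f g : T → α → ℝ} (hf : CRe nm f) (h : ∀ t x, g t x = f t x) : CRe nm g := by
  obtain rfl : g = f := funext₂ h
  exact hf

theorem CRe.subst {f : T → β → ℝ} (hf : CRe nm f) {G : T → α → β} (hG : Comp nm G) :
    CRe nm fun t x => f t (G t x) := by
  have h : Comp nm fun t (z : α × ℕ) => (G t z.1, z.2) :=
    Comp.pair (hG.reindex (by fun_prop)) (Comp.of_computable (by fun_prop))
  have h1 := hf.1.subst h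
  have h2 := hf.2.subst h
  exact ⟨h1, h2⟩

theorem CRe.reindex {f : T → β → ℝ} (hf : CRe nm f) {g : α → β} (hg : Computable g) :
    CRe nm fun t x => f t (g x) :=
  hf.subst (G := fun _ => g) (Comp.of_computable hg)

theorem CRe.of_rat {G : T → α → ℕ} (hG : Comp nm G) : CRe nm fun t x => ((rat (G t x) : ℚ) : ℝ) := by
  constructor
  · refine (Comp.semi (Comp.map₂ (g := fun a b : ℕ => ratLt a b) (by fun_prop)
      (Comp.of_computable (g := fun z : α × ℕ => z.2) (by fun_prop))
      (hG.reindex (g := fun z : α × ℕ => z.1) (by fun_prop)))).congr fun t z => ?_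
    rw [ratLt_iff, Rat.cast_lt]
  · refine (Comp.semi (Comp.map₂ (g := fun a b : ℕ => ratLt a b) (by fun_prop)
      (hG.reindex (g := fun z : α × ℕ => z.1) (by fun_prop))
      (Comp.of_computable (g := fun z : α × ℕ => z.2) (by fun_prop)))).congr fun t z => ?_
    rw [ratLt_iff, Rat.cast_lt]

theorem CRe.pow {G : T → α → ℕ} (hG : Comp nm G) : CRe nm fun t x => (2 : ℝ)⁻¹ ^ G t x :=
  (CRe.of_rat (Comp.map (g := ratPow) (by fun_prop) hG)).congr fun _ _ => (rat_ratPow _).symm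

theorem CRe.of_posRat {G : T → α → ℕ} (hG : Comp nm G) :
    CRe nm fun t x => ((posRat (G t x) : ℚ) : ℝ) :=
  (CRe.of_rat (Comp.map (g := ratPos) (by fun_prop) hG)).congr fun _ _ => by rw [rat_ratPos]

theorem CRe.zero : CRe nm fun _ (_ : α) => (0 : ℝ) :=
  (CRe.of_rat (G := fun _ _ => ratCode 0 0 0) (Comp.of_computable (by fun_prop))).congr
    fun _ _ => by simp [rat_ratCode]

theorem CRe.lt {f g : T → α → ℝ} (hf : CRe nm f) (hg : CRe nm g) :
    Semi nm fun t x => f t x < g t x :=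
  (Semi.ex (hf.2.and hg.1)).congr fun _ _ => ⟨fun h => exists_rat_btwn_code h,
    fun ⟨_, h1, h2⟩ => h1.trans h2⟩

theorem CRe.neg {f : T → α → ℝ} (hf : CRe nm f) : CRe nm fun t x => -f t x := by
  constructor
  · refine (hf.2.reindex (g := fun z : α × ℕ => (z.1, ratNeg z.2)) (by fun_prop)).congr
      fun t z => ?_
    rw [rat_ratNeg, Rat.cast_neg, lt_neg]
  · refine (hf.1.reindex (g := fun z : α × ℕ => (z.1, ratNeg z.2)) (by fun_prop)).congr
      fun t z => ?_
    rw [rat_ratNeg, Rat.cast_neg, neg_lt]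

theorem CRe.add {f g : T → α → ℝ} (hf : CRe nm f) (hg : CRe nm g) :
    CRe nm fun t x => f t x + g t x := by
  -- A rational `q` lies below `f + g` exactly if some rational `n < f` satisfies `q - n < g`. Upper
  -- bounds then follow by passing to the negatives.
  have key : ∀ {f g : T → α → ℝ}, CRe nm f → CRe nm g →
      Semi nm fun t (z : α × ℕ) => ((rat z.2 : ℚ) : ℝ) < f t z.1 + g t z.1 := by
    intro f g hf hg
    have h : Semi nm fun t (z : α × ℕ) => ∃ n, ((rat n : ℚ) : ℝ) < f t z.1 ∧
        ((rat (ratAdd z.2 (ratNeg n)) : ℚ) : ℝ) < g t z.1 := by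
      refine Semi.ex (Semi.and ?_ ?_)
      · exact hf.1.reindex (g := fun z : (α × ℕ) × ℕ => (z.1.1, z.2)) (by fun_prop)
      · exact hg.1.reindex (g := fun z : (α × ℕ) × ℕ => (z.1.1, ratAdd z.1.2 (ratNeg z.2)))
          (by fun_prop)
    refine h.congr fun t z => ?_
    simp only [rat_ratAdd, rat_ratNeg, Rat.cast_add, Rat.cast_neg]
    constructor
    · intro h
      obtain ⟨n, h1, h2⟩ := exists_rat_btwn_code
        (show ((rat z.2 : ℚ) : ℝ) - g t z.1 < f t z.1 by linarith)
      exact ⟨n, h2, by linarith⟩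
    · rintro ⟨n, h1, h2⟩
      linarith
  refine ⟨key hf hg, ?_⟩
  refine ((key hf.neg hg.neg).reindex (g := fun z : α × ℕ => (z.1, ratNeg z.2))
    (by fun_prop)).congr fun t z => ?_
  rw [rat_ratNeg, Rat.cast_neg]
  constructor <;> intro h <;> linarith

theorem CRe.sub {f g : T → α → ℝ} (hf : CRe nm f) (hg : CRe nm g) :
    CRe nm fun t x => f t x - g t x :=
  (hf.add hg.neg).congr fun _ _ => sub_eq_add_neg _ _

theorem exists_pow_lt {ε : ℝ} (h : 0 < ε) : ∃ k, (2 : ℝ)⁻¹ ^ k < ε :=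
  exists_pow_lt_of_lt_one h (by norm_num)

/-- Limits of sequences that converge with a known speed. -/
theorem CRe.of_approx {f : T → α → ℝ} {g : T → α → ℕ → ℝ}
    (hg : CRe nm fun t (z : α × ℕ) => g t z.1 z.2)
    (h : ∀ t x k, |f t x - g t x k| ≤ 2 * (2 : ℝ)⁻¹ ^ k) : CRe nm f := by
  have hp : CRe nm fun (_ : T) (z : (α × ℕ) × ℕ) => (2 : ℝ)⁻¹ ^ z.2 :=
    CRe.pow (Comp.of_computable (by fun_prop))
  have hg' : CRe nm fun t (z : (α × ℕ) × ℕ) => g t z.1.1 z.2 :=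
    hg.reindex (g := fun z : (α × ℕ) × ℕ => (z.1.1, z.2)) (by fun_prop)
  have hr : CRe nm fun (_ : T) (z : (α × ℕ) × ℕ) => ((rat z.1.2 : ℚ) : ℝ) :=
    CRe.of_rat (Comp.of_computable (by fun_prop))
  constructor
  · refine (Semi.ex (P := fun t (z : α × ℕ) k => ((rat z.2 : ℚ) : ℝ) <
      g t z.1 k - ((2 : ℝ)⁻¹ ^ k + (2 : ℝ)⁻¹ ^ k)) (hr.lt (hg'.sub (hp.add hp)))).congr
      fun t z => ⟨fun hz => ?_, ?_⟩
    · obtain ⟨k, hk⟩ := exists_pow_lt (show 0 < (f t z.1 - rat z.2) / 4 by linarith)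
      have := abs_le.1 (h t z.1 k)
      exact ⟨k, by linarith⟩
    · rintro ⟨k, hk⟩
      have := abs_le.1 (h t z.1 k)
      linarith
  · refine (Semi.ex (P := fun t (z : α × ℕ) k =>
      g t z.1 k + ((2 : ℝ)⁻¹ ^ k + (2 : ℝ)⁻¹ ^ k) < ((rat z.2 : ℚ) : ℝ))
      ((hg'.add (hp.add hp)).lt hr)).congr fun t z => ⟨fun hz => ?_, ?_⟩
    · obtain ⟨k, hk⟩ := exists_pow_lt (show 0 < (rat z.2 - f t z.1) / 4 by linarith)
      have := abs_le.1 (h t z.1 k)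
      exact ⟨k, by linarith⟩
    · rintro ⟨k, hk⟩
      have := abs_le.1 (h t z.1 k)
      linarith

end Real

/-! ### Points and open sets -/

section Metric

variable {X : Type*} [MetricSpace X] {ν : ℕ → X}

theorem cauchyName.dist_le {p : Baire} {x : X} (h : cauchyName ν p x) (i : ℕ) :
    dist (ν (p i)) x ≤ (2 : ℝ)⁻¹ ^ i := by
  refine le_of_tendsto (tendsto_const_nhds.dist h.2) (eventually_atTop.2 ⟨i, fun j hj => ?_⟩)
  simpa only [min_eq_left hj] using (h.1 i j).le

/-- The extra factor one half in the distance to the limit makes two such errors add up to less than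
the tolerance of the Cauchy condition. -/
theorem cauchyName_of_lt {p : Baire} {x : X} (h : ∀ i, dist (ν (p i)) x < (2 : ℝ)⁻¹ ^ (i + 1)) :
    cauchyName ν p x := by
  constructor
  · intro i j
    have hm : ∀ i, dist (ν (p i)) x < (2 : ℝ)⁻¹ ^ i / 2 := fun i => by
      have := h i
      rw [pow_succ] at this
      linarith
    have h1 : (2 : ℝ)⁻¹ ^ i ≤ (2 : ℝ)⁻¹ ^ min i j :=
      pow_le_pow_of_le_one (by norm_num) (by norm_num) (min_le_left _ _)
    have h2 : (2 : ℝ)⁻¹ ^ j ≤ (2 : ℝ)⁻¹ ^ min i j :=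
      pow_le_pow_of_le_one (by norm_num) (by norm_num) (min_le_right _ _)
    have := dist_triangle_right (ν (p i)) (ν (p j)) x
    linarith [hm i, hm j]
  · rw [tendsto_iff_dist_tendsto_zero]
    refine squeeze_zero (fun _ => dist_nonneg) (fun i => (h i).le) ?_
    exact (tendsto_pow_atTop_nhds_zero_of_lt_one (by norm_num)
      (by norm_num : (2 : ℝ)⁻¹ < 1)).comp (tendsto_add_atTop_nat 1)

theorem cauchyName_const (i : ℕ) : cauchyName ν (fun _ => i) (ν i) :=
  cauchyName_of_lt fun _ => by rw [dist_self]; positivity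

theorem exists_cauchyName (hν : DenseRange ν) (x : X) : ∃ p, cauchyName ν p x := by
  have h : ∀ i : ℕ, ∃ n, dist (ν n) x < (2 : ℝ)⁻¹ ^ (i + 1) := fun i => by
    obtain ⟨n, hn⟩ := hν.exists_dist_lt x (show (0 : ℝ) < 2⁻¹ ^ (i + 1) by positivity)
    exact ⟨n, by rwa [dist_comm]⟩
  choose p hp using h
  exact ⟨p, cauchyName_of_lt hp⟩

theorem mem_idealBall {z : X} {c : ℕ} :
    z ∈ idealBall ν c ↔ dist z (ν c.unpair.1) < ((posRat c.unpair.2 : ℚ) : ℝ) := Iff.rfl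

/-- Used to show that an enumeration by a strict inequality between centres and radii is exhaustive:
both the displacement of the centre and the radius can be made smaller than the available margin. -/
theorem exists_idealBall (hν : DenseRange ν) (z : X) {ε : ℝ} (hε : 0 < ε) :
    ∃ c, z ∈ idealBall ν c ∧ dist z (ν c.unpair.1) < ε ∧ ((posRat c.unpair.2 : ℚ) : ℝ) < ε := by
  obtain ⟨k, hk⟩ := exists_nat_one_div_lt hε
  have hr : ((posRat (Nat.pair 0 k) : ℚ) : ℝ) = 1 / ((k : ℝ) + 1) := by simp [posRat]
  obtain ⟨n, hn⟩ := hν.exists_dist_lt z (show 0 < 1 / ((k : ℝ) + 1) by positivity)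
  refine ⟨Nat.pair n (Nat.pair 0 k), ?_, ?_, ?_⟩
  · rw [mem_idealBall]
    simpa only [Nat.unpair_pair, hr] using hn
  · simpa only [Nat.unpair_pair] using hn.trans hk
  · simpa only [Nat.unpair_pair, hr] using hk

theorem isOpen_of_openName {p : Baire} {U : Set X} (h : openName ν p U) : IsOpen U := by
  rw [show U = _ from h]
  exact isOpen_biUnion fun _ _ => Metric.isOpen_ball

variable {T : Type*} {α β : Type} [Primcodable α] [Primcodable β] {nm : T → Baire}

theorem Named.isOpen {U : T → α → Set X} (h : Named nm (openName ν) U) (t : T) (a : α) :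
    IsOpen (U t a) := by
  obtain ⟨F, -, hF⟩ := h
  exact isOpen_of_openName (hF t a)

theorem CRe.dist_dense (hν : IsComputableMetricSpace ν) :
    CRe nm fun _ (z : ℕ × ℕ) => dist (ν z.1) (ν z.2) := by
  obtain ⟨f, hf, hfd⟩ := hν.computable_dist
  refine CRe.of_approx (g := fun _ z k => ((rat (f (z.1, z.2, k)) : ℚ) : ℝ))
    (CRe.of_rat (Comp.of_computable (by fun_prop))) fun t x k => (hfd x.1 x.2 k).trans ?_
  have : (0 : ℝ) < 2⁻¹ ^ k := by positivity
  linarith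

theorem CRe.dist (hν : IsComputableMetricSpace ν) {x y : T → α → X}
    (hx : Named nm (cauchyName ν) x) (hy : Named nm (cauchyName ν) y) :
    CRe nm fun t a => dist (x t a) (y t a) := by
  obtain ⟨F, hF, hFx⟩ := hx
  obtain ⟨G, hG, hGy⟩ := hy
  refine CRe.of_approx (g := fun t a k => Dist.dist (ν (F t (a, k))) (ν (G t (a, k))))
    ((CRe.dist_dense hν).subst (hF.pair hG)) fun t a k => ?_
  have h1 := (hFx t a).dist_le k
  have h2 := (hGy t a).dist_le k
  have h3 := dist_dist_dist_le (x t a) (y t a) (ν (F t (a, k))) (ν (G t (a, k)))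
  rw [Real.dist_eq] at h3
  rw [dist_comm] at h1 h2
  linarith

theorem Named.dense {G : T → α → ℕ} (hG : Comp nm G) :
    Named nm (cauchyName ν) fun t a => ν (G t a) :=
  ⟨fun t z => G t z.1, hG.reindex (by fun_prop), fun t a => cauchyName_const (G t a)⟩

/-- The standard way to name an open set: give a semidecidable set of ideal balls contained in it
that covers it. Not all contained balls need be listed, so a sufficient formal criterion for
inclusion is enough. -/
theorem Named.open_of {E : T → α × ℕ → Prop} (hE : Semi nm E) {U : T → α → Set X}
    (h1 : ∀ t a c, E t (a, c) → idealBall ν c ⊆ U t a)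
    (h2 : ∀ t a, ∀ z ∈ U t a, ∃ c, E t (a, c) ∧ z ∈ idealBall ν c) :
    Named nm (openName ν) U := by
  obtain ⟨F, hF, hFE⟩ := hE.enumerate
  refine ⟨F, hF, fun t a => Subset.antisymm (fun z hz => ?_) (iUnion₂_subset fun c hc => ?_)⟩
  · obtain ⟨c, hc, hzc⟩ := h2 t a z hz
    exact mem_iUnion₂.2 ⟨c, (hFE t a c).1 hc, hzc⟩
  · exact h1 t a c ((hFE t a c).2 hc)

theorem Named.exists_semi {U : T → α → Set X} (h : Named nm (openName ν) U) :
    ∃ E : T → α × ℕ → Prop, Semi nm E ∧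
      ∀ t a z, z ∈ U t a ↔ ∃ c, E t (a, c) ∧ z ∈ idealBall ν c := by
  obtain ⟨F, hF, hFU⟩ := h
  refine ⟨fun t z => ∃ i, F t (z.1, i) = z.2 + 1, ?_, fun t a z => ?_⟩
  · exact Semi.ex (Comp.semi_eq (hF.reindex (g := fun z : (α × ℕ) × ℕ => (z.1.1, z.2))
      (by fun_prop)) (Comp.of_computable (by fun_prop)))
  · rw [show U t a = _ from hFU t a]
    simp only [mem_iUnion₂, mem_ofPred_eq, exists_prop]

theorem CRe.radius {G : T → α → ℕ} (hG : Comp nm G) :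
    CRe nm fun t a => ((posRat (G t a).unpair.2 : ℚ) : ℝ) :=
  CRe.of_posRat (Comp.map (g := fun c => c.unpair.2) (by fun_prop) hG)

theorem CRe.dist_center (hν : IsComputableMetricSpace ν) {x : T → α → X} {G : T → α → ℕ}
    (hx : Named nm (cauchyName ν) x) (hG : Comp nm G) :
    CRe nm fun t a => Dist.dist (x t a) (ν (G t a).unpair.1) :=
  CRe.dist hν hx (Named.dense (Comp.map (g := fun c => c.unpair.1) (by fun_prop) hG))

theorem Semi.mem (hν : IsComputableMetricSpace ν) {U : T → α → Set X}
    (h : Named nm (openName ν) U) {x : T → α → X} (hx : Named nm (cauchyName ν) x) :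
    Semi nm fun t a => x t a ∈ U t a := by
  obtain ⟨E, hE, hEU⟩ := h.exists_semi
  have hc : Comp nm fun (_ : T) (z : α × ℕ) => z.2 := Comp.of_computable (by fun_prop)
  exact (Semi.ex (P := fun t a c => E t (a, c) ∧ x t a ∈ idealBall ν c)
    (Semi.and hE ((CRe.dist_center hν (hx.reindex (by fun_prop)) hc).lt
      (CRe.radius hc)))).congr fun t a => hEU t a (x t a)

/-- List the ideal balls that are formally inside, meaning that the distance of the centres plus the
ideal radius is below `r`. Half of the slack at `z` is enough margin for a formally included ball
around `z`. -/
theorem Named.ball (hν : IsComputableMetricSpace ν) {x : T → α → X} {r : T → α → ℝ}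
    (hx : Named nm (cauchyName ν) x) (hr : CRe nm r) :
    Named nm (openName ν) fun t a => Metric.ball (x t a) (r t a) := by
  have hc : Comp nm fun (_ : T) (z : α × ℕ) => z.2 := Comp.of_computable (by fun_prop)
  refine Named.open_of (((CRe.dist_center hν (hx.reindex (g := fun z : α × ℕ => z.1)
    (by fun_prop)) hc).add (CRe.radius hc)).lt (hr.reindex (g := fun z : α × ℕ => z.1)
    (by fun_prop))) (fun t a c hc z hz => ?_) fun t a z hz => ?_
  · rw [mem_idealBall] at hz
    rw [Metric.mem_ball]
    have := dist_triangle_right z (x t a) (ν c.unpair.1)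
    simp only at hc
    linarith
  · rw [Metric.mem_ball] at hz
    obtain ⟨c, h1, h2, h3⟩ := exists_idealBall hν.dense z
      (show 0 < (r t a - Dist.dist z (x t a)) / 2 by linarith)
    refine ⟨c, ?_, h1⟩
    have := dist_triangle_left (x t a) (ν c.unpair.1) z
    simp only
    linarith

/-- The exterior of a closed ball, listed through ideal balls that avoid it formally. With `r = 0`
it is the complement of a point. -/
theorem Named.far (hν : IsComputableMetricSpace ν) {x : T → α → X} {r : T → α → ℝ}
    (hx : Named nm (cauchyName ν) x) (hr : CRe nm r) :
    Named nm (openName ν) fun t a => {z | r t a < dist (x t a) z} := by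
  have hc : Comp nm fun (_ : T) (z : α × ℕ) => z.2 := Comp.of_computable (by fun_prop)
  refine Named.open_of (((hr.reindex (g := fun z : α × ℕ => z.1) (by fun_prop)).add
    (CRe.radius hc)).lt (CRe.dist_center hν (hx.reindex (g := fun z : α × ℕ => z.1)
    (by fun_prop)) hc)) (fun t a c hc z hz => ?_) fun t a z hz => ?_
  · rw [mem_idealBall] at hz
    rw [mem_ofPred_eq]
    have := dist_triangle (x t a) z (ν c.unpair.1)
    simp only at hc
    linarith
  · rw [mem_ofPred_eq] at hz
    obtain ⟨c, h1, h2, h3⟩ := exists_idealBall hν.dense z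
      (show 0 < (Dist.dist (x t a) z - r t a) / 2 by linarith)
    refine ⟨c, ?_, h1⟩
    have := dist_triangle_right (x t a) z (ν c.unpair.1)
    simp only
    linarith

theorem Named.biUnion {P : T → α → β → Prop} (hP : Semi nm fun t (z : α × β) => P t z.1 z.2)
    {U : T → α → β → Set X} (hU : Named nm (openName ν) fun t (z : α × β) => U t z.1 z.2) :
    Named nm (openName ν) fun t a => {z | ∃ b, P t a b ∧ z ∈ U t a b} := by
  obtain ⟨E, hE, hEU⟩ := hU.exists_semi
  refine Named.open_of (E := fun t z => ∃ b, P t z.1 b ∧ E t ((z.1, b), z.2)) ?_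
    (fun t a c hc z hz => ?_) fun t a z hz => ?_
  · refine Semi.ex (Semi.and ?_ ?_)
    · exact hP.reindex (g := fun z : (α × ℕ) × β => (z.1.1, z.2)) (by fun_prop)
    · exact hE.reindex (by fun_prop)
  · obtain ⟨b, hb, hc⟩ := hc
    exact ⟨b, hb, (hEU t (a, b) z).2 ⟨c, hc, hz⟩⟩
  · obtain ⟨b, hb, hz⟩ := hz
    obtain ⟨c, hc, hz⟩ := (hEU t (a, b) z).1 hz
    exact ⟨c, ⟨b, hb, hc⟩, hz⟩

/-- The condition does not involve the point, so the set is all of `U` or empty. Unions of such sets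
implement case distinctions between open sets. -/
theorem Named.sep {P : T → α → Prop} (hP : Semi nm P) {U : T → α → Set X}
    (hU : Named nm (openName ν) U) :
    Named nm (openName ν) fun t a => {z | P t a ∧ z ∈ U t a} :=
  (Named.biUnion (β := Unit) (P := fun t a _ => P t a) (U := fun t a _ => U t a)
    (hP.reindex (by fun_prop)) (hU.reindex (by fun_prop))).congr fun t a => by simp

theorem Named.whole (hν : DenseRange ν) :
    Named nm (openName ν) fun _ (_ : α) => (Set.univ : Set X) :=
  Named.open_of (Semi.const_true) (fun _ _ _ _ => subset_univ _) fun _ _ z _ =>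
    let ⟨c, hc, _⟩ := exists_idealBall hν z one_pos
    ⟨c, trivial, hc⟩

theorem Named.union {U V : T → α → Set X} (hU : Named nm (openName ν) U)
    (hV : Named nm (openName ν) V) : Named nm (openName ν) fun t a => U t a ∪ V t a := by
  obtain ⟨E, hE, hEU⟩ := hU.exists_semi
  obtain ⟨F, hF, hFV⟩ := hV.exists_semi
  refine Named.open_of (hE.or hF) (fun t a c hc z hz => ?_) fun t a z hz => ?_
  · exact hc.imp (fun hc => (hEU t a z).2 ⟨c, hc, hz⟩) fun hc => (hFV t a z).2 ⟨c, hc, hz⟩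
  · rcases hz with hz | hz
    · obtain ⟨c, hc, hz⟩ := (hEU t a z).1 hz
      exact ⟨c, Or.inl hc, hz⟩
    · obtain ⟨c, hc, hz⟩ := (hFV t a z).1 hz
      exact ⟨c, Or.inr hc, hz⟩

/-- List the ideal balls that, for every index below the bound, are formally included in some ball
enumerated into the corresponding set. Finiteness supplies a common positive margin at each point of
the intersection. -/
theorem Named.biInter (hν : IsComputableMetricSpace ν) {n : T → α → ℕ} (hn : Comp nm n)
    {U : T → α → ℕ → Set X} (hU : Named nm (openName ν) fun t (z : α × ℕ) => U t z.1 z.2) :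
    Named nm (openName ν) fun t a => {z | ∀ i < n t a, z ∈ U t a i} := by
  suffices h : Named nm (openName ν) fun t (y : α × ℕ) => {z | ∀ i < y.2, z ∈ U t y.1 i} from
    h.subst (G := fun t a => (a, n t a)) ((Comp.of_computable (by fun_prop)).pair hn)
  obtain ⟨E, hE, hEU⟩ := hU.exists_semi
  have h1 : CRe nm fun (_ : T) (y : (((α × ℕ) × ℕ) × ℕ) × ℕ) =>
      Dist.dist (ν y.1.1.2.unpair.1) (ν y.2.unpair.1) :=
    (CRe.dist_dense hν).reindex (g := fun y : (((α × ℕ) × ℕ) × ℕ) × ℕ =>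
      (y.1.1.2.unpair.1, y.2.unpair.1)) (by fun_prop)
  have h2 : CRe nm fun (_ : T) (y : (((α × ℕ) × ℕ) × ℕ) × ℕ) =>
      ((posRat y.1.1.2.unpair.2 : ℚ) : ℝ) := CRe.of_posRat (Comp.of_computable (by fun_prop))
  have h3 : CRe nm fun (_ : T) (y : (((α × ℕ) × ℕ) × ℕ) × ℕ) =>
      ((posRat y.2.unpair.2 : ℚ) : ℝ) := CRe.of_posRat (Comp.of_computable (by fun_prop))
  have h4 : Semi nm fun t (y : (((α × ℕ) × ℕ) × ℕ) × ℕ) => E t ((y.1.1.1.1, y.1.2), y.2) :=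
    hE.reindex (by fun_prop)
  have h5 : Semi nm fun t (y : ((α × ℕ) × ℕ) × ℕ) => ∃ c', E t ((y.1.1.1, y.2), c') ∧
      Dist.dist (ν y.1.2.unpair.1) (ν c'.unpair.1) + ((posRat y.1.2.unpair.2 : ℚ) : ℝ) <
        ((posRat c'.unpair.2 : ℚ) : ℝ) := Semi.ex (h4.and ((h1.add h2).lt h3))
  refine Named.open_of (Semi.allLt (P := fun t (y : (α × ℕ) × ℕ) i => ∃ c',
      E t ((y.1.1, i), c') ∧ Dist.dist (ν y.2.unpair.1) (ν c'.unpair.1) +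
      ((posRat y.2.unpair.2 : ℚ) : ℝ) < ((posRat c'.unpair.2 : ℚ) : ℝ)) h5
    (n := fun y : (α × ℕ) × ℕ => y.1.2) (by fun_prop)) (fun t a c hc z hz i hi => ?_)
    fun t a z hz => ?_
  · obtain ⟨c', hc', hcc⟩ := hc i hi
    refine (hEU t (a.1, i) z).2 ⟨c', hc', ?_⟩
    rw [mem_idealBall] at hz ⊢
    have := dist_triangle z (ν c.unpair.1) (ν c'.unpair.1)
    simp only at hcc
    linarith
  · have hz' : ∀ i, ∃ c', i < a.2 → E t ((a.1, i), c') ∧ z ∈ idealBall ν c' := fun i => by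
      by_cases hi : i < a.2
      · obtain ⟨c', hc'⟩ := (hEU t (a.1, i) z).1 (hz i hi)
        exact ⟨c', fun _ => hc'⟩
      · exact ⟨0, fun h => absurd h hi⟩
    choose c' hc' using hz'
    -- Twice the margin is reserved: once for moving the centre away from `z` and once for the
    -- radius of the new ball.
    have hε : ∃ ε > 0, ∀ i < a.2, Dist.dist z (ν (c' i).unpair.1) + 2 * ε ≤
        ((posRat (c' i).unpair.2 : ℚ) : ℝ) := by
      generalize a.2 = N at hc'
      induction N with
      | zero => exact ⟨1, one_pos, fun i hi => absurd hi (Nat.not_lt_zero i)⟩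
      | succ N ih =>
        obtain ⟨ε, hε, h⟩ := ih fun i hi => hc' i (by omega)
        have hN := (hc' N (by omega)).2
        rw [mem_idealBall] at hN
        refine ⟨min ε ((((posRat (c' N).unpair.2 : ℚ) : ℝ) - Dist.dist z (ν (c' N).unpair.1)) / 2),
          lt_min hε (by linarith), fun i hi => ?_⟩
        rcases Nat.lt_succ_iff_lt_or_eq.1 hi with hi | rfl
        · have := min_le_left ε
            ((((posRat (c' N).unpair.2 : ℚ) : ℝ) - Dist.dist z (ν (c' N).unpair.1)) / 2)
          linarith [h i hi]
        · have := min_le_right ε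
            ((((posRat (c' i).unpair.2 : ℚ) : ℝ) - Dist.dist z (ν (c' i).unpair.1)) / 2)
          linarith
    obtain ⟨ε, hε, h⟩ := hε
    obtain ⟨c, hzc, hc1, hc2⟩ := exists_idealBall hν.dense z hε
    refine ⟨c, fun i hi => ⟨c' i, (hc' i hi).1, ?_⟩, hzc⟩
    have := dist_triangle_left (ν c.unpair.1) (ν (c' i).unpair.1) z
    have := h i hi
    simp only
    linarith

theorem Named.inter (hν : IsComputableMetricSpace ν) {U V : T → α → Set X}
    (hU : Named nm (openName ν) U) (hV : Named nm (openName ν) V) :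
    Named nm (openName ν) fun t a => U t a ∩ V t a := by
  have h : Named nm (openName ν) fun t (y : α × ℕ) =>
      {z | y.2 = 0 ∧ z ∈ U t y.1} ∪ {z | y.2 ≠ 0 ∧ z ∈ V t y.1} :=
    (Named.sep (Comp.semi_eq (Comp.of_computable (by fun_prop))
      (Comp.of_computable (by fun_prop))) (hU.reindex (by fun_prop))).union
    (Named.sep (Comp.semi_ne (Comp.of_computable (by fun_prop))
      (Comp.of_computable (by fun_prop))) (hV.reindex (by fun_prop)))
  refine (Named.biInter hν (n := fun _ _ => 2) (Comp.of_computable (by fun_prop))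
    (U := fun t a i => {z | i = 0 ∧ z ∈ U t a} ∪ {z | i ≠ 0 ∧ z ∈ V t a}) h).congr
    fun t a => ?_
  ext z
  constructor
  · rintro ⟨hu, hv⟩ i hi
    by_cases h0 : i = 0
    · exact Or.inl ⟨h0, hu⟩
    · exact Or.inr ⟨h0, hv⟩
  · intro hz
    exact ⟨(hz 0 (by omega)).elim (fun h => h.2) fun h => absurd rfl h.1,
      (hz 1 (by omega)).elim (fun h => absurd h.1 (by omega)) fun h => h.2⟩

end Metric
section Sets

variable {X : Type*} [MetricSpace X] {ν : ℕ → X} {T T' : Type*} {α β : Type} [Primcodable α]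
  [Primcodable β] {nm : T → Baire} {nm' : T' → Baire}

/-! ### Making open sets disjoint -/

/-- Exhaust the sets by open balls whose closed counterparts, with the same radius, still lie in the
set. From each ball remove the closed balls with a smaller number that belong to other sets. Two
kept balls of different sets are then disjoint, and a point lying in only one of the original sets
is never removed, since every closed ball removed lies in another set. -/
theorem Named.exists_pairwise_disjoint (hν : IsComputableMetricSpace ν) {W : T → α → ℕ → Set X}
    (hW : Named nm (openName ν) fun t (z : α × ℕ) => W t z.1 z.2) :
    ∃ W' : T → α → ℕ → Set X, Named nm (openName ν) (fun t (z : α × ℕ) => W' t z.1 z.2) ∧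
      ∀ t a, (Pairwise fun i j => Disjoint (W' t a i) (W' t a j)) ∧
        ∀ i, W' t a i ⊆ W t a i ∧ ∀ z ∈ W t a i, (∀ j, j ≠ i → z ∉ W t a j) → z ∈ W' t a i := by
  obtain ⟨F, hF, hFW⟩ := hW
  -- A number `k` codes `⟨i, ⟨j, l⟩⟩`: entry `j` of the name of the `i`-th set, with its radius
  -- reduced by `2⁻ˡ`.
  let G : T → α × ℕ → ℕ := fun t y => F t ((y.1, y.2.unpair.1), y.2.unpair.2.unpair.1)
  have hG : Comp nm G := hF.reindex (by fun_prop)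
  let ctr : T → α × ℕ → ℕ := fun t y => (G t y - 1).unpair.1
  have hctr : Comp nm ctr := Comp.map (g := fun n => (n - 1).unpair.1) (by fun_prop) hG
  -- A padding entry receives the radius `-1`, so that its open ball is empty and its exterior is
  -- the whole space.
  let rad : T → α × ℕ → ℝ := fun t y => ((rat (bif G t y = 0 then ratCode 0 1 0 else
    ratAdd (ratPos (G t y - 1).unpair.2) (ratNeg (ratPow y.2.unpair.2.unpair.2))) : ℚ) : ℝ)
  have hrad : CRe nm rad := CRe.of_rat (Comp.map (g := fun y : ℕ × ℕ => bif y.1 = 0 then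
    ratCode 0 1 0 else ratAdd (ratPos (y.1 - 1).unpair.2) (ratNeg (ratPow y.2))) (by fun_prop)
    (hG.pair (Comp.of_computable (g := fun y : α × ℕ => y.2.unpair.2.unpair.2) (by fun_prop))))
  have hrad0 : ∀ t y, G t y = 0 → rad t y = -1 := fun t y h => by
    simp [rad, h, rat_ratCode]
  have hrad1 : ∀ t y, G t y ≠ 0 → rad t y = ((posRat (G t y - 1).unpair.2 : ℚ) : ℝ) -
      (2 : ℝ)⁻¹ ^ y.2.unpair.2.unpair.2 := fun t y h => by
    simp only [rad, h, decide_false, cond_false, rat_ratAdd, rat_ratPos, rat_ratNeg,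
      Rat.cast_add, Rat.cast_neg, rat_ratPow]
    ring
  have hclosed : ∀ t a k z, dist (ν (ctr t (a, k))) z ≤ rad t (a, k) → z ∈ W t a k.unpair.1 := by
    intro t a k z h
    have h0 : G t (a, k) ≠ 0 := fun h0 => by
      rw [hrad0 t _ h0] at h
      linarith [dist_nonneg (x := ν (ctr t (a, k))) (y := z)]
    rw [hrad1 t _ h0, dist_comm] at h
    rw [show W t a k.unpair.1 = _ from hFW t (a, k.unpair.1)]
    refine mem_iUnion₂.2 ⟨G t (a, k) - 1, ⟨k.unpair.2.unpair.1, ?_⟩, ?_⟩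
    · exact (Nat.succ_pred_eq_of_ne_zero h0).symm
    · rw [mem_idealBall]
      have : (0 : ℝ) < 2⁻¹ ^ k.unpair.2.unpair.2 := by positivity
      simp only [ctr] at h
      linarith
  have hopen : ∀ t a i, ∀ z ∈ W t a i, ∃ k : ℕ, k.unpair.1 = i ∧
      z ∈ Metric.ball (ν (ctr t (a, k))) (rad t (a, k)) := by
    intro t a i z hz
    rw [show W t a i = _ from hFW t (a, i)] at hz
    obtain ⟨c, ⟨j, hj⟩, hz⟩ := mem_iUnion₂.1 hz
    rw [mem_idealBall] at hz
    obtain ⟨l, hl⟩ := exists_pow_lt (sub_pos.2 hz)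
    have hGc : G t (a, Nat.pair i (Nat.pair j l)) = c + 1 := by simpa [G] using hj
    refine ⟨Nat.pair i (Nat.pair j l), by simp, ?_⟩
    rw [Metric.mem_ball, hrad1 t _ (by omega)]
    simp only [ctr, hGc, Nat.add_sub_cancel, Nat.unpair_pair]
    linarith
  -- Balls with the same index `i` impose no restriction on each other; all others up to number `k`
  -- must be avoided together with their boundary.
  refine ⟨fun t a i => {z | ∃ k : ℕ, k.unpair.1 = i ∧
    z ∈ Metric.ball (ν (ctr t (a, k))) (rad t (a, k)) ∩ {z | ∀ k' < k + 1,
      z ∈ {z | k'.unpair.1 = i ∧ z ∈ (univ : Set X)} ∪ {z | rad t (a, k') <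
        dist (ν (ctr t (a, k'))) z}}}, ?_, fun t a => ⟨?_, fun i => ⟨?_, ?_⟩⟩⟩
  · refine Named.biUnion (P := fun t (y : α × ℕ) (k : ℕ) => k.unpair.1 = y.2)
      (U := fun t (y : α × ℕ) k => Metric.ball (ν (ctr t (y.1, k))) (rad t (y.1, k)) ∩
        {z | ∀ k' < k + 1, z ∈ {z | k'.unpair.1 = y.2 ∧ z ∈ (univ : Set X)} ∪
          {z | rad t (y.1, k') < dist (ν (ctr t (y.1, k'))) z}}) ?_ (Named.inter hν ?_ ?_)
    · exact Comp.semi_eq (Comp.of_computable (by fun_prop)) (Comp.of_computable (by fun_prop))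
    · exact Named.ball hν (Named.dense (hctr.reindex (g := fun y : (α × ℕ) × ℕ => (y.1.1, y.2))
        (by fun_prop))) (hrad.reindex (g := fun y : (α × ℕ) × ℕ => (y.1.1, y.2)) (by fun_prop))
    · refine Named.biInter hν (n := fun t (y : (α × ℕ) × ℕ) => y.2 + 1)
        (U := fun t (y : (α × ℕ) × ℕ) k' => {z | k'.unpair.1 = y.1.2 ∧ z ∈ (univ : Set X)} ∪
          {z | rad t (y.1.1, k') < dist (ν (ctr t (y.1.1, k'))) z})
        (Comp.of_computable (by fun_prop)) (Named.union (Named.sep ?_ (Named.whole hν.dense))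
          (Named.far hν (Named.dense ?_) ?_))
      · exact Comp.semi_eq (Comp.of_computable (by fun_prop)) (Comp.of_computable (by fun_prop))
      · exact hctr.reindex (g := fun y : ((α × ℕ) × ℕ) × ℕ => (y.1.1.1, y.2)) (by fun_prop)
      · exact hrad.reindex (g := fun y : ((α × ℕ) × ℕ) × ℕ => (y.1.1.1, y.2)) (by fun_prop)
  · have key : ∀ i j k l z, i ≠ j → k ≤ l → Nat.unpair k = (i, (Nat.unpair k).2) →
        z ∈ Metric.ball (ν (ctr t (a, k))) (rad t (a, k)) →
        (∀ k' < l + 1, z ∈ {z | k'.unpair.1 = j ∧ z ∈ (univ : Set X)} ∪ {z | rad t (a, k') <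
        dist (ν (ctr t (a, k'))) z}) → False := by
      intro i j k l z hij hkl hk hz h
      rcases h k (by omega) with h | h
      · exact hij (by rw [← h.1, hk])
      · rw [Metric.mem_ball, dist_comm] at hz
        exact lt_asymm hz h
    intro i j hij
    refine Set.disjoint_left.2 ?_
    rintro z ⟨k, rfl, hzk, hk⟩ ⟨l, rfl, hzl, hl⟩
    rcases le_total k l with h | h
    · exact key _ _ k l z hij h rfl hzk hl
    · exact key _ _ l k z hij.symm h rfl hzl hk
  · rintro z ⟨k, rfl, hz, -⟩
    rw [Metric.mem_ball, dist_comm] at hz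
    exact hclosed t a k z hz.le
  · intro z hz hj
    obtain ⟨k, hk, hzk⟩ := hopen t a i z hz
    refine ⟨k, hk, hzk, fun k' _ => ?_⟩
    by_cases h : k'.unpair.1 = i
    · exact Or.inl ⟨h, mem_univ z⟩
    · refine Or.inr (lt_of_not_ge fun hle => hj _ h (hclosed t a k' z hle))

/-- The two-set case of the previous disjointification. Only points of the overlap can be lost, so
sets covering `Y` stay covering once their overlap misses `Y`. -/
theorem Named.exists_disjoint (hν : IsComputableMetricSpace ν) {U V : T → α → Set X}
    (hU : Named nm (openName ν) U) (hV : Named nm (openName ν) V) :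
    ∃ U' V' : T → α → Set X, Named nm (openName ν) U' ∧ Named nm (openName ν) V' ∧
      ∀ t a, Disjoint (U' t a) (V' t a) ∧ U' t a ⊆ U t a ∧ V' t a ⊆ V t a ∧
        U t a \ V t a ⊆ U' t a ∧ V t a \ U t a ⊆ V' t a := by
  have h : Named nm (openName ν) fun t (y : α × ℕ) =>
      {z | y.2 = 0 ∧ z ∈ U t y.1} ∪ {z | y.2 = 1 ∧ z ∈ V t y.1} :=
    (Named.sep (Comp.semi_eq (Comp.of_computable (by fun_prop))
      (Comp.of_computable (by fun_prop))) (hU.reindex (by fun_prop))).union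
    (Named.sep (Comp.semi_eq (Comp.of_computable (by fun_prop))
      (Comp.of_computable (by fun_prop))) (hV.reindex (by fun_prop)))
  obtain ⟨W, hW, hWd⟩ := Named.exists_pairwise_disjoint hν
    (W := fun t a i => {z | i = 0 ∧ z ∈ U t a} ∪ {z | i = 1 ∧ z ∈ V t a}) h
  refine ⟨fun t a => W t a 0, fun t a => W t a 1,
    hW.reindex (g := fun a => (a, 0)) (by fun_prop),
    hW.reindex (g := fun a => (a, 1)) (by fun_prop), fun t a =>
    ⟨(hWd t a).1 zero_ne_one, fun z hz => ?_, fun z hz => ?_, fun z hz => ?_, fun z hz => ?_⟩⟩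
  · rcases ((hWd t a).2 0).1 hz with h | h
    exacts [h.2, absurd h.1 zero_ne_one]
  · rcases ((hWd t a).2 1).1 hz with h | h
    exacts [absurd h.1 one_ne_zero, h.2]
  · refine ((hWd t a).2 0).2 z (Or.inl ⟨rfl, hz.1⟩) fun j hj h => ?_
    rcases h with h | h
    exacts [hj h.1, hz.2 h.2]
  · refine ((hWd t a).2 1).2 z (Or.inr ⟨rfl, hz.1⟩) fun j hj h => ?_
    rcases h with h | h
    exacts [hz.2 h.2, hj h.1]

/-- Reduction of a semidecidable family of clopen partitions. -/
theorem Named.exists_reduction (hν : IsComputableMetricSpace ν) {U : T → ℕ → Set X}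
    {Y : T → Set X} {Good : T → β → Prop} (hGood : Semi nm Good) {ι : β → ℕ}
    (hι : Computable ι) {V W : T → β → Set X} (hV : Named nm (openName ν) V)
    (hW : Named nm (openName ν) W)
    (h : ∀ t b, Good t b → Disjoint (V t b) (W t b) ∧ Y t ⊆ V t b ∪ W t b ∧ V t b ⊆ U t (ι b))
    (hcov : ∀ t, ∀ y ∈ Y t, ∃ b, Good t b ∧ y ∈ V t b) :
    ∃ P : T → Unit → ℕ → Set X, Named nm (openName ν) (fun t (z : Unit × ℕ) => P t z.1 z.2) ∧
      ∀ t, (∀ i, P t () i ⊆ U t i) ∧ Y t ⊆ ⋃ i, P t () i ∧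
        Pairwise fun i j => Disjoint (P t () i) (P t () j) := by
  have hG' : Semi nm fun t (z : Unit × ℕ) => ∃ b, Encodable.encode b = z.2 ∧ Good t b :=
    Semi.ex (Semi.and (Comp.semi_eq (Comp.of_computable (by fun_prop))
      (Comp.of_computable (by fun_prop)))
      (hGood.reindex (g := fun z : (Unit × ℕ) × β => z.2) (by fun_prop)))
  obtain ⟨F, hF, hFG⟩ := hG'.enumerate
  have hFgood : ∀ t n b, F t ((), n) = Encodable.encode b + 1 → Good t b := fun t n b hb => by
    obtain ⟨b', hb', hg⟩ := (hFG t () (Encodable.encode b)).2 ⟨n, hb⟩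
    rwa [← Encodable.encode_injective hb']
  -- A point enters through the `n`-th pair if it lies in its `V` and in the `W` of every earlier
  -- pair. This openly expresses that `n` is the first pair whose `V` contains the point; `Y ⊆ V ∪
  -- W` makes it exhaustive on `Y`, and `V ∩ W = ∅` makes it exclusive in all of `X`. Padding
  -- entries `0` impose no condition.
  let P : T → Unit → ℕ → Set X := fun t _ i => {z | ∃ n : ℕ, True ∧
    z ∈ {z | ∃ b, (F t ((), n) = Encodable.encode b + 1 ∧ ι b = i) ∧ z ∈ V t b} ∩
      {z | ∀ m < n, z ∈ {z | F t ((), m) = 0 ∧ z ∈ (univ : Set X)} ∪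
        {z | ∃ b, F t ((), m) = Encodable.encode b + 1 ∧ z ∈ W t b}}}
  refine ⟨P, ?_, fun t => ⟨?_, ?_, ?_⟩⟩
  · refine Named.biUnion (P := fun t _ _ => True) (U := fun t (y : Unit × ℕ) (n : ℕ) =>
      {z | ∃ b, (F t ((), n) = Encodable.encode b + 1 ∧ ι b = y.2) ∧ z ∈ V t b} ∩
      {z | ∀ m < n, z ∈ {z | F t ((), m) = 0 ∧ z ∈ (univ : Set X)} ∪
        {z | ∃ b, F t ((), m) = Encodable.encode b + 1 ∧ z ∈ W t b}}) Semi.const_true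
      (Named.inter hν ?_ ?_)
    · refine Named.biUnion (P := fun t (y : (Unit × ℕ) × ℕ) b =>
        F t ((), y.2) = Encodable.encode b + 1 ∧ ι b = y.1.2) (U := fun t _ b => V t b)
        (Semi.and ?_ ?_) (hV.reindex (by fun_prop))
      · exact Comp.semi_eq (hF.reindex (g := fun y : ((Unit × ℕ) × ℕ) × β => ((), y.1.2))
          (by fun_prop)) (Comp.of_computable (by fun_prop))
      · exact Comp.semi_eq (Comp.of_computable (by fun_prop)) (Comp.of_computable (by fun_prop))
    · refine Named.biInter hν (n := fun t (y : (Unit × ℕ) × ℕ) => y.2)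
        (U := fun t _ m => {z | F t ((), m) = 0 ∧ z ∈ (univ : Set X)} ∪
          {z | ∃ b, F t ((), m) = Encodable.encode b + 1 ∧ z ∈ W t b})
        (Comp.of_computable (by fun_prop)) (Named.union (Named.sep ?_ (Named.whole hν.dense)) ?_)
      · exact Comp.semi_eq (hF.reindex (g := fun y : ((Unit × ℕ) × ℕ) × ℕ => ((), y.2))
          (by fun_prop)) (Comp.of_computable (by fun_prop))
      · refine Named.biUnion (P := fun t (y : ((Unit × ℕ) × ℕ) × ℕ) b =>
          F t ((), y.2) = Encodable.encode b + 1) (U := fun t _ b => W t b) ?_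
          (hW.reindex (by fun_prop))
        exact Comp.semi_eq (hF.reindex (g := fun y : (((Unit × ℕ) × ℕ) × ℕ) × β =>
          ((), y.1.2)) (by fun_prop)) (Comp.of_computable (by fun_prop))
  · rintro i z ⟨n, -, ⟨b, ⟨hb, rfl⟩, hz⟩, -⟩
    exact (h t b (hFgood t n b hb)).2.2 hz
  · intro y hy
    have hex : ∃ n b, F t ((), n) = Encodable.encode b + 1 ∧ y ∈ V t b := by
      obtain ⟨b, hb, hyb⟩ := hcov t y hy
      obtain ⟨n, hn⟩ := (hFG t () (Encodable.encode b)).1 ⟨b, rfl, hb⟩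
      exact ⟨n, b, hn, hyb⟩
    classical
    obtain ⟨b, hb, hyb⟩ := Nat.find_spec hex
    refine mem_iUnion.2 ⟨ι b, Nat.find hex, trivial, ⟨b, ⟨hb, rfl⟩, hyb⟩, fun m hm => ?_⟩
    rcases Nat.eq_zero_or_pos (F t ((), m)) with h0 | h0
    · exact Or.inl ⟨h0, mem_univ y⟩
    · obtain ⟨b', hb', -⟩ := (hFG t () (F t ((), m) - 1)).2 ⟨m, by omega⟩
      have hb'' : F t ((), m) = Encodable.encode b' + 1 := by omega
      refine Or.inr ⟨b', hb'', ((h t b' (hFgood t m b' hb'')).2.1 hy).resolve_left fun hv => ?_⟩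
      exact Nat.find_min hex hm ⟨b', hb'', hv⟩
  · have key : ∀ {n n' i z}, n < n' →
        (z ∈ {z | ∃ b, (F t ((), n) = Encodable.encode b + 1 ∧ ι b = i) ∧ z ∈ V t b}) →
        (∀ m < n', z ∈ {z | F t ((), m) = 0 ∧ z ∈ (univ : Set X)} ∪
          {z | ∃ b, F t ((), m) = Encodable.encode b + 1 ∧ z ∈ W t b}) → False := by
      rintro n n' i z hn ⟨b, ⟨hb, -⟩, hz⟩ hm
      rcases hm n hn with h' | ⟨b', hb', hz'⟩
      · have := h'.1
        omega
      · obtain rfl : b = b' := Encodable.encode_injective (by omega)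
        exact Set.disjoint_left.1 (h t b (hFgood t n b hb)).1 hz hz'
    intro i j hij
    refine Set.disjoint_left.2 ?_
    rintro z ⟨n, -, hzn, hn⟩ ⟨n', -, hzn', hn'⟩
    rcases lt_trichotomy n n' with h' | rfl | h'
    · exact key h' hzn hn'
    · obtain ⟨b, ⟨hb, hi⟩, -⟩ := hzn
      obtain ⟨b', ⟨hb', hj⟩, -⟩ := hzn'
      obtain rfl : b = b' := Encodable.encode_injective (by omega)
      exact hij (hi.symm.trans hj)
    · exact key h' hzn' hn

/-- Here the auxiliary situation exists only when `S t b` holds; otherwise the set is empty, which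
costs nothing because an enumeration may simply wait for `S`. -/
theorem Named.pull_open {U : T' → Unit → Set X} (hU : Named nm' (openName ν) U)
    {S : T → β → Prop} (hS : Semi nm S) (φ : ∀ t b, S t b → T') {F : T → β × ℕ → ℕ}
    (hF : Comp nm F) (h : ∀ t b hs k, nm' (φ t b hs) k = F t (b, k)) :
    Named nm (openName ν) fun t b => {z | ∃ hs : S t b, z ∈ U (φ t b hs) ()} := by
  obtain ⟨E, hE, hEU⟩ := hU.exists_semi
  refine Named.open_of (Semi.pull (hE.reindex (g := fun c : ℕ => ((), c)) (by fun_prop)) hS φ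
    hF h) (fun t b c ⟨hs, hc⟩ z hz => ⟨hs, (hEU _ _ _).2 ⟨c, hc, hz⟩⟩) ?_
  rintro t b z ⟨hs, hz⟩
  obtain ⟨c, hc, hz⟩ := (hEU _ _ _).1 hz
  exact ⟨c, ⟨hs, hc⟩, hz⟩

/-- Finite use: acceptance reads only a finite part of the name, hence it persists for every
situation agreeing on that part. -/
theorem Semi.exists_prefix {P : T → α → Prop} (hP : Semi nm P) {t : T} {x : α} (h : P t x) :
    ∃ m, ∀ t', (∀ k < m, nm t' k = nm t k) → P t' x := by
  obtain ⟨D, -, -, hDP⟩ := hP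
  obtain ⟨m, hm⟩ := (hDP t x).1 h
  exact ⟨m, fun t' ht' => (hDP t' x).2 ⟨m, by rwa [prefixOf_congr ht']⟩⟩

/-! ### Adjoining a named point -/

/-- Situations extended by a named point of a set `A t`. -/
abbrev WithPoint (ν : ℕ → X) (A : T → Set X) : Type _ :=
  {s : T × Baire × X // cauchyName ν s.2.1 s.2.2 ∧ s.2.2 ∈ A s.1}

/-- The name of a situation extended by a named point. -/
def withPointName (nm : T → Baire) (A : T → Set X) : WithPoint ν A → Baire :=
  fun s => ilv s.1.2.1 (nm s.1.1)

theorem WithPoint.comp_base (A : T → Set X) :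
    Comp (withPointName (ν := ν) nm A) fun s k => nm s.1.1 k :=
  Comp.right_name (q := fun s : WithPoint ν A => s.1.2.1) fun _ => rfl

theorem WithPoint.comp_point (A : T → Set X) :
    Comp (withPointName (ν := ν) nm A) fun s k => s.1.2.1 k :=
  Comp.left_name (base := fun s : WithPoint ν A => s.1.1) fun _ => rfl

theorem WithPoint.named (A : T → Set X) :
    Named (withPointName (ν := ν) nm A) (cauchyName ν) fun s (_ : Unit) => s.1.2.2 :=
  ⟨fun s z => s.1.2.1 z.2, (WithPoint.comp_point A).reindex (by fun_prop), fun s _ => s.2.1⟩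

/-! ### Finite words as approximations to named points -/

theorem cauchyName_of_lt' {p : Baire} {x : X}
    (h : ∀ j, ∀ i < j, dist (ν (p i)) (ν (p j)) < (2 : ℝ)⁻¹ ^ i)
    (hlim : Tendsto (fun i => ν (p i)) atTop (𝓝 x)) : cauchyName ν p x := by
  refine ⟨fun i j => ?_, hlim⟩
  rcases lt_trichotomy i j with hij | rfl | hij
  · rw [min_eq_left hij.le]
    exact h j i hij
  · rw [dist_self]
    positivity
  · rw [min_eq_right hij.le, dist_comm]
    exact h i j hij

/-- Finite prefixes of names. -/
def IsValid (ν : ℕ → X) (σ : List ℕ) : Prop :=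
  ∀ j < σ.length, ∀ i < j, dist (ν (σ.getD i 0)) (ν (σ.getD j 0)) < (2 : ℝ)⁻¹ ^ i

theorem IsValid.semi (hν : IsComputableMetricSpace ν) {G : α → List ℕ} (hG : Computable G) :
    Semi nm fun _ x => IsValid ν (G x) := by
  refine Semi.allLt (Semi.allLt (P := fun _ (x : α × ℕ) i =>
    dist (ν ((G x.1).getD i 0)) (ν ((G x.1).getD x.2 0)) < (2 : ℝ)⁻¹ ^ i)
    (CRe.lt ?_ (CRe.pow (Comp.of_computable (by fun_prop)))) (n := fun x => x.2) (by fun_prop))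
    (by fun_prop)
  exact (CRe.dist_dense hν).reindex (g := fun x : (α × ℕ) × ℕ =>
    ((G x.1.1).getD x.2 0, (G x.1.1).getD x.1.2 0)) (by fun_prop)

/-- The last entry. -/
def lastEntry (σ : List ℕ) : ℕ := σ.getD (σ.length - 1) 0

/-- Extension of a finite sequence by repetition of the last entry. -/
def extend (σ : List ℕ) : Baire := fun k => bif Nat.ble σ.length k then lastEntry σ else σ.getD k 0

@[fun_prop]
theorem computable_lastEntry {α : Type*} [Primcodable α] {f : α → List ℕ} (hf : Computable f) :
    Computable fun x => lastEntry (f x) := by unfold lastEntry; fun_prop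

@[fun_prop]
theorem computable_extend {α : Type*} [Primcodable α] {f : α → List ℕ} {g : α → ℕ}
    (hf : Computable f) (hg : Computable g) :
    Computable fun x => extend (f x) (g x) := by unfold extend; fun_prop

theorem extend_of_lt {σ : List ℕ} {k : ℕ} (h : k < σ.length) : extend σ k = σ.getD k 0 := by
  have : Nat.ble σ.length k = false := by
    rw [← Bool.not_eq_true, Nat.ble_eq]
    omega
  simp [extend, this]

theorem extend_of_le {σ : List ℕ} {k : ℕ} (h : σ.length ≤ k) : extend σ k = lastEntry σ := by
  have : Nat.ble σ.length k = true := by rwa [Nat.ble_eq]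
  simp [extend, this]

theorem extend_prefixOf {q : Baire} {m i : ℕ} (h : i < m) : extend (prefixOf q m) i = q i := by
  rw [extend_of_lt (by rwa [length_prefixOf]), getD_prefixOf h]

theorem lastEntry_prefixOf (q : Baire) (m : ℕ) : lastEntry (prefixOf q (m + 1)) = q m := by
  rw [lastEntry, length_prefixOf, Nat.add_sub_cancel, getD_prefixOf (Nat.lt_succ_self m)]

/-- A valid word continued by its last entry names the dense point of that entry, so each such word
supplies a concrete named point. The empty word gives `ν 0`. -/
theorem IsValid.cauchyName {σ : List ℕ} (h : IsValid ν σ) :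
    cauchyName ν (extend σ) (ν (lastEntry σ)) := by
  refine cauchyName_of_lt' (fun j i hij => ?_) ?_
  · by_cases hi : i < σ.length
    · rw [extend_of_lt hi]
      by_cases hj : j < σ.length
      · rw [extend_of_lt hj]
        exact h j hj i hij
      · rw [extend_of_le (by omega), lastEntry]
        by_cases hl : i = σ.length - 1
        · rw [← hl, dist_self]
          positivity
        · exact h _ (by omega) i (by omega)
    · rw [extend_of_le (by omega), extend_of_le (by omega), dist_self]
      positivity
  · refine tendsto_const_nhds.congr' ?_
    filter_upwards [eventually_ge_atTop σ.length] with k hk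
    rw [extend_of_le hk]

theorem cauchyName.isValid {q : Baire} {x : X} (h : cauchyName ν q x) (m : ℕ) :
    IsValid ν (prefixOf q m) := by
  intro j hj i hij
  rw [length_prefixOf] at hj
  rw [getD_prefixOf hj, getD_prefixOf (hij.trans hj)]
  simpa only [min_eq_left hij.le] using h.1 i j

/-- The tasks: finite prefixes of names whose canonical extension names a point of `A t`. -/
def Task (ν : ℕ → X) (A : T → Set X) (t : T) (σ : List ℕ) : Prop :=
  IsValid ν σ ∧ ν (lastEntry σ) ∈ A t

/-- The situation belonging to a task. -/
def Task.point {A : T → Set X} (t : T) (σ : List ℕ) (h : Task ν A t σ) : WithPoint ν A :=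
  ⟨(t, extend σ, ν (lastEntry σ)), h.1.cauchyName, h.2⟩

theorem Task.semi (hν : IsComputableMetricSpace ν) {A : T → Set X}
    (hA : Named nm (openName ν) fun t (_ : Unit) => A t) : Semi nm (Task ν A) :=
  (IsValid.semi hν (by fun_prop)).and (Semi.mem hν (hA.reindex (g := fun _ => ())
    (by fun_prop)) (Named.dense (Comp.of_computable (by fun_prop))))

theorem Named.pull_task (hν : IsComputableMetricSpace ν) {A : T → Set X}
    (hA : Named nm (openName ν) fun t (_ : Unit) => A t) {U : WithPoint ν A → Unit → Set X}
    (hU : Named (withPointName nm A) (openName ν) U) :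
    Named nm (openName ν) fun t σ => {z | ∃ h : Task ν A t σ, z ∈ U (h.point) ()} :=
  hU.pull_open (Task.semi hν hA) (fun t σ h => h.point) (Comp.ilv
    (F := fun _ (y : List ℕ × ℕ) => extend y.1 y.2) (G := fun t y => nm t y.2)
    (Comp.of_computable (by fun_prop)) (Comp.name.reindex (by fun_prop))) fun _ _ _ _ => rfl

/-- Truncate the name of the point beyond the part that is used, at a place where the approximating
dense point already lies in the open set `A`. In this way a countable family of finite words
replaces all names of all points of `A`. -/
theorem Task.exists_of_semi {A : T → Set X} (hA : ∀ t, IsOpen (A t))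
    {P : WithPoint ν A → β → Prop} (hP : Semi (withPointName nm A) P) {s : WithPoint ν A} {b : β}
    (hs : P s b) : ∃ (σ : List ℕ) (h : Task ν A s.1.1 σ), P h.point b := by
  obtain ⟨m, hm⟩ := hP.exists_prefix hs
  have hev : ∀ᶠ k in atTop, ν (s.1.2.1 k) ∈ A s.1.1 :=
    s.2.1.2.eventually ((hA s.1.1).mem_nhds s.2.2)
  obtain ⟨k, hk, hkm⟩ := (hev.and (eventually_ge_atTop m)).exists
  have h : Task ν A s.1.1 (prefixOf s.1.2.1 (k + 1)) :=
    ⟨s.2.1.isValid _, by rwa [lastEntry_prefixOf]⟩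
  refine ⟨_, h, hm _ fun i hi => ?_⟩
  simp only [withPointName, Task.point, ilv]
  rw [extend_prefixOf (by omega)]

/-- Since `z` satisfies finitely many strict inequalities, there is a positive margin `ε`, and any
sufficiently good continuation of the word remains a Cauchy name. -/
theorem IsValid.exists_name (hν : DenseRange ν) {τ : List ℕ} (hτ : IsValid ν τ) {z : X}
    (hz : ∀ i < τ.length, dist z (ν (τ.getD i 0)) < (2 : ℝ)⁻¹ ^ i) :
    ∃ q, TTE.cauchyName ν q z ∧ ∀ i < τ.length, q i = τ.getD i 0 := by
  obtain ⟨ε, hε, hε0⟩ : ∃ ε : ℝ, (∀ i ∈ Finset.range τ.length,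
      dist z (ν (τ.getD i 0)) + ε < (2 : ℝ)⁻¹ ^ i) ∧ 0 < ε := by
    have h1 : ∀ᶠ ε in 𝓝[>] (0 : ℝ), ∀ i ∈ Finset.range τ.length,
        dist z (ν (τ.getD i 0)) + ε < (2 : ℝ)⁻¹ ^ i := by
      refine (Filter.eventually_all_finset _).2 fun i hi => ?_
      have h2 : ∀ᶠ ε in 𝓝 (0 : ℝ), dist z (ν (τ.getD i 0)) + ε < (2 : ℝ)⁻¹ ^ i :=
        (continuous_const.add continuous_id).tendsto _ |>.eventually
          (gt_mem_nhds (by simpa using hz i (Finset.mem_range.1 hi)))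
      exact h2.filter_mono nhdsWithin_le_nhds
    exact (h1.and self_mem_nhdsWithin).exists
  -- The bound `ε` makes new entries compatible with those of `τ`, while `2⁻¹ ^ (j + 1)` makes them
  -- compatible with each other and convergent to `z`.
  have hn : ∀ j : ℕ, ∃ n, dist z (ν n) < min ε ((2 : ℝ)⁻¹ ^ (j + 1)) := fun j =>
    hν.exists_dist_lt z (lt_min hε0 (by positivity))
  choose n hn using hn
  refine ⟨fun j => if j < τ.length then τ.getD j 0 else n j, ?_, fun i hi => if_pos hi⟩
  refine cauchyName_of_lt' (fun j i hij => ?_) ?_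
  · by_cases hi : i < τ.length
    · simp only [if_pos hi]
      by_cases hj : j < τ.length
      · simp only [if_pos hj]
        exact hτ j hj i hij
      · simp only [if_neg hj]
        have h1 := hε i (Finset.mem_range.2 hi)
        have h2 := (hn j).trans_le (min_le_left _ _)
        have := dist_triangle_left (ν (τ.getD i 0)) (ν (n j)) z
        linarith
    · simp only [if_neg hi, if_neg (show ¬ j < τ.length by omega)]
      have h1 := (hn i).trans_le (min_le_right _ _)
      have h2 := (hn j).trans_le (min_le_right _ _)
      have h3 : (2 : ℝ)⁻¹ ^ (j + 1) ≤ 2⁻¹ ^ (i + 1) :=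
        pow_le_pow_of_le_one (by norm_num) (by norm_num) (by omega)
      have := dist_triangle_left (ν (n i)) (ν (n j)) z
      rw [pow_succ _ i] at h1 h3
      linarith
  · rw [tendsto_iff_dist_tendsto_zero]
    refine squeeze_zero' (Eventually.of_forall fun _ => dist_nonneg) ?_
      ((tendsto_pow_atTop_nhds_zero_of_lt_one (by norm_num)
        (by norm_num : (2 : ℝ)⁻¹ < 1)).comp (tendsto_add_atTop_nat 1))
    filter_upwards [eventually_ge_atTop τ.length] with j hj
    simp only [if_neg (show ¬ j < τ.length by omega)]
    rw [dist_comm]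
    exact ((hn j).trans_le (min_le_right _ _)).le

/-- Semidecidable properties of the points of `A t` are traces of open sets. -/
theorem Semi.exists_open (hν : IsComputableMetricSpace ν) {A : T → Set X} {Q : T → X → Prop}
    (hQ : Semi (withPointName (ν := ν) nm A) fun s (_ : Unit) => Q s.1.1 s.1.2.2) :
    ∃ O : T → Unit → Set X, Named nm (openName ν) O ∧ ∀ t, ∀ z ∈ A t, (z ∈ O t () ↔ Q t z) := by
  obtain ⟨D, hD, hDm, hDQ⟩ := hQ
  -- A ball is listed if an accepted word `τ` begins some name of each of its points. The property
  -- concerns the point alone, so acceptance from one name establishes it.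
  let E : T → Unit × ℕ → Prop := fun t y => ∃ τ : List ℕ, IsValid ν τ ∧
    (∀ i < τ.length, dist (ν y.2.unpair.1) (ν (τ.getD i 0)) + ((posRat y.2.unpair.2 : ℚ) : ℝ) <
      (2 : ℝ)⁻¹ ^ i) ∧ D (prefixOf (ilv (fun k => τ.getD k 0) (nm t)) (2 * τ.length), ()) = true
  have hE : Semi nm E := by
    refine Semi.ex (Semi.and (IsValid.semi hν (by fun_prop)) (Semi.and (Semi.allLt ?_
      (by fun_prop)) (Comp.semi (Comp.map hD (Comp.pair ?_ (Comp.of_computable (by fun_prop)))))))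
    · exact (CRe.add ((CRe.dist_dense hν).reindex (g := fun x : ((Unit × ℕ) × List ℕ) × ℕ =>
        (x.1.1.2.unpair.1, x.1.2.getD x.2 0)) (by fun_prop)) (CRe.of_posRat
        (G := fun _ (x : ((Unit × ℕ) × List ℕ) × ℕ) => x.1.1.2.unpair.2)
        (Comp.of_computable (by fun_prop)))).lt (CRe.pow (Comp.of_computable (by fun_prop)))
    · exact (Comp.prefixes (Comp.ilv (F := fun _ (y : List ℕ × ℕ) => y.1.getD y.2 0)
        (G := fun t y => nm t y.2) (Comp.of_computable (by fun_prop))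
        (Comp.name.reindex (by fun_prop)))).reindex
        (g := fun y : (Unit × ℕ) × List ℕ => (y.2, 2 * y.2.length)) (by fun_prop)
  refine ⟨fun t _ => {z | ∃ c, E t ((), c) ∧ z ∈ idealBall ν c}, Named.open_of hE
    (fun t _ c hc z hz => ⟨c, hc, hz⟩) fun t _ z hz => hz, fun t z hzA => ⟨?_, fun hz => ?_⟩⟩
  · rintro ⟨c, ⟨τ, hτ, hc, hDτ⟩, hz⟩
    obtain ⟨q, hq, hqτ⟩ := hτ.exists_name hν.dense (z := z) fun i hi => by
      have h1 := hc i hi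
      have h2 := dist_triangle z (ν c.unpair.1) (ν (τ.getD i 0))
      rw [mem_idealBall] at hz
      simp only at h1
      linarith
    refine (hDQ ⟨(t, q, z), hq, hzA⟩ ()).2 ⟨2 * τ.length, ?_⟩
    rwa [withPointName, prefixOf_ilv hqτ fun _ _ => rfl]
  · have hp : ∀ i : ℕ, ∃ n, dist z (ν n) < (2 : ℝ)⁻¹ ^ (i + 1) := fun i =>
      hν.dense.exists_dist_lt z (by positivity)
    choose q hq using hp
    have hqz : cauchyName ν q z := cauchyName_of_lt fun i => by rw [dist_comm]; exact hq i
    obtain ⟨m, hm⟩ := (hDQ ⟨(t, q, z), hqz, hzA⟩ ()).1 hz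
    -- The name `q` converges at double precision, which leaves `2⁻¹ ^ (i + 1) ≥ 2⁻¹ ^ m` for moving
    -- the centre and for the radius when `i < m`.
    obtain ⟨c, hzc, hc1, hc2⟩ := exists_idealBall hν.dense z
      (show (0 : ℝ) < 2⁻¹ ^ m / 2 by positivity)
    refine ⟨c, ⟨prefixOf q m, hqz.isValid m, fun i hi => ?_, ?_⟩, hzc⟩
    · rw [length_prefixOf] at hi
      rw [getD_prefixOf hi]
      have h1 := dist_triangle_left (ν c.unpair.1) (ν (q i)) z
      have h2 := hq i
      have h3 : (2 : ℝ)⁻¹ ^ m ≤ 2⁻¹ ^ (i + 1) :=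
        pow_le_pow_of_le_one (by norm_num) (by norm_num) (by omega)
      rw [pow_succ _ i] at h2 h3
      simp only
      linarith
    · rw [length_prefixOf, prefixOf_ilv (fun i hi => getD_prefixOf hi) fun _ _ => rfl]
      exact prefix_mono hDm (by omega) hm

end Sets
-- Equivalence of the operations `N`, `M`, `B` and `S`
section Equivalence

variable {X : Type*} [MetricSpace X] {ν : ℕ → X} {T T' : Type*} {α β γ : Type} [Primcodable α]
  [Primcodable β] [Primcodable γ] {nm : T → Baire} {nm' : T' → Baire}
  {𝒴 : Set (Set X)} {δ : Naming (Set X)}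

/-- The name of a situation extended by a natural number. -/
def withNatName (nm : T → Baire) : T × ℕ → Baire := fun s => ilv (fun _ => s.2) (nm s.1)

theorem comp_withNat_base : Comp (withNatName nm) fun s k => nm s.1 k :=
  Comp.right_name (q := fun s : T × ℕ => fun _ => s.2) fun _ => rfl

theorem comp_withNat_nat : Comp (withNatName nm) fun s (_ : α) => s.2 :=
  (Comp.left_name (base := Prod.fst) (q := fun s : T × ℕ => fun _ => s.2) fun _ => rfl).reindex
    (g := fun _ => 0) (by fun_prop)

/-- An index can thus be made part of the situation, as constructions with a set depending only on
the situation require, and afterwards be turned back into a parameter. -/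
theorem Semi.uncurry {P : T × ℕ → α → Prop} (hP : Semi (withNatName nm) P) :
    Semi nm fun t (x : ℕ × α) => P (t, x.1) x.2 :=
  (Semi.pull hP (Semi.const_true (α := ℕ)) (fun t i _ => (t, i)) (Comp.ilv
    (F := fun _ (y : ℕ × ℕ) => y.1) (G := fun t y => nm t y.2)
    (Comp.of_computable (by fun_prop)) (Comp.name.reindex (by fun_prop)))
    fun _ _ _ _ => rfl).congr fun t x => by simp

theorem Comp.uncurry {F : T × ℕ → α → β} (hF : Comp (withNatName nm) F) :
    Comp nm fun t (x : ℕ × α) => F (t, x.1) x.2 :=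
  (Semi.uncurry hF).reindex (g := fun x : (ℕ × α) × β => (x.1.1, (x.1.2, x.2))) (by fun_prop)

theorem Named.uncurry {B : Type*} {δ : Naming B} {y : T × ℕ → α → B}
    (hy : Named (withNatName nm) δ y) : Named nm δ fun t (x : ℕ × α) => y (t, x.1) x.2 := by
  obtain ⟨F, hF, hFy⟩ := hy
  exact ⟨_, hF.uncurry.reindex (g := fun x : (ℕ × α) × ℕ => (x.1.1, (x.1.2, x.2)))
    (by fun_prop), fun t x => hFy (t, x.1) x.2⟩

theorem Named.compl {A : T → α → Set X} (h : Named nm (closedName ν) A) :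
    Named nm (openName ν) fun t a => (A t a)ᶜ := h

theorem Named.of_compl {A : T → α → Set X} (h : Named nm (openName ν) fun t a => (A t a)ᶜ) :
    Named nm (closedName ν) A := h

theorem Task.exists_mem {A : T → Set X} (hA : ∀ t, IsOpen (A t)) {U : WithPoint ν A → Unit → Set X}
    (hU : Named (withPointName nm A) (openName ν) U) {s : WithPoint ν A} {z : X}
    (hz : z ∈ U s ()) : ∃ (σ : List ℕ) (h : Task ν A s.1.1 σ), z ∈ U h.point () := by
  obtain ⟨E, hE, hEU⟩ := hU.exists_semi
  obtain ⟨c, hc, hzc⟩ := (hEU _ _ _).1 hz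
  obtain ⟨σ, h, hσ⟩ := Task.exists_of_semi hA hE hc
  exact ⟨σ, h, (hEU _ _ _).2 ⟨c, hσ, hzc⟩⟩

/-- S applied to the cover `Bᶜ, Aᶜ` of `Y` gives disjoint `W₀ ⊆ Bᶜ` and `W₁ ⊆ Aᶜ` covering `Y`. To
include the parts of `A` and `B` outside `Y`, pass to `(W₀ ∪ Yᶜ) ∩ Bᶜ` and `(W₁ ∪ Yᶜ) ∩ Aᶜ`, open by
the negative information on `Y`. Their overlap misses `A`, `B` and `Y`, so disjointification loses
none of these points. -/
theorem NComputable.of_SComputable (hν : IsComputableMetricSpace ν)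
    (hneg : Reducible δ (closedName ν)) (hS : SComputable ν 𝒴 δ) : NComputable ν 𝒴 δ := by
  refine Operation.isComputable_of_named (f := opN 𝒴) ?_
  have hin := Operation.Input.named (opN 𝒴)
    (prodName (closedName ν) (prodName (closedName ν) δ))
  have hA := hin.fst.compl
  have hB := hin.snd.fst.compl
  have hY := hin.snd.snd
  have hYc := (hY.reduce hneg).compl
  generalize hnm : (fun t : (opN 𝒴).Input
    (prodName (closedName ν) (prodName (closedName ν) δ)) => t.1.1) = nm at *
  have hU : Named nm (openName ν) fun t (y : Unit × ℕ) =>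
      {z | y.2 = 0 ∧ z ∈ t.1.2.2.1ᶜ} ∪ {z | y.2 = 1 ∧ z ∈ t.1.2.1ᶜ} :=
    (Named.sep (Comp.semi_eq (Comp.of_computable (by fun_prop))
      (Comp.of_computable (by fun_prop))) (hB.reindex (Computable.const ()))).union
    (Named.sep (Comp.semi_eq (Comp.of_computable (by fun_prop))
      (Comp.of_computable (by fun_prop))) (hA.reindex (Computable.const ())))
  obtain ⟨W, hW, hWval⟩ := Operation.IsComputable.apply (f := opS 𝒴) hS
    ((Named.seq (y := fun t (_ : Unit) i => {z | i = 0 ∧ z ∈ t.1.2.2.1ᶜ} ∪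
      {z | i = 1 ∧ z ∈ t.1.2.1ᶜ}) hU).prod hY) (fun t _ => by
      refine ⟨fun i => hU.isOpen t ((), i), t.2.1.2.2.1, fun y _ => ?_⟩
      by_cases hy : y ∈ t.1.2.1
      · exact mem_iUnion.2 ⟨0, Or.inl ⟨rfl, Set.disjoint_left.1 t.2.1.2.2.2 hy⟩⟩
      · exact mem_iUnion.2 ⟨1, Or.inr ⟨rfl, hy⟩⟩)
  have hW' := hW.seq_apply
  obtain ⟨U', V', hU', hV', hd⟩ := Named.exists_disjoint hν (nm := nm) (α := Unit)
    (U := fun t _ => (W t () 0 ∪ t.1.2.2.2ᶜ) ∩ t.1.2.2.1ᶜ)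
    (V := fun t _ => (W t () 1 ∪ t.1.2.2.2ᶜ) ∩ t.1.2.1ᶜ)
    (Named.inter hν (Named.union (hW'.reindex (g := fun _ => ((), 0)) (by fun_prop)) hYc) hB)
    (Named.inter hν (Named.union (hW'.reindex (g := fun _ => ((), 1)) (by fun_prop)) hYc) hA)
  refine ⟨fun t u => (U' t u, V' t u), hU'.prod hV', fun t => ?_⟩
  obtain ⟨hdis, hUs, hVs, hU1, hV1⟩ := hd t ()
  obtain ⟨hWs, hWc, hWd⟩ := hWval t ()
  have hW0 : W t () 0 ⊆ t.1.2.2.1ᶜ := fun z hz => by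
    rcases (hWs 0).2 hz with h | h
    exacts [h.2, absurd h.1 zero_ne_one]
  have hW1 : W t () 1 ⊆ t.1.2.1ᶜ := fun z hz => by
    rcases (hWs 1).2 hz with h | h
    exacts [absurd h.1 one_ne_zero, h.2]
  have hcov : ∀ z ∈ t.1.2.2.2, z ∈ W t () 0 ∨ z ∈ W t () 1 := fun z hz => by
    obtain ⟨i, hi⟩ := mem_iUnion.1 (hWc hz)
    rcases (hWs i).2 hi with h | h
    · exact Or.inl (h.1 ▸ hi)
    · exact Or.inr (h.1 ▸ hi)
  have hAB := Set.disjoint_left.1 t.2.1.2.2.2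
  refine ⟨hU'.isOpen t (), hV'.isOpen t (), fun z hz => hU1 ⟨⟨?_, hAB hz⟩, fun h => h.2 hz⟩,
    fun z hz => hV1 ⟨⟨?_, fun h => hAB h hz⟩, fun h => h.2 hz⟩, fun z hz => ?_, hdis⟩
  · by_cases hzY : z ∈ t.1.2.2.2
    · exact Or.inl ((hcov z hzY).resolve_right fun h => hW1 h hz)
    · exact Or.inr hzY
  · by_cases hzY : z ∈ t.1.2.2.2
    · exact Or.inl ((hcov z hzY).resolve_left fun h => hW0 h hz)
    · exact Or.inr hzY
  · have hdW := Set.disjoint_left.1 (hWd zero_ne_one)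
    rcases hcov z hz with h | h
    · exact Or.inl (hU1 ⟨⟨Or.inl h, hW0 h⟩, fun h' => h'.1.elim (hdW h) fun h' => h' hz⟩)
    · exact Or.inr (hV1 ⟨⟨Or.inl h, hW1 h⟩, fun h' => h'.1.elim (fun h' => hdW h' h)
        fun h' => h' hz⟩)

/-- Separate the closed sets `{x}` and `Uᶜ`. The first separating set lies in `U` because it is
disjoint from the second, which contains `Uᶜ`. -/
theorem MComputable.of_NComputable (hν : IsComputableMetricSpace ν)
    (hN : NComputable ν 𝒴 δ) : MComputable ν 𝒴 δ := by
  refine Operation.isComputable_of_named (f := opM 𝒴) ?_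
  have hin := Operation.Input.named (opM 𝒴) (prodName (cauchyName ν) (prodName (openName ν) δ))
  have hx := hin.fst
  have hU := hin.snd.fst
  have hY := hin.snd.snd
  obtain ⟨o, ho, hval⟩ := Operation.IsComputable.apply (f := opN 𝒴) hN
    (y := fun t (_ : Unit) => ({t.1.2.1}, t.1.2.2.1ᶜ, t.1.2.2.2))
    ((Named.of_compl ((Named.far hν hx CRe.zero).congr fun t _ => by
      ext z
      rw [mem_compl_iff, mem_singleton_iff, mem_ofPred_eq, dist_pos, ne_comm])).prod
      ((Named.of_compl (hU.congr fun t _ => compl_compl _)).prod hY))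
    (fun t _ => ⟨isClosed_singleton, (hU.isOpen t ()).isClosed_compl, t.2.1.2.1,
      Set.disjoint_singleton_left.2 fun h => h t.2.1.2.2⟩)
  refine ⟨o, ho, fun t => ?_⟩
  obtain ⟨h1, h2, h3, h4, h5, h6⟩ := hval t ()
  exact ⟨h1, h2, h3 rfl, fun z hz => by_contra fun h => Set.disjoint_left.1 h6 hz (h4 h), h5, h6⟩

/-- Run M on the canonical points of all tasks `(i, σ)` in `U i`. The resulting pairs have `V ⊆ U
i`, and finite use shows that the sets `V` cover `Y`: the output at any `y ∈ Y ∩ U i` that contains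
`y` is matched, as far as `y` is concerned, by the output for some finite word. The countable
reduction then applies. -/
theorem SComputable.of_MComputable (hν : IsComputableMetricSpace ν)
    (hM : MComputable ν 𝒴 δ) : SComputable ν 𝒴 δ := by
  refine Operation.isComputable_of_named (f := opS 𝒴) ?_
  have hin := Operation.Input.named (opS 𝒴) (prodName (seqName (openName ν)) δ)
  have hU := hin.fst.seq_apply
  have hY := hin.snd
  generalize hnm : (fun t : (opS 𝒴).Input (prodName (seqName (openName ν)) δ) => t.1.1) = nm at *
  let A : (opS 𝒴).Input (prodName (seqName (openName ν)) δ) × ℕ → Set X := fun s => s.1.1.2.1 s.2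
  have hA : Named (withNatName nm) (openName ν) fun s (_ : Unit) => A s :=
    (hU.pullback comp_withNat_base).subst (G := fun s _ => ((), s.2))
      ((Comp.of_computable (Computable.const ())).pair comp_withNat_nat)
  have hbase := WithPoint.comp_base (ν := ν) (nm := withNatName nm) A
  obtain ⟨o, ho, hval⟩ := Operation.IsComputable.apply (f := opM 𝒴) hM
    ((WithPoint.named A).prod ((hA.pullback hbase).prod
      ((hY.pullback comp_withNat_base).pullback hbase)))
    (fun s _ => ⟨hA.isOpen s.1.1 (), s.1.1.1.2.1.2.1, s.2.2⟩)
  refine Exists.elim (Named.exists_reduction hν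
    (U := fun t => t.1.2.1) (Y := fun t => t.1.2.2) (Task.semi hν hA).uncurry
    (ι := fun y => y.1) (by fun_prop) (Named.pull_task hν hA ho.fst).uncurry
    (Named.pull_task hν hA ho.snd).uncurry (fun t y hy => ?_) (fun t y hy => ?_)) ?_
  rotate_left 2
  · rintro P ⟨hP, hPval⟩
    refine ⟨P, hP.seq, fun t => ⟨fun i => ⟨hP.isOpen t ((), i), (hPval t).1 i⟩,
      (hPval t).2.1, (hPval t).2.2⟩⟩
  · obtain ⟨-, -, -, h4, h5, h6⟩ := hval hy.point ()
    refine ⟨Set.disjoint_left.2 ?_, fun z hz => ?_, ?_⟩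
    · rintro z ⟨_, h⟩ ⟨_, h'⟩
      exact Set.disjoint_left.1 h6 h h'
    · exact (h5 hz).imp (fun h => ⟨hy, h⟩) fun h => ⟨hy, h⟩
    · rintro z ⟨_, h⟩
      exact h4 h
  · obtain ⟨i, hi⟩ := mem_iUnion.1 (t.2.1.2.2 hy)
    obtain ⟨q, hq⟩ := exists_cauchyName hν.dense y
    obtain ⟨σ, h, hσ⟩ := Task.exists_mem (fun s => hA.isOpen s ()) ho.fst
      (s := ⟨((t, i), q, y), hq, hi⟩) (hval _ ()).2.2.1
    exact ⟨(i, σ), h, h, hσ⟩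

/-- Use basic sets `U i` certified by `R` to lie, within `Y`, in an ideal ball listed for a member
of the cover. Intersecting with that ball makes the inclusion hold outside `Y` too, without changing
the trace on `Y`, so the pair still covers `Y`. -/
theorem SComputable.of_BComputable (hν : IsComputableMetricSpace ν)
    (hB : BComputable ν 𝒴 δ) : SComputable ν 𝒴 δ := by
  refine Operation.isComputable_of_named (f := opS 𝒴) ?_
  have hin := Operation.Input.named (opS 𝒴) (prodName (seqName (openName ν)) δ)
  have hU := hin.fst.seq_apply
  have hY := hin.snd
  generalize hnm : (fun t : (opS 𝒴).Input (prodName (seqName (openName ν)) δ) => t.1.1) = nm at *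
  obtain ⟨o, ho, hval⟩ := Operation.IsComputable.apply (f := opB ν 𝒴) hB hY
    (fun t _ => t.2.1.2.1)
  obtain ⟨E, hE, hEU⟩ := hU.exists_semi
  obtain ⟨F, hF, hFR⟩ := ho.snd.snd
  have hR : Semi nm fun t (y : ℕ × ℕ) => y ∈ (o t ()).2.2 := by
    refine (Semi.ex (P := fun t (y : ℕ × ℕ) i => F t ((), i) = Nat.pair y.1 y.2 + 1)
      (Comp.semi_eq (hF.reindex (by fun_prop)) (Comp.of_computable (by fun_prop)))).congr
      fun t y => ?_
    rw [show (o t ()).2.2 = _ from hFR t ()]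
    rfl
  refine Exists.elim (Named.exists_reduction hν
    (U := fun t => t.1.2.1) (Y := fun t => t.1.2.2)
    (Good := fun t (y : (ℕ × ℕ) × ℕ) => y.1 ∈ (o t ()).2.2 ∧ E t (((), y.2), y.1.2))
    ((hR.reindex (by fun_prop)).and (hE.reindex (by fun_prop)))
    (ι := fun y => y.2) (by fun_prop)
    (V := fun t y => (o t ()).1 y.1.1 ∩ Metric.ball (ν y.1.2.unpair.1)
      ((posRat y.1.2.unpair.2 : ℚ) : ℝ)) (W := fun t y => (o t ()).2.1 y.1.1)
    (Named.inter hν (ho.fst.seq_apply.reindex (g := fun y : (ℕ × ℕ) × ℕ => ((), y.1.1))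
      (by fun_prop)) (Named.ball hν (Named.dense (Comp.of_computable (by fun_prop)))
      (CRe.of_posRat (Comp.of_computable (by fun_prop)))))
    (ho.snd.fst.seq_apply.reindex (g := fun y : (ℕ × ℕ) × ℕ => ((), y.1.1)) (by fun_prop))
    (fun t y hy => ?_) (fun t y hy => ?_)) ?_
  rotate_left 2
  · rintro P ⟨hP, hPval⟩
    refine ⟨P, hP.seq, fun t => ⟨fun i => ⟨hP.isOpen t ((), i), (hPval t).1 i⟩,
      (hPval t).2.1, (hPval t).2.2⟩⟩
  · obtain ⟨h1, h2, -⟩ := hval t ()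
    refine ⟨(h1 y.1.1).2.2.2.mono_left inter_subset_left, fun z hz => ?_, fun z hz =>
      (hEU t ((), y.2) z).2 ⟨y.1.2, hy.2, hz.2⟩⟩
    exact ((h1 y.1.1).2.2.1 hz).imp_left fun h => ⟨h, (h2 _ _ hy.1 ⟨h, hz⟩).1⟩
  · obtain ⟨-, -, h3⟩ := hval t ()
    obtain ⟨j, hj⟩ := mem_iUnion.1 (t.2.1.2.2 hy)
    obtain ⟨a, ha, hya⟩ := (hEU t ((), j) y).1 hj
    obtain ⟨i, hi, hyi⟩ := h3 a y ⟨hya, hy⟩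
    exact ⟨((i, a), j), ⟨hi, ha⟩, hyi.1, hya⟩

/-- For every `k`, S cuts `Y` into pieces contained in balls of radius `2⁻ᵏ` around the dense
points, and the other pieces of the same level form the complement within `Y`. Small pieces form a
basis, and formal inclusion of the ambient balls serves as the refined inclusion `R`. -/
theorem BComputable.of_SComputable (hν : IsComputableMetricSpace ν)
    (hS : SComputable ν 𝒴 δ) : BComputable ν 𝒴 δ := by
  refine Operation.isComputable_of_named (f := opB ν 𝒴) ?_
  have hY := Operation.Input.named (opB ν 𝒴) δ
  generalize hnm : (fun t : (opB ν 𝒴).Input δ => t.1.1) = nm at *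
  have hU : Named nm (openName ν) fun _ (y : (Unit × ℕ) × ℕ) =>
      Metric.ball (ν y.2) ((2 : ℝ)⁻¹ ^ y.1.2) :=
    Named.ball hν (Named.dense (Comp.of_computable (by fun_prop)))
      (CRe.pow (Comp.of_computable (by fun_prop)))
  obtain ⟨W, hW, hWval⟩ := Operation.IsComputable.apply (f := opS 𝒴) hS
    ((Named.seq (y := fun _ (y : Unit × ℕ) i => Metric.ball (ν i) ((2 : ℝ)⁻¹ ^ y.2)) hU).prod
      (hY.reindex (g := fun _ : Unit × ℕ => ()) (by fun_prop)))
    (fun t y => ⟨fun i => Metric.isOpen_ball, t.2.1, fun z _ => by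
      obtain ⟨n, hn⟩ := hν.dense.exists_dist_lt z (show (0 : ℝ) < 2⁻¹ ^ y.2 by positivity)
      exact mem_iUnion.2 ⟨n, hn⟩⟩)
  have hW' := hW.seq_apply
  let R : Set (ℕ × ℕ) := {y | dist (ν y.1.unpair.2) (ν y.2.unpair.1) + (2 : ℝ)⁻¹ ^ y.1.unpair.1 <
    ((posRat y.2.unpair.2 : ℚ) : ℝ)}
  have hR : Semi nm fun _ (y : Unit × ℕ) => y.2.unpair ∈ R :=
    (CRe.add ((CRe.dist_dense hν).reindex (g := fun y : Unit × ℕ =>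
      (y.2.unpair.1.unpair.2, y.2.unpair.2.unpair.1)) (by fun_prop))
      (CRe.pow (G := fun _ (y : Unit × ℕ) => y.2.unpair.1.unpair.1)
        (Comp.of_computable (by fun_prop)))).lt
      (CRe.of_posRat (G := fun _ (y : Unit × ℕ) => y.2.unpair.2.unpair.2)
        (Comp.of_computable (by fun_prop)))
  obtain ⟨F, hF, hFR⟩ := hR.enumerate
  have hRn : Named nm enumName fun _ (_ : Unit) => R := by
    refine ⟨F, hF, fun t a => ?_⟩
    ext y
    have h := hFR t a (Nat.pair y.1 y.2)
    rwa [Nat.unpair_pair] at h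
  refine ⟨fun t _ => (fun n => W t ((), n.unpair.1) n.unpair.2,
    fun n => {z | ∃ j, j ≠ n.unpair.2 ∧ z ∈ W t ((), n.unpair.1) j}, R),
    (Named.seq ?_).prod ((Named.seq ?_).prod hRn), fun t => ⟨fun n => ?_, ?_, ?_⟩⟩
  · exact hW'.reindex (g := fun y : Unit × ℕ => (((), y.2.unpair.1), y.2.unpair.2))
      (by fun_prop)
  · exact Named.biUnion (P := fun _ (y : Unit × ℕ) j => j ≠ y.2.unpair.2)
      (U := fun t y j => W t ((), y.2.unpair.1) j)
      (Comp.semi_ne (Comp.of_computable (by fun_prop)) (Comp.of_computable (by fun_prop)))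
      (hW'.reindex (g := fun y : (Unit × ℕ) × ℕ => (((), y.1.2.unpair.1), y.2)) (by fun_prop))
  · obtain ⟨h1, h2, h3⟩ := hWval t ((), n.unpair.1)
    refine ⟨(h1 _).1, ?_, fun z hz => ?_, Set.disjoint_left.2 ?_⟩
    · have : {z | ∃ j, j ≠ n.unpair.2 ∧ z ∈ W t ((), n.unpair.1) j} =
          ⋃ j ∈ {j | j ≠ n.unpair.2}, W t ((), n.unpair.1) j := by
        ext z
        simp
      simp only [this]
      exact isOpen_biUnion fun j _ => (h1 j).1
    · obtain ⟨j, hj⟩ := mem_iUnion.1 (h2 hz)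
      by_cases h : j = n.unpair.2
      · exact Or.inl (by subst h; exact hj)
      · exact Or.inr ⟨j, h, hj⟩
    · rintro z hz ⟨j, hj, hz'⟩
      exact Set.disjoint_left.1 (h3 hj) hz' hz
  · rintro n a hna z ⟨hz, hzY⟩
    refine ⟨?_, hzY⟩
    have h1 := ((hWval t ((), n.unpair.1)).1 n.unpair.2).2 hz
    have h2 : dist (ν n.unpair.2) (ν a.unpair.1) + (2 : ℝ)⁻¹ ^ n.unpair.1 <
      ((posRat a.unpair.2 : ℚ) : ℝ) := hna
    rw [Metric.mem_ball] at h1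
    rw [mem_idealBall]
    have := dist_triangle z (ν n.unpair.2) (ν a.unpair.1)
    simp only at h1
    linarith
  · rintro a z ⟨hza, hzY⟩
    rw [mem_idealBall] at hza
    obtain ⟨k, hk⟩ := exists_pow_lt (show 0 < (((posRat a.unpair.2 : ℚ) : ℝ) -
      dist z (ν a.unpair.1)) / 2 by linarith)
    obtain ⟨h1, h2, -⟩ := hWval t ((), k)
    obtain ⟨i, hi⟩ := mem_iUnion.1 (h2 hzY)
    have h4 := (h1 i).2 hi
    rw [Metric.mem_ball] at h4
    refine ⟨Nat.pair k i, ?_, ?_, hzY⟩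
    · have := dist_triangle_left (ν i) (ν a.unpair.1) z
      simp only [R, mem_ofPred_eq, Nat.unpair_pair]
      simp only at h4
      linarith
    · simpa only [Nat.unpair_pair] using hi

end Equivalence
section Retraction

variable {X : Type*} [MetricSpace X] {ν : ℕ → X} {T T' : Type*} {α β γ : Type} [Primcodable α]
  [Primcodable β] [Primcodable γ] {nm : T → Baire} {nm' : T' → Baire}
  {𝒴 : Set (Set X)} {δ : Naming (Set X)}

/-! ### Closed sets with positive information -/

theorem lt_dist_of_lt_infEDist {r : ℝ} {x y : X} {B : Set X} (hy : y ∈ B)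
    (h : (r : EReal) < (Metric.infEDist x B : EReal)) : r < dist x y := by
  have h1 : (Metric.infEDist x B : EReal) ≤ (edist x y : EReal) :=
    EReal.coe_ennreal_le_coe_ennreal_iff.2 (Metric.infEDist_le_edist_of_mem hy)
  rw [edist_dist, EReal.coe_ennreal_ofReal, max_eq_left dist_nonneg] at h1
  exact EReal.coe_lt_coe_iff.1 (h.trans_le h1)

theorem lt_infEDist_of_le {r s : ℝ} {x : X} {B : Set X} (hrs : r < s)
    (h : ∀ y ∈ B, s ≤ dist x y) : (r : EReal) < (Metric.infEDist x B : EReal) := by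
  have h1 : ENNReal.ofReal s ≤ Metric.infEDist x B := Metric.le_infEDist.2 fun y hy => by
    rw [edist_dist]
    exact ENNReal.ofReal_le_ofReal (h y hy)
  have h2 := EReal.coe_ennreal_le_coe_ennreal_iff.2 h1
  rw [EReal.coe_ennreal_ofReal] at h2
  exact (EReal.coe_lt_coe_iff.2 (hrs.trans_le (le_max_left s 0))).trans_le h2

theorem Named.exists_dense_seq {B : T → α → Set X} (h : Named nm (rangeName ν) B)
    (hne : ∀ t a, (B t a).Nonempty) :
    ∃ b : T → α × ℕ → X, Named nm (cauchyName ν) b ∧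
      ∀ t a, (∀ i, b t (a, i) ∈ B t a) ∧ B t a ⊆ closure (range fun i => b t (a, i)) := by
  obtain ⟨F, hF, hFB⟩ := h
  have h' : ∀ t a, ∃ y : ℕ → X, (∀ i, cauchyName ν
      (fun k => component (fun k => F t (a, k)) i k - 1) (y i)) ∧
      (∀ i, y i ∈ B t a) ∧ B t a ⊆ closure (range y) := fun t a => by
    rcases (hFB t a).2 with h | h
    · exact absurd h.1 (hne t a).ne_empty
    · exact h.2.2
  choose y hy using h'
  exact ⟨fun t z => y t z.1 z.2, ⟨fun t z => F t (z.1.1, Nat.pair z.1.2 z.2) - 1,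
    Comp.map (g := fun n => n - 1) (by fun_prop) (hF.reindex
      (g := fun z : (α × ℕ) × ℕ => (z.1.1, Nat.pair z.1.2 z.2)) (by fun_prop)),
    fun t a => (hy t a.1).1 a.2⟩, fun t a => (hy t a).2⟩

/-- An ideal ball whose radius is below the distance of its centre from `B` misses `B`, and this is
recognized by evaluating the distance name at constant names of dense points. Sufficiently small
balls around points outside the closed set `B` pass the test. -/
theorem Named.compl_of_dist (hν : IsComputableMetricSpace ν) {B : T → α → Set X}
    (h : Named nm (distName ν) B) : Named nm (openName ν) fun t a => (B t a)ᶜ := by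
  obtain ⟨F, hF, hFB⟩ := h
  choose R hR hRB using fun t (y : α × ℕ) =>
    (hFB t y.1).2 (fun _ => y.2.unpair.1) _ (cauchyName_const (ν := ν) y.2.unpair.1)
  have hRc : Comp nm fun t (z : (α × ℕ) × ℕ) => R t z.1 z.2 :=
    Comp.eta (A := fun t (z : (α × ℕ) × ℕ) => F t (z.1.1, z.2))
      (Q := fun _ (z : (α × ℕ) × ℕ) => z.1.2.unpair.1)
      (hF.reindex (by fun_prop)) (Comp.of_computable (by fun_prop)) hR
  have hiff : ∀ t y, (∃ i, R t y i = ratPos y.2.unpair.2 + 1) ↔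
      ((((posRat y.2.unpair.2 : ℚ) : ℝ)) : EReal) <
        (Metric.infEDist (ν y.2.unpair.1) (B t y.1) : EReal) := fun t y => by
    have h1 := Set.ext_iff.1 (hRB t y) (ratPos y.2.unpair.2)
    rw [mem_ofPred_eq, mem_ofPred_eq, rat_ratPos] at h1
    exact h1.symm
  refine Named.open_of (E := fun t y => ∃ i, R t y i = ratPos y.2.unpair.2 + 1)
    (Semi.ex (Comp.semi_eq hRc (Comp.of_computable (by fun_prop)))) (fun t a c hc z hz hzB => ?_)
    fun t a z hz => ?_
  · have := lt_dist_of_lt_infEDist hzB ((hiff t (a, c)).1 hc)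
    rw [mem_idealBall, dist_comm] at hz
    exact lt_asymm this hz
  · obtain ⟨ε, hε, hball⟩ := Metric.isOpen_iff.1 (hFB t a).1.isOpen_compl z hz
    obtain ⟨c, h1, h2, h3⟩ := exists_idealBall hν.dense z (half_pos hε)
    refine ⟨c, (hiff t (a, c)).2 (lt_infEDist_of_le h3 fun y hy => ?_), h1⟩
    have h4 : ε ≤ dist y z := not_lt.1 fun h => hball h hy
    have := dist_triangle_right y z (ν c.unpair.1)
    rw [dist_comm y (ν c.unpair.1)] at this
    linarith

/-- Taking entry `i + 3` of the approximation number `i + 3` gives an error of at most `3 * 2⁻¹ ^ (i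
+ 3)`, which is less than `2⁻¹ ^ (i + 1)`. -/
theorem Named.limit {y : T → α → ℕ → X} {l : T → α → X}
    (hy : Named nm (cauchyName ν) fun t (z : α × ℕ) => y t z.1 z.2)
    (h : ∀ t a k, dist (y t a k) (l t a) ≤ 2 * (2 : ℝ)⁻¹ ^ k) : Named nm (cauchyName ν) l := by
  obtain ⟨F, hF, hFy⟩ := hy
  refine ⟨fun t z => F t ((z.1, z.2 + 3), z.2 + 3), hF.reindex (by fun_prop), fun t a =>
    cauchyName_of_lt fun i => ?_⟩
  have h1 := (hFy t (a, i + 3)).dist_le (i + 3)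
  have h2 := h t a (i + 3)
  have h3 := dist_triangle (ν (F t ((a, i + 3), i + 3))) (y t a (i + 3)) (l t a)
  have h4 : (2 : ℝ)⁻¹ ^ (i + 3) = 2⁻¹ ^ (i + 1) / 4 := by
    rw [show i + 3 = i + 1 + 2 by omega, pow_add _ (i + 1) 2]
    norm_num
    ring
  have h5 : (0 : ℝ) < 2⁻¹ ^ (i + 1) := by positivity
  simp only at h1
  linarith

theorem Named.pair_range {x y : T → Unit → X} (hx : Named nm (cauchyName ν) x)
    (hy : Named nm (cauchyName ν) y) :
    Named nm (rangeName ν) fun t a => {x t a, y t a} := by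
  obtain ⟨F, hF, hFx⟩ := hx
  obtain ⟨G, hG, hGy⟩ := hy
  refine ⟨fun t z => (bif z.2.unpair.1 = 0 then F t (z.1, z.2.unpair.2) else
    G t (z.1, z.2.unpair.2)) + 1, ?_, fun t a => ⟨(Set.toFinite _).isClosed, Or.inr
    ⟨(insert_nonempty _ _).ne_empty, fun i => Nat.succ_le_succ (Nat.zero_le _),
      fun i => if i = 0 then x t a else y t a, fun i => ?_, fun i => ?_, ?_⟩⟩⟩
  · exact Comp.map (g := fun n => n + 1) (by fun_prop) (Comp.cond
      (c := fun _ (z : Unit × ℕ) => decide (z.2.unpair.1 = 0)) (Comp.of_computable (by fun_prop))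
      (hF.reindex (g := fun z : Unit × ℕ => (z.1, z.2.unpair.2)) (by fun_prop))
      (hG.reindex (g := fun z : Unit × ℕ => (z.1, z.2.unpair.2)) (by fun_prop)))
  · by_cases hi : i = 0
    · simpa [component, hi] using hFx t a
    · simpa [component, hi] using hGy t a
  · by_cases hi : i = 0 <;> simp [hi]
  · refine subset_closure.trans' ?_
    rintro z (rfl | rfl)
    · exact ⟨0, by simp⟩
    · exact ⟨1, by simp⟩

/-- The distance from a pair is a minimum, so a rational lies below it exactly if it lies below both
distances; currying this enumeration over the name of the variable point gives the required
`η`-name. -/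
theorem Named.pair_dist (hν : IsComputableMetricSpace ν) {x y : T → Unit → X}
    (hx : Named nm (cauchyName ν) x) (hy : Named nm (cauchyName ν) y) :
    Named nm (distName ν) fun t a => {x t a, y t a} := by
  let A : T → Set X := fun _ => univ
  have hb := WithPoint.comp_base (ν := ν) (nm := nm) A
  have hp := WithPoint.named (ν := ν) (nm := nm) A
  have hr : CRe (withPointName (ν := ν) nm A) fun _ (z : Unit × ℕ) => ((rat z.2 : ℚ) : ℝ) :=
    CRe.of_rat (Comp.of_computable (by fun_prop))
  have h1 := (CRe.dist hν hp (hx.pullback hb)).reindex (g := fun _ : Unit × ℕ => ())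
    (Computable.const ())
  have h2 := (CRe.dist hν hp (hy.pullback hb)).reindex (g := fun _ : Unit × ℕ => ())
    (Computable.const ())
  have hS := (hr.lt h1).and (hr.lt h2)
  obtain ⟨G, hG, hGS⟩ := hS.enumerate
  obtain ⟨F, hF, hFG⟩ := Comp.curry (base := fun s : WithPoint ν A => s.1.1)
    (q := fun s => s.1.2.1) (fun _ => rfl) (G := fun s k => G s ((), k))
    (hG.reindex (g := fun k => ((), k)) (by fun_prop))
  refine ⟨F, hF, fun t a => ⟨(Set.toFinite _).isClosed, fun q z hq =>
    ⟨_, hFG ⟨(t, q, z), hq, mem_univ z⟩, ?_⟩⟩⟩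
  ext n
  refine Iff.trans ?_ (hGS ⟨(t, q, z), hq, mem_univ z⟩ () n)
  constructor
  · intro h
    have h' : (((rat n : ℚ) : ℝ) : EReal) <
      (Metric.infEDist z ({x t (), y t ()} : Set X) : EReal) := h
    exact ⟨lt_dist_of_lt_infEDist (B := {x t (), y t ()}) (by simp) h',
      lt_dist_of_lt_infEDist (B := {x t (), y t ()}) (by simp) h'⟩
  · rintro ⟨h1, h2⟩
    refine lt_infEDist_of_le (lt_min h1 h2) ?_
    rintro w (rfl | rfl)
    exacts [min_le_left _ _, min_le_right _ _]

theorem Named.ofFun {B C : Type*} {δ : Naming B} {δ' : Naming C} {s : Set B} {f : B → C}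
    (hf : (Operation.ofFun s f).IsComputable δ δ') {y : T → α → B} (hy : Named nm δ y)
    (hs : ∀ t a, y t a ∈ s) : Named nm δ' fun t a => f (y t a) := by
  obtain ⟨z, hz, hzf⟩ := hf.apply hy hs
  exact hz.congr fun t a => (hzf t a).symm

/-! ### Partial maps -/

theorem Named.map_apply {f : T → Unit → X →. X} (hf : Named nm (partialMapName ν) f)
    {A : T → Set X} {v : T → X → X} (hv : ∀ t, ∀ z ∈ A t, v t z ∈ f t () z) :
    Named (withPointName (ν := ν) nm A) (cauchyName ν) fun s (_ : Unit) => v s.1.1 s.1.2.2 := by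
  obtain ⟨F, hF, hFf⟩ := hf
  choose R hR hRv using fun (s : WithPoint ν A) (_ : Unit) =>
    (hFf s.1.1 ()).1 s.1.2.1 s.1.2.2 s.2.1 _ (hv s.1.1 _ s.2.2)
  refine ⟨fun s z => R s z.1 z.2, Comp.eta (A := fun (s : WithPoint ν A) (z : Unit × ℕ) =>
    left (fun k => F s.1.1 ((), k)) z.2) (Q := fun (s : WithPoint ν A) z => s.1.2.1 z.2)
    (hF.left.pullback (WithPoint.comp_base A)) ((WithPoint.comp_point A).reindex (by fun_prop))
    hR, hRv⟩

/-- The value `v t x` does not depend on the name of `x`, so an algorithm working from a name of the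
point, once curried, realizes a map. -/
theorem Named.of_map {A : T → Unit → Set X} (hA : Named nm (closedName ν) A) {v : T → X → X}
    (hv : Named (withPointName (ν := ν) nm fun t => A t ()) (cauchyName ν)
      fun s (_ : Unit) => v s.1.1 s.1.2.2) :
    Named nm (partialMapName ν) fun t u x => ⟨x ∈ A t u, fun _ => v t x⟩ := by
  obtain ⟨G, hG, hGv⟩ := hv
  obtain ⟨F, hF, hFG⟩ := Comp.curry (base := fun s : WithPoint ν fun t => A t () => s.1.1)
    (q := fun s => s.1.2.1) (fun _ => rfl) (G := fun s k => G s ((), k))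
    (hG.reindex (g := fun k => ((), k)) (by fun_prop))
  obtain ⟨C, hC, hCA⟩ := hA
  refine ⟨_, hF.ilv hC, fun t u => ⟨?_, ?_⟩⟩
  · simp only [left_ilv]
    rintro p x hp y ⟨hx, rfl⟩
    exact ⟨_, hFG ⟨(t, p, x), hp, hx⟩, hGv ⟨(t, p, x), hp, hx⟩ ()⟩
  · simp only [right_ilv]
    exact hCA t u

/-! ### From reductions to retractions -/

/-- The sequence `ι k - 1`, frozen before the first zero of `ι`. -/
def freeze (ι : ℕ → ℕ) (k : ℕ) : ℕ :=
  Nat.rec (ι 0 - 1) (fun k r => bif allBelow (fun i => !decide (ι i = 0)) (k + 2) then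
    ι (k + 1) - 1 else r) k

theorem freeze_succ (ι : ℕ → ℕ) (k : ℕ) : freeze ι (k + 1) =
    bif allBelow (fun i => !decide (ι i = 0)) (k + 2) then ι (k + 1) - 1 else freeze ι k := rfl

theorem freeze_succ_pos {ι : ℕ → ℕ} {k : ℕ} (h : ∀ i ≤ k + 1, ι i ≠ 0) :
    freeze ι (k + 1) = ι (k + 1) - 1 := by
  have : allBelow (fun i => !decide (ι i = 0)) (k + 2) = true :=
    allBelow_iff.2 fun i hi => by simpa using h i (by omega)
  rw [freeze_succ, this, cond_true]

theorem freeze_succ_neg {ι : ℕ → ℕ} {k : ℕ} (h : ¬ ∀ i ≤ k + 1, ι i ≠ 0) :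
    freeze ι (k + 1) = freeze ι k := by
  have : allBelow (fun i => !decide (ι i = 0)) (k + 2) = false := by
    rw [← Bool.not_eq_true, allBelow_iff]
    intro h'
    exact h fun i hi => by simpa using h' i (by omega)
  rw [freeze_succ, this, cond_false]

theorem freeze_of_pos {ι : ℕ → ℕ} {k : ℕ} (h : ∀ i ≤ k, ι i ≠ 0) : ι k = freeze ι k + 1 := by
  cases k with
  | zero => exact (Nat.succ_pred_eq_of_ne_zero (h 0 le_rfl)).symm
  | succ k =>
    rw [freeze_succ_pos h]
    exact (Nat.succ_pred_eq_of_ne_zero (h (k + 1) le_rfl)).symm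

theorem freeze_congr {ι κ : ℕ → ℕ} {k : ℕ} (h : ∀ i ≤ k, ι i = κ i) : freeze ι k = freeze κ k := by
  induction k with
  | zero => exact congrArg (· - 1) (h 0 le_rfl)
  | succ k ih =>
    by_cases hk : ∀ i ≤ k + 1, ι i ≠ 0
    · rw [freeze_succ_pos hk, freeze_succ_pos fun i hi => by rw [← h i hi]; exact hk i hi,
        h _ le_rfl]
    · rw [freeze_succ_neg hk, freeze_succ_neg fun hκ => hk fun i hi => by
        rw [h i hi]; exact hκ i hi]
      exact ih fun i hi => h i (by omega)

theorem computable_freeze : Computable fun z : List ℕ × ℕ => freeze (fun i => z.1.getD i 0) z.2 := by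
  refine Computable.nat_rec (h := fun (z : List ℕ × ℕ) (y : ℕ × ℕ) =>
    bif allBelow (fun i => !decide (z.1.getD i 0 = 0)) (y.1 + 2) then
    z.1.getD (y.1 + 1) 0 - 1 else y.2) Computable.snd (by fun_prop) (Computable₂.mk ?_)
  fun_prop

theorem Comp.freeze {F : T → ℕ → ℕ} (hF : Comp nm F) : Comp nm fun t k => freeze (F t) k := by
  have h : Comp nm fun t k => prefixOf (F t) (k + 1) :=
    (Comp.prefixes (F := fun t (z : Unit × ℕ) => F t z.2) (hF.reindex (by fun_prop))).reindex
      (g := fun k => ((), k + 1)) (by fun_prop)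
  refine (Comp.map computable_freeze (h.pair (Comp.of_computable (g := fun k => k)
    (by fun_prop)))).congr fun t k => freeze_congr fun i hi => ?_
  rw [getD_prefixOf (by omega)]

/-- The frozen sequence changes only at positions up to which no zero has occurred, so a later value
is either the old one or one that still approximates the point. -/
theorem exists_freeze_eq (ι : ℕ → ℕ) {k l : ℕ} (h : k ≤ l) :
    freeze ι l = freeze ι k ∨ ∃ l' ≥ k, (∀ i ≤ l', ι i ≠ 0) ∧ freeze ι l = freeze ι l' := by
  induction l, h using Nat.le_induction with
  | base => exact Or.inl rfl
  | succ l hl ih =>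
    by_cases hg : ∀ i ≤ l + 1, ι i ≠ 0
    · exact Or.inr ⟨l + 1, by omega, hg, rfl⟩
    · rwa [freeze_succ_neg hg]

/-- If `ι` has no zero, the points selected are within `2⁻ᵏ` of `x`, so they converge to `x`, which
lies in the closed set `B`. If `ι` has a zero, then `x ∉ B` and the sequence is eventually a
constant point of `B`. In both cases two changing terms are compared through `x`, whence the rate `2
* 2⁻ᵏ`. A zero at the start freezes the index `0`, which still selects a point of `B`. -/
theorem exists_freeze_limit {b : ℕ → X} {B : Set X} (hB : IsClosed B) (hb : ∀ j, b j ∈ B)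
    {ι : ℕ → ℕ} {x : X} (h0 : x ∈ B → ∀ k, ι k ≠ 0)
    (hι : ∀ k j, ι k = j + 1 → dist x (b j) < (2 : ℝ)⁻¹ ^ k) :
    ∃ y ∈ B, (∀ k, dist (b (freeze ι k)) y ≤ 2 * (2 : ℝ)⁻¹ ^ k) ∧ (x ∈ B → y = x) := by
  by_cases hall : ∀ k, ι k ≠ 0
  · have hd : ∀ k, dist (b (freeze ι k)) x < (2 : ℝ)⁻¹ ^ k := fun k => by
      rw [dist_comm]
      exact hι k _ (freeze_of_pos fun i _ => hall i)
    refine ⟨x, ?_, fun k => ?_, fun _ => rfl⟩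
    · refine hB.mem_of_tendsto (tendsto_iff_dist_tendsto_zero.2 (squeeze_zero
        (fun _ => dist_nonneg) (fun k => (hd k).le) (tendsto_pow_atTop_nhds_zero_of_lt_one
        (by norm_num) (by norm_num : (2 : ℝ)⁻¹ < 1)))) (Eventually.of_forall fun k => hb _)
    · have := hd k
      have : (0 : ℝ) < 2⁻¹ ^ k := by positivity
      linarith
  · obtain ⟨m, hm⟩ := not_forall_not.1 hall
    have hconst : ∀ l ≥ m, freeze ι l = freeze ι m := fun l hl => by
      rcases exists_freeze_eq ι hl with h | ⟨l', hl', h, -⟩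
      · exact h
      · exact absurd hm (h m hl')
    refine ⟨b (freeze ι m), hb _, fun k => ?_, fun hx => absurd hm (h0 hx m)⟩
    have hpos : (0 : ℝ) < 2⁻¹ ^ k := by positivity
    rcases le_total m k with hk | hk
    · rw [hconst k hk, dist_self]
      positivity
    · rcases exists_freeze_eq ι hk with h | ⟨l', hl', h, heq⟩
      · rw [h, dist_self]
        positivity
      · rw [heq]
        have h1 := hι k _ (freeze_of_pos fun i hi => h i (by omega))
        have h2 := hι l' _ (freeze_of_pos h)
        have h3 : (2 : ℝ)⁻¹ ^ l' ≤ 2⁻¹ ^ k :=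
          pow_le_pow_of_le_one (by norm_num) (by norm_num) hl'
        have := dist_triangle_left (b (freeze ι k)) (b (freeze ι l')) x
        linarith

/-- Zero-dimensionality makes the approximate nearest-point choice continuous: for each level `k`,
disjointness gives every point of `A` a unique piece independent of its name, hence a computable
index `ι`. Freezing keeps the selected points in `B` and convergent even when the point is
recognized as lying outside `B`; points of `B` never fall into the piece inside `Bᶜ` and so are
fixed. -/
theorem RetractComputable.of_SComputable (hν : IsComputableMetricSpace ν)
    (hneg : Reducible δ (closedName ν)) (hS : SComputable ν 𝒴 δ) : RetractComputable ν 𝒴 δ := by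
  refine Operation.isComputable_of_named (f := opRetract ν 𝒴) ?_
  have hin := Operation.Input.named (opRetract ν 𝒴)
    (prodName δ (meetName (rangeName ν) (distName ν)))
  have hA := hin.fst
  have hAc := hA.reduce hneg
  have hBd := hin.snd.meet_right.compl_of_dist hν
  obtain ⟨b, hb, hbB⟩ := hin.snd.meet_left.exists_dense_seq fun t _ => t.2.1.2.2.1
  generalize hnm : (fun t : (opRetract ν 𝒴).Input
    (prodName δ (meetName (rangeName ν) (distName ν))) => t.1.1) = nm at *
  -- Index `0` stands for the complement of `B`, and index `j + 1` for the ball around `b j`; thus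
  -- zero is the signal to freeze.
  have hU : Named nm (openName ν) fun t (y : (Unit × ℕ) × ℕ) => {z | y.2 = 0 ∧ z ∈ t.1.2.2ᶜ} ∪
      {z | y.2 ≠ 0 ∧ z ∈ Metric.ball (b t ((), y.2 - 1)) ((2 : ℝ)⁻¹ ^ y.1.2)} := by
    refine Named.union (Named.sep ?_ (hBd.reindex (Computable.const ()))) (Named.sep ?_
      (Named.ball hν (hb.reindex (g := fun y : (Unit × ℕ) × ℕ => ((), y.2 - 1)) (by fun_prop))
        (CRe.pow (Comp.of_computable (by fun_prop)))))
    · exact Comp.semi_eq (Comp.of_computable (by fun_prop)) (Comp.of_computable (by fun_prop))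
    · exact Comp.semi_ne (Comp.of_computable (by fun_prop)) (Comp.of_computable (by fun_prop))
  obtain ⟨W, hW, hWval⟩ := Operation.IsComputable.apply (f := opS 𝒴) hS
    ((Named.seq (y := fun t (y : Unit × ℕ) i => {z | i = 0 ∧ z ∈ t.1.2.2ᶜ} ∪
      {z | i ≠ 0 ∧ z ∈ Metric.ball (b t ((), i - 1)) ((2 : ℝ)⁻¹ ^ y.2)}) hU).prod
      (hA.reindex (g := fun _ : Unit × ℕ => ()) (by fun_prop)))
    (fun t y => ⟨fun i => hU.isOpen t (y, i), t.2.1.1, fun z _ => by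
      by_cases hz : z ∈ t.1.2.2
      · obtain ⟨_, ⟨j, rfl⟩, hj⟩ := Metric.mem_closure_iff.1 ((hbB t ()).2 hz)
          ((2 : ℝ)⁻¹ ^ y.2) (by positivity)
        exact mem_iUnion.2 ⟨j + 1, Or.inr ⟨Nat.succ_ne_zero j, hj⟩⟩
      · exact mem_iUnion.2 ⟨0, Or.inl ⟨rfl, hz⟩⟩⟩)
  have hex : ∀ t z k, ∃ i, z ∈ t.1.2.1 → z ∈ W t ((), k) i := fun t z k => by
    by_cases hz : z ∈ t.1.2.1
    · obtain ⟨i, hi⟩ := mem_iUnion.1 ((hWval t ((), k)).2.1 hz)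
      exact ⟨i, fun _ => hi⟩
    · exact ⟨0, fun h => absurd h hz⟩
  choose ι hι using hex
  let A : (opRetract ν 𝒴).Input (prodName δ (meetName (rangeName ν) (distName ν))) → Set X :=
    fun t => t.1.2.1
  -- Membership in a piece is semidecidable, and since exactly one piece contains the point it
  -- describes the graph of `ι`.
  have hιc : Comp (withPointName (ν := ν) nm A) fun s k => ι s.1.1 s.1.2.2 k := by
    have h : Semi (withPointName (ν := ν) nm A) fun s (y : ℕ × ℕ) =>
        s.1.2.2 ∈ W s.1.1 ((), y.1) y.2 :=
      Semi.mem hν ((hW.seq_apply.pullback (WithPoint.comp_base A)).reindex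
        (g := fun y : ℕ × ℕ => (((), y.1), y.2)) (by fun_prop))
        ((WithPoint.named A).reindex (Computable.const ()))
    refine h.congr fun s y => ⟨fun h => h ▸ hι s.1.1 s.1.2.2 y.1 s.2.2, fun h => ?_⟩
    by_contra hne
    exact Set.disjoint_left.1 ((hWval s.1.1 ((), y.1)).2.2 hne) (hι s.1.1 s.1.2.2 y.1 s.2.2) h
  have hlim : ∀ t z, ∃ y, z ∈ t.1.2.1 → y ∈ t.1.2.2 ∧
      (∀ k, dist (b t ((), freeze (ι t z) k)) y ≤ 2 * (2 : ℝ)⁻¹ ^ k) ∧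
      (z ∈ t.1.2.2 → y = z) := fun t z => by
    by_cases hz : z ∈ t.1.2.1
    · obtain ⟨y, hy⟩ := exists_freeze_limit t.2.1.2.1 (hbB t ()).1 (ι := ι t z) (x := z)
        (fun hzB k hk => by
          rcases ((hWval t ((), k)).1 _).2 (hι t z k hz) with h | h
          exacts [h.2 hzB, h.1 hk])
        (fun k j hkj => by
          rcases ((hWval t ((), k)).1 _).2 (hι t z k hz) with h | h
          · have h1 : ι t z k = 0 := h.1
            omega
          · have h1 := h.2
            rw [hkj] at h1
            exact h1)
      exact ⟨y, fun _ => hy⟩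
    · exact ⟨z, fun h => absurd h hz⟩
  choose v hv using hlim
  have hvn : Named (withPointName (ν := ν) nm A) (cauchyName ν)
      fun s (_ : Unit) => v s.1.1 s.1.2.2 := by
    refine Named.limit (y := fun s _ k => b s.1.1 ((), freeze (ι s.1.1 s.1.2.2) k)) ?_
      fun s _ k => (hv s.1.1 s.1.2.2 s.2.2).2.1 k
    exact (hb.pullback (WithPoint.comp_base A)).subst
      (G := fun s (y : Unit × ℕ) => ((), freeze (ι s.1.1 s.1.2.2) y.2))
      ((Comp.of_computable (Computable.const ())).pair (hιc.freeze.reindex (by fun_prop)))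
  have hf := Named.of_map hAc hvn
  refine ⟨_, hf, fun t => ?_⟩
  obtain ⟨F, -, hF⟩ := hf
  have hcl : IsClosed t.1.2.1 := ⟨hAc.compl.isOpen t ()⟩
  refine ⟨⟨hcl, _, (hF t ()).1⟩, rfl, ?_, fun z hz => ⟨t.2.1.2.2.2.1 hz, ?_⟩⟩
  · ext y
    constructor
    · rintro ⟨z, hz, rfl⟩
      exact (hv t z hz).1
    · exact fun hy => ⟨y, t.2.1.2.2.2.1 hy, (hv t y (t.2.1.2.2.2.1 hy)).2.2 hy⟩
  · exact (hv t z (t.2.1.2.2.2.1 hz)).2.2 hz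

end Retraction
section Separation

variable {X : Type*} [MetricSpace X] {ν : ℕ → X} {T : Type*} {nm : T → Baire}
  {𝒴 : Set (Set X)} {δ : Naming (Set X)}

/-! ### From retractions to separations -/

/-- Retract `Y ∪ {x, y}` onto `{x, y}`. The fibres over `x` and `y` partition the domain and are
relatively open as the sets where the value differs from `y` and from `x`. Extending them to open
sets of `X` and disjointifying gives the separation. -/
theorem Named.exists_separation (hν : IsComputableMetricSpace ν)
    (hγ_mem : ∀ x, ∀ Y ∈ 𝒴, insert x Y ∈ 𝒴)
    (hγ : (opAddPoint 𝒴).IsComputable (prodName (cauchyName ν) δ) δ)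
    (hR : RetractComputable ν 𝒴 δ) (hX : ∀ x y : X, ({x, y} : Set X) ≠ univ)
    {x y : T → Unit → X} {Y : T → Unit → Set X} (hx : Named nm (cauchyName ν) x)
    (hy : Named nm (cauchyName ν) y) (hY : Named nm δ Y) (hmem : ∀ t, Y t () ∈ 𝒴)
    (hxy : ∀ t, x t () ≠ y t ()) :
    ∃ V W : T → Unit → Set X, Named nm (openName ν) V ∧ Named nm (openName ν) W ∧
      ∀ t, Disjoint (V t ()) (W t ()) ∧ Y t () ⊆ V t () ∪ W t () ∧ x t () ∈ V t () ∧
        y t () ∈ W t () := by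
  have hY1 : Named nm δ fun t a => insert (y t a) (insert (x t a) (Y t a)) :=
    Named.ofFun hγ (hy.prod (Named.ofFun hγ (hx.prod hY) fun t _ => hmem t))
      fun t _ => hγ_mem _ _ (hmem t)
  obtain ⟨f, hf, hfval⟩ := Operation.IsComputable.apply (f := opRetract ν 𝒴) hR
    (hY1.prod ((hx.pair_range hy).meet (hx.pair_dist hν hy)))
    (fun t _ => ⟨hγ_mem _ _ (hγ_mem _ _ (hmem t)), (Set.toFinite _).isClosed,
      insert_nonempty _ _, insert_subset (mem_insert_of_mem _ (mem_insert _ _))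
        (singleton_subset_iff.2 (mem_insert _ _)), hX _ _⟩)
  let A : T → Set X := fun t => insert (y t ()) (insert (x t ()) (Y t ()))
  have hex : ∀ t z, ∃ w, z ∈ A t → w ∈ f t () z := fun t z => by
    by_cases hz : z ∈ A t
    · have h1 : z ∈ (f t ()).Dom := by
        rw [(hfval t ()).2.1]
        exact hz
      exact ⟨_, fun _ => Part.get_mem h1⟩
    · exact ⟨z, fun h => absurd h hz⟩
  choose v hv using hex
  have hvn := hf.map_apply hv
  have hb := WithPoint.comp_base (ν := ν) (nm := nm) A
  -- On `A`, `O` is the fibre over `x` and `O'` the fibre over `y`. They may overlap only outside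
  -- `A`, so disjointifying loses no point of `A`.
  obtain ⟨O, hO, hOv⟩ := Semi.exists_open hν (nm := nm) (A := A)
    (Q := fun t z => 0 < dist (v t z) (y t ()))
    (CRe.zero.lt (CRe.dist hν hvn (hy.pullback hb)))
  obtain ⟨O', hO', hOv'⟩ := Semi.exists_open hν (nm := nm) (A := A)
    (Q := fun t z => 0 < dist (v t z) (x t ()))
    (CRe.zero.lt (CRe.dist hν hvn (hx.pullback hb)))
  obtain ⟨V, W, hV, hW, hVW⟩ := Named.exists_disjoint hν hO hO'
  refine ⟨V, W, hV, hW, fun t => ?_⟩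
  obtain ⟨hdis, -, -, hOV, hOW⟩ := hVW t ()
  have hran : ∀ z ∈ A t, v t z = x t () ∨ v t z = y t () := fun z hz => by
    have h1 : v t z ∈ (f t ()).ran := ⟨z, hv t z hz⟩
    rw [(hfval t ()).2.2.1] at h1
    exact h1
  have hxV : ∀ z ∈ A t, v t z = x t () → z ∈ V t () := fun z hz h => by
    refine hOV ⟨(hOv t z hz).2 (by rw [h]; exact dist_pos.2 (hxy t)), fun h' => ?_⟩
    have := (hOv' t z hz).1 h'
    rw [h, dist_self] at this
    exact lt_irrefl _ this
  have hyW : ∀ z ∈ A t, v t z = y t () → z ∈ W t () := fun z hz h => by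
    refine hOW ⟨(hOv' t z hz).2 (by rw [h]; exact dist_pos.2 (hxy t).symm), fun h' => ?_⟩
    have := (hOv t z hz).1 h'
    rw [h, dist_self] at this
    exact lt_irrefl _ this
  have hxA : x t () ∈ A t := mem_insert_of_mem _ (mem_insert _ _)
  have hyA : y t () ∈ A t := mem_insert _ _
  refine ⟨hdis, fun z hz => ?_, hxV _ hxA ?_, hyW _ hyA ?_⟩
  · have hzA : z ∈ A t := mem_insert_of_mem _ (mem_insert_of_mem _ hz)
    exact (hran z hzA).imp (hxV z hzA) (hyW z hzA)
  · exact Part.mem_unique (hv t _ hxA) ((hfval t ()).2.2.2 _ (mem_insert _ _))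
  · exact Part.mem_unique (hv t _ hyA) ((hfval t ()).2.2.2 _ (mem_insert_of_mem _ rfl))

/-- A space with at most two points is uniformly discrete: for a constant `k` depending only on `X`,
the ball of radius `2⁻ᵏ` around `x` is `{x}`. This covers the spaces in which a two-point set is not
admissible as the image for `E'`. -/
theorem MComputable.of_pair_eq_univ (hν : IsComputableMetricSpace ν) {a b : X}
    (hX : ({a, b} : Set X) = univ) : MComputable ν 𝒴 δ := by
  refine Operation.isComputable_of_named (f := opM 𝒴) ?_
  have hin := Operation.Input.named (opM 𝒴) (prodName (cauchyName ν) (prodName (openName ν) δ))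
  have hx := hin.fst
  obtain ⟨k, hk⟩ : ∃ k : ℕ, ∀ x y : X, dist x y < (2 : ℝ)⁻¹ ^ k → x = y := by
    have hX' : ∀ x : X, x = a ∨ x = b := fun x => by
      have : x ∈ ({a, b} : Set X) := hX ▸ mem_univ x
      exact this
    by_cases hab : a = b
    · refine ⟨0, fun x y _ => ?_⟩
      rcases hX' x with rfl | rfl <;> rcases hX' y with rfl | rfl <;> simp_all
    · obtain ⟨k, hk⟩ := exists_pow_lt (dist_pos.2 hab)
      refine ⟨k, fun x y h => ?_⟩
      rcases hX' x with rfl | rfl <;> rcases hX' y with rfl | rfl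
      · rfl
      · exact absurd (h.trans hk) (lt_irrefl _)
      · rw [dist_comm] at h
        exact absurd (h.trans hk) (lt_irrefl _)
      · rfl
  have hV : Named (fun t : (opM 𝒴).Input (prodName (cauchyName ν) (prodName (openName ν) δ)) =>
      t.1.1) (openName ν) fun t (_ : Unit) => Metric.ball t.1.2.1 ((2 : ℝ)⁻¹ ^ k) :=
    Named.ball hν hx (CRe.pow (G := fun _ _ => k) (Comp.of_computable (by fun_prop)))
  have hW := Named.far hν hx CRe.zero
  refine ⟨_, hV.prod hW, fun t => ⟨hV.isOpen t (), hW.isOpen t (),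
    Metric.mem_ball_self (by positivity), fun z hz => ?_, fun z _ => ?_,
    Set.disjoint_left.2 fun z hz hz' => ?_⟩⟩
  · rw [hk _ _ hz]
    exact t.2.1.2.2
  · by_cases h : t.1.2.1 = z
    · exact Or.inl (h ▸ Metric.mem_ball_self (by positivity))
    · exact Or.inr (dist_pos.2 h)
  · have h1 : (0 : ℝ) < dist t.1.2.1 z := hz'
    rw [hk _ _ hz, dist_self] at h1
    exact lt_irrefl _ h1

/-! ### From separations and compactness to `M` -/

theorem computable_listMap_fst {α β : Type} [Primcodable α] [Primcodable β] :
    Computable fun l : List (α × β) => l.map Prod.fst :=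
  (Primrec.list_map Primrec.id (Primrec.fst.comp Primrec.snd).to₂).to_comp

/-- Choose a closed ball around `x` of radius `r = 2⁻ⁿ` inside `U`. The compact trace of `Y` on it
is covered by ideal balls formally inside the open ball and by balls inside sets `W` of separations
of `x` from other points. Take a finite such cover; let the first set be the open ball intersected
with the finitely many `V`, and the second the exterior of the closed ball united with the
corresponding `W`. Points of `Y` on the sphere are caught by some `W`, so nothing of `Y` is left
over. -/
theorem MComputable.of_RetractComputable (hν : IsComputableMetricSpace ν)
    (hγ_mem : ∀ x, ∀ Y ∈ 𝒴, insert x Y ∈ 𝒴)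
    (hγ : (opAddPoint 𝒴).IsComputable (prodName (cauchyName ν) δ) δ)
    (hβ : (opBall 𝒴).IsComputable (prodName (cauchyName ν) (prodName natName δ))
      (minCoverName ν)) (hR : RetractComputable ν 𝒴 δ) : MComputable ν 𝒴 δ := by
  by_cases hX : ∀ x y : X, ({x, y} : Set X) ≠ univ
  swap
  · obtain ⟨a, ha⟩ := not_forall.1 hX
    obtain ⟨b, hb⟩ := not_forall_not.1 ha
    exact MComputable.of_pair_eq_univ hν hb
  refine Operation.isComputable_of_named (f := opM 𝒴) ?_
  have hin := Operation.Input.named (opM 𝒴) (prodName (cauchyName ν) (prodName (openName ν) δ))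
  have hx := hin.fst
  have hU := hin.snd.fst
  have hY := hin.snd.snd
  generalize hnm : (fun t : (opM 𝒴).Input (prodName (cauchyName ν) (prodName (openName ν) δ)) =>
    t.1.1) = nm at *
  -- a radius `2⁻ⁿ` such that the closed ball lies in the open set
  obtain ⟨E, hE, hEU⟩ := hU.exists_semi
  have hn : ∀ t u, ∃ n c : ℕ, E t (u, c) ∧ dist t.1.2.1 (ν c.unpair.1) + (2 : ℝ)⁻¹ ^ n <
      ((posRat c.unpair.2 : ℚ) : ℝ) := fun t u => by
    obtain ⟨c, hc, hxc⟩ := (hEU t u _).1 t.2.1.2.2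
    obtain ⟨n, hn⟩ := exists_pow_lt (sub_pos.2 (mem_idealBall.1 hxc))
    exact ⟨n, c, hc, by linarith⟩
  have hnS : Semi nm fun t (y : Unit × ℕ) => ∃ c : ℕ, E t (y.1, c) ∧
      dist t.1.2.1 (ν c.unpair.1) + (2 : ℝ)⁻¹ ^ y.2 < ((posRat c.unpair.2 : ℚ) : ℝ) := by
    have hc : Comp nm fun _ (y : (Unit × ℕ) × ℕ) => y.2 := Comp.of_computable (by fun_prop)
    refine Semi.ex (Semi.and (hE.reindex (by fun_prop)) (CRe.lt (CRe.add ?_ (CRe.pow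
      (Comp.of_computable (by fun_prop)))) (CRe.radius hc)))
    exact CRe.dist_center hν (hx.reindex (Computable.const ())) hc
  obtain ⟨n, hnc, hnP⟩ := Semi.choose hnS hn
  have hr : CRe nm fun t u => (2 : ℝ)⁻¹ ^ n t u := CRe.pow hnc
  have hK := Named.ofFun hβ (hx.prod ((Named.nat hnc).prod hY)) fun t _ => t.2.1.2.1
  -- separating the center from all other points
  let A : (opM 𝒴).Input (prodName (cauchyName ν) (prodName (openName ν) δ)) → Set X :=
    fun t => {z | 0 < dist t.1.2.1 z}
  have hA : Named nm (openName ν) fun t (_ : Unit) => A t := Named.far hν hx CRe.zero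
  have hb := WithPoint.comp_base (ν := ν) (nm := nm) A
  obtain ⟨V, W, hV, hW, hVW⟩ := Named.exists_separation hν hγ_mem hγ hR hX (hx.pullback hb)
    (WithPoint.named A) (hY.pullback hb) (fun s => s.1.1.2.1.2.1) (fun s => dist_pos.1 s.2.2)
  have hV2 := Named.pull_task hν hA hV
  have hW2 := Named.pull_task hν hA hW
  obtain ⟨E2, hE2, hE2W⟩ := hW2.exists_semi
  -- a finite cover of the compact set
  let Ok : (opM 𝒴).Input (prodName (cauchyName ν) (prodName (openName ν) δ)) →
      ℕ × ℕ × List ℕ → Prop := fun t e =>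
    (e.2.1 = 0 ∧ dist t.1.2.1 (ν e.1.unpair.1) + ((posRat e.1.unpair.2 : ℚ) : ℝ) <
      (2 : ℝ)⁻¹ ^ n t ()) ∨ (e.2.1 ≠ 0 ∧ Task ν A t e.2.2 ∧ E2 t (e.2.2, e.1))
  have hOk : Semi nm Ok := by
    have hc : Comp nm fun _ (e : ℕ × ℕ × List ℕ) => e.1 := Comp.of_computable (by fun_prop)
    refine Semi.or (Semi.and ?_ ?_) (Semi.and ?_ (Semi.and ?_ ?_))
    · exact Comp.semi_eq (Comp.of_computable (by fun_prop)) (Comp.of_computable (by fun_prop))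
    · exact ((CRe.dist_center hν (hx.reindex (Computable.const ())) hc).add
        (CRe.radius hc)).lt (hr.reindex (Computable.const ()))
    · exact Comp.semi_ne (Comp.of_computable (by fun_prop)) (Comp.of_computable (by fun_prop))
    · exact (Task.semi hν hA).reindex (g := fun e : ℕ × ℕ × List ℕ => e.2.2) (by fun_prop)
    · exact hE2.reindex (g := fun e : ℕ × ℕ × List ℕ => (e.2.2, e.1)) (by fun_prop)
  obtain ⟨F, hF, hFK⟩ := hK
  -- An entry `(c, flag, σ)` records the ball `c` and the reason for using it: flag `0` for formal
  -- inclusion in the open ball, a nonzero flag for a ball listed in the set `W` of task `σ`. The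
  -- search looks for reasons attached to a cover listed by the minimal cover name, which certifies
  -- that it covers.
  have hcover : ∀ t u, ∃ l : List (ℕ × ℕ × List ℕ),
      (∃ i, F t (u, i) = Encodable.encode (l.map Prod.fst)) ∧
        ∀ i < l.length, ∃ e, l[i]? = some e ∧ Ok t e := by
    intro t u
    obtain ⟨hcomp, hrange⟩ := hFK t u
    have he : ∀ z, ∃ e, z ∈ t.1.2.2.2 ∩ Metric.closedBall t.1.2.1 ((2 : ℝ)⁻¹ ^ n t u) →
        Ok t e ∧ z ∈ idealBall ν e.1 := fun z => by
      by_cases hz : z ∈ t.1.2.2.2 ∩ Metric.closedBall t.1.2.1 ((2 : ℝ)⁻¹ ^ n t u)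
      · have hzd : dist z t.1.2.1 ≤ (2 : ℝ)⁻¹ ^ n t u := hz.2
        -- Interior points, among them possibly `x`, use a small ball in the open ball. A point on
        -- the sphere differs from `x`, so a separation is available.
        rcases hzd.lt_or_eq with hlt | heq
        · obtain ⟨c, h1, h2, h3⟩ := exists_idealBall hν.dense z
            (show 0 < ((2 : ℝ)⁻¹ ^ n t u - dist z t.1.2.1) / 2 by linarith)
          refine ⟨(c, 0, []), fun _ => ⟨Or.inl ⟨rfl, ?_⟩, h1⟩⟩
          have := dist_triangle_left t.1.2.1 (ν c.unpair.1) z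
          simp only
          linarith
        · obtain ⟨q, hq⟩ := exists_cauchyName hν.dense z
          have hzA : z ∈ A t := by
            rw [mem_ofPred_eq, dist_comm, heq]
            positivity
          obtain ⟨σ, h, hσ⟩ := Task.exists_mem (fun t => hA.isOpen t ()) hW
            (s := ⟨(t, q, z), hq, hzA⟩) (hVW _).2.2.2
          obtain ⟨c, hc, hzc⟩ := (hE2W t σ z).1 ⟨h, hσ⟩
          exact ⟨(c, 1, σ), fun _ => ⟨Or.inr ⟨one_ne_zero, h, hc⟩, hzc⟩⟩
      · exact ⟨(0, 0, []), fun h => absurd h hz⟩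
    choose e he using he
    obtain ⟨s, hs, hsK⟩ := hcomp.elim_nhds_subcover (fun z => idealBall ν (e z).1)
      fun z hz => Metric.isOpen_ball.mem_nhds (he z hz).2
    refine ⟨s.toList.map e, ?_, fun i hi => ⟨_, List.getElem?_eq_getElem hi, ?_⟩⟩
    · have hw : Encodable.encode ((s.toList.map e).map Prod.fst) ∈ range fun k => F t (u, k) := by
        rw [hrange]
        refine ⟨_, rfl, fun z hz => ?_, fun b hb => ?_⟩
        · obtain ⟨y, hy, hzy⟩ := mem_iUnion₂.1 (hsK hz)
          exact mem_iUnion₂.2 ⟨(e y).1, List.mem_map.2 ⟨e y, List.mem_map.2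
            ⟨y, Finset.mem_toList.2 hy, rfl⟩, rfl⟩, hzy⟩
        · obtain ⟨_, hb', rfl⟩ := List.mem_map.1 hb
          obtain ⟨y, hy, rfl⟩ := List.mem_map.1 hb'
          have hyK := hs y (Finset.mem_toList.1 hy)
          exact ⟨y, (he y hyK).2, hyK⟩
      exact hw
    · obtain ⟨y, hy, hye⟩ := List.mem_map.1 (List.getElem_mem hi)
      rw [← hye]
      exact (he y (hs y (Finset.mem_toList.1 hy))).1
  have hcoverS : Semi nm fun t (y : Unit × List (ℕ × ℕ × List ℕ)) =>
      (∃ i, F t (y.1, i) = Encodable.encode (y.2.map Prod.fst)) ∧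
        ∀ i < y.2.length, ∃ e, y.2[i]? = some e ∧ Ok t e := by
    have h1 : Semi nm fun t (y : (Unit × List (ℕ × ℕ × List ℕ)) × ℕ) =>
        F t (y.1.1, y.2) = Encodable.encode (y.1.2.map Prod.fst) :=
      Comp.semi_eq (hF.reindex (g := fun y : (Unit × List (ℕ × ℕ × List ℕ)) × ℕ =>
        (y.1.1, y.2)) (by fun_prop)) (Comp.of_computable (Computable.encode.comp
        (computable_listMap_fst.comp (Computable.snd.comp Computable.fst))))
    have h2 : Semi nm fun t (y : ((Unit × List (ℕ × ℕ × List ℕ)) × ℕ) × (ℕ × ℕ × List ℕ)) =>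
        y.1.1.2[y.1.2]? = some y.2 :=
      Comp.semi_eq (Comp.of_computable (computable_getElem? (Computable.snd.comp
        (Computable.fst.comp Computable.fst)) (Computable.snd.comp Computable.fst)))
        (Comp.of_computable (Computable.option_some.comp Computable.snd))
    have h3 : Semi nm fun t (y : (Unit × List (ℕ × ℕ × List ℕ)) × ℕ) =>
        ∃ e, y.1.2[y.2]? = some e ∧ Ok t e :=
      Semi.ex (P := fun t (y : (Unit × List (ℕ × ℕ × List ℕ)) × ℕ) e =>
        y.1.2[y.2]? = some e ∧ Ok t e) (h2.and (hOk.reindex Computable.snd))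
    exact (Semi.ex (P := fun t (y : Unit × List (ℕ × ℕ × List ℕ)) i =>
      F t (y.1, i) = Encodable.encode (y.2.map Prod.fst)) h1).and
      (Semi.allLt (P := fun t (y : Unit × List (ℕ × ℕ × List ℕ)) i =>
        ∃ e, y.2[i]? = some e ∧ Ok t e) h3 (n := fun y => y.2.length)
        (Computable.list_length.comp Computable.snd))
  obtain ⟨L, hL, hLP⟩ := Semi.choose hcoverS hcover
  have hLn : Comp nm fun t (u : Unit) => (L t u).length := Comp.map Computable.list_length hL
  have hLe : Semi nm fun t (y : ℕ × (ℕ × ℕ × List ℕ)) => (L t ())[y.1]? = some y.2 := by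
    refine Comp.semi_eq ?_ (Comp.of_computable (Computable.option_some.comp Computable.snd))
    exact Comp.map₂ (g := fun (l : List (ℕ × ℕ × List ℕ)) (i : ℕ) => l[i]?)
      (computable_getElem? Computable.fst Computable.snd)
      (hL.reindex (g := fun _ => ()) (Computable.const ())) (Comp.of_computable Computable.fst)
  have hflag : Semi nm fun _ (e : ℕ × ℕ × List ℕ) => e.2.1 = 0 :=
    Comp.semi_eq (Comp.of_computable (by fun_prop)) (Comp.of_computable (by fun_prop))
  have hflag' : Semi nm fun _ (e : ℕ × ℕ × List ℕ) => e.2.1 ≠ 0 :=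
    Comp.semi_ne (Comp.of_computable (by fun_prop)) (Comp.of_computable (by fun_prop))
  -- the two open sets
  have hV3 := (Named.sep hflag ((Named.whole (nm := nm) (α := Unit) hν.dense).reindex
    (g := fun _ : ℕ × ℕ × List ℕ => ()) (Computable.const ()))).union
    (hV2.reindex (g := fun e : ℕ × ℕ × List ℕ => e.2.2) (by fun_prop))
  -- An entry with flag `0` needs no separation and therefore contributes the whole space to the
  -- finite intersection.
  let V3 : (opM 𝒴).Input (prodName (cauchyName ν) (prodName (openName ν) δ)) →
      ℕ × ℕ × List ℕ → Set X := fun t e => {z | e.2.1 = 0 ∧ z ∈ (univ : Set X)} ∪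
    {z | ∃ h : Task ν A t e.2.2, z ∈ V (Task.point t e.2.2 h) ()}
  have hV4 := Named.biUnion
    (P := fun t (y : Unit × ℕ) (e : ℕ × ℕ × List ℕ) => (L t ())[y.2]? = some e)
    (hLe.reindex (g := fun y : (Unit × ℕ) × (ℕ × ℕ × List ℕ) => (y.1.2, y.2)) (by fun_prop))
    (U := fun t _ e => V3 t e)
    (hV3.reindex (g := fun y : (Unit × ℕ) × (ℕ × ℕ × List ℕ) => y.2) (by fun_prop))
  have hV5 := Named.biInter hν hLn (U := fun t (_ : Unit) (i : ℕ) =>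
    {z | ∃ e, (L t ())[i]? = some e ∧ z ∈ V3 t e}) hV4
  have hV0 := Named.inter hν (Named.ball hν hx hr) hV5
  have hW3 := Named.biUnion
    (P := fun t (_ : Unit) (b : ℕ × (ℕ × ℕ × List ℕ)) =>
      (L t ())[b.1]? = some b.2 ∧ b.2.2.1 ≠ 0)
    ((hLe.and (hflag'.reindex Computable.snd)).reindex
      (g := fun y : Unit × (ℕ × (ℕ × ℕ × List ℕ)) => y.2) (by fun_prop))
    (U := fun t _ b => {z | ∃ h : Task ν A t b.2.2.2, z ∈ W (Task.point t b.2.2.2 h) ()})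
    (hW2.reindex (g := fun y : Unit × (ℕ × (ℕ × ℕ × List ℕ)) => y.2.2.2.2) (by fun_prop))
  have hW0 := (Named.far hν hx hr).union hW3
  have hlist : ∀ t, ∀ i < (L t ()).length, ∃ e, (L t ())[i]? = some e ∧ Ok t e := fun t =>
    (hLP t ()).2
  refine ⟨_, hV0.prod hW0, fun t => ⟨hV0.isOpen t (), hW0.isOpen t (),
    ⟨Metric.mem_ball_self (by positivity), fun i hi => ?_⟩, fun z hz => ?_, fun z hz => ?_,
    Set.disjoint_left.2 fun z hz hz' => ?_⟩⟩
  · obtain ⟨e, he, hok⟩ := hlist t i hi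
    rcases hok with hok | hok
    · exact ⟨e, he, Or.inl ⟨hok.1, mem_univ _⟩⟩
    · exact ⟨e, he, Or.inr ⟨hok.2.1, (hVW (Task.point t e.2.2 hok.2.1)).2.2.1⟩⟩
  · obtain ⟨c, hc, hlt⟩ := hnP t ()
    refine (hEU t () z).2 ⟨c, hc, mem_idealBall.2 ?_⟩
    have h1 : dist z t.1.2.1 < (2 : ℝ)⁻¹ ^ n t () := hz.1
    have h2 := dist_triangle z t.1.2.1 (ν c.unpair.1)
    linarith
  · by_cases hfar : (2 : ℝ)⁻¹ ^ n t () < dist t.1.2.1 z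
    · exact Or.inr (Or.inl hfar)
    by_cases hzW : z ∈ {z | ∃ b : ℕ × (ℕ × ℕ × List ℕ), ((L t ())[b.1]? = some b.2 ∧
        b.2.2.1 ≠ 0) ∧ z ∈ {z | ∃ h : Task ν A t b.2.2.2, z ∈ W (Task.point t b.2.2.2 h) ()}}
    · exact Or.inr (Or.inr hzW)
    refine Or.inl ⟨?_, fun i hi => ?_⟩
    -- The point is in the closed ball and in none of the sets `W`; the ball of the finite cover
    -- containing it must then have flag `0`, which puts the point in the open ball.
    · obtain ⟨k, hk⟩ := (hLP t ()).1
      obtain ⟨w, hw, hcov, -⟩ := (hFK t ()).2.subset (mem_range_self k)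
      obtain rfl := Encodable.encode_injective (hk.symm.trans hw)
      have hzK : z ∈ t.1.2.2.2 ∩ Metric.closedBall t.1.2.1 ((2 : ℝ)⁻¹ ^ n t ()) :=
        ⟨hz, by rw [Metric.mem_closedBall, dist_comm]; exact not_lt.1 hfar⟩
      obtain ⟨b, hb, hzb⟩ := mem_iUnion₂.1 (hcov hzK)
      obtain ⟨e, he, rfl⟩ := List.mem_map.1 hb
      obtain ⟨i, hi, rfl⟩ := List.mem_iff_getElem.1 he
      obtain ⟨e, he', hok⟩ := hlist t i hi
      rw [List.getElem?_eq_getElem hi, Option.some_inj] at he'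
      rw [he'] at hzb
      rcases hok with hok | hok
      · have h1 := mem_idealBall.1 hzb
        have h2 := dist_triangle_right z t.1.2.1 (ν e.1.unpair.1)
        rw [Metric.mem_ball]
        linarith [hok.2]
      · exact absurd ⟨(i, e), ⟨by rw [List.getElem?_eq_getElem hi, he'], hok.1⟩,
          (hE2W t e.2.2 z).2 ⟨_, hok.2.2, hzb⟩⟩ hzW
    · obtain ⟨e, he, hok⟩ := hlist t i hi
      rcases hok with hok | hok
      · exact ⟨e, he, Or.inl ⟨hok.1, mem_univ _⟩⟩
      · refine ⟨e, he, Or.inr ⟨hok.2.1, ((hVW (Task.point t e.2.2 hok.2.1)).2.1 hz).resolve_right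
          fun h => hzW ⟨(i, e), ⟨he, hok.1⟩, hok.2.1, h⟩⟩⟩
  · rcases hz' with hz' | ⟨b, ⟨hb, hb0⟩, h, hbW⟩
    · have h1 : dist z t.1.2.1 < (2 : ℝ)⁻¹ ^ n t () := hz.1
      rw [dist_comm] at h1
      exact lt_asymm h1 hz'
    · obtain ⟨e, he, heV⟩ := hz.2 b.1 (List.getElem?_eq_some_iff.1 hb).1
      obtain rfl : e = b.2 := Option.some_inj.1 (he.symm.trans hb)
      rcases heV with heV | ⟨h', heV⟩
      · exact hb0 heV.1
      · exact Set.disjoint_left.1 (hVW (Task.point t b.2.2.2 h)).1 heV hbW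

end Separation
end TTE

/-! ### Assembling the equivalences -/

theorem mainTheorem3 {X : Type*} [MetricSpace X] (ν : ℕ → X)
    (hν : TTE.IsComputableMetricSpace ν)
    (𝒴 : Set (Set X)) (δ : TTE.Naming (Set X)) (hδ : TTE.IsRepresentation δ 𝒴)
    (h𝒴 : ∀ A ∈ 𝒴, IsClosed A ∧ HasSmallInductiveDimensionLE A 0)
    (hneg : TTE.Reducible δ (TTE.closedName ν))
    (hγ_mem : ∀ x, ∀ Y ∈ 𝒴, insert x Y ∈ 𝒴)
    (hγ : (TTE.opAddPoint 𝒴).IsComputable (TTE.prodName (TTE.cauchyName ν) δ) δ)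
    (hβ_mem : ∀ (x : X) (n : ℕ), ∀ Y ∈ 𝒴,
      IsCompact (Y ∩ Metric.closedBall x ((2 : ℝ)⁻¹ ^ n)))
    (hβ : (TTE.opBall 𝒴).IsComputable
      (TTE.prodName (TTE.cauchyName ν) (TTE.prodName TTE.natName δ)) (TTE.minCoverName ν)) :
    (TTE.RetractComputable ν 𝒴 δ ↔ TTE.UniformlyEffectivelyZeroDimensional ν 𝒴 δ) ∧
      [TTE.NComputable ν 𝒴 δ, TTE.MComputable ν 𝒴 δ, TTE.BComputable ν 𝒴 δ,
        TTE.SComputable ν 𝒴 δ].TFAE := by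
  refine ⟨⟨fun h => TTE.SComputable.of_MComputable hν
    (TTE.MComputable.of_RetractComputable hν hγ_mem hγ hβ h),
    TTE.RetractComputable.of_SComputable hν hneg⟩, ?_⟩
  tfae_have 4 → 1 := TTE.NComputable.of_SComputable hν hneg
  tfae_have 1 → 2 := TTE.MComputable.of_NComputable hν
  tfae_have 2 → 4 := TTE.SComputable.of_MComputable hν
  tfae_have 4 → 3 := TTE.BComputable.of_SComputable hν
  tfae_have 3 → 4 := TTE.SComputable.of_BComputable hν
  tfae_finish
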